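/- **Setting.** Let $\ell\ge 1$, $n\ge 0$ be integers and $\zeta\in\mathbf C$ a primitive $\ell$-th root of unity. $G(\ell,1,n)=(\mathbf Z/\ell)^n\rtimes S_n$ is the group of monomial $n\times n$ matrices with entries in the $\ell$-th roots of unity, $\zeta_i$ is the diagonal matrix with $\zeta$ in position $i$ and ones elsewhere, $s_{ij}$ is the transposition matrix and $s_i=s_{i,i+1}$. The degenerate affine Hecke algebra $H_{\ell,n}$ is the $\mathbf C$-algebra generated by $\mathbf C[u_1,\dots,u_n]$ and $G(\ell,1,n)$ subject to $$\zeta_iu_j=u_j\zeta_i,\qquad s_iu_j=u_js_i\ (j\ne i,i+1),\qquad s_iu_i=u_{i+1}s_i-\sum_{k=0}^{\ell-1}\zeta_i^k\zeta_{i+1}^{-k}.$$ Let $\mathfrak u\subseteq H_{\ell,n}$ be the subalgebra generated by the $u_i$ and $\zeta_i$; a module is $\mathfrak u$-diagonalizable if it has a basis of simultaneous eigenvectors for $\mathfrak u$. **Shapes.** A skew shape is a finite set $D\subset\mathbf C^2$ of boxes such that (i) if $(x,y)\in D$ and $(x+k,y+l)\in D$ with integers $k,l\ge0$, then $(x+k',y+l')\in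 D$ for all integers $0\le k'\le k$, $0\le l'\le l$; (ii) if $(x,y),(x',y')\in D$ and $(x'-y')-(x-y)\in\{0,1\}$, then $(x'-x,\,y'-y)\in\mathbf Z^2$ (automatic if $D\subset\mathbf Z^2$). An $\ell$-skew shape is a sequence $D=(D^0,\dots,D^{\ell-1})$ of skew shapes; a box $b=(x,y)$ of $D^j$ has content $\mathrm{ct}(b)=x-y$ and coordinate $\beta(b)=j\in\mathbf Z/\ell$. Two boxes of the same $D^j$ are adjacent if they differ by $\pm(1,0)$ or $\pm(0,1)$; the connected components of $D$ are the classes of the equivalence relation generated by adjacency. A diagonal slide translates each connected component by a vector $(\kappa,\kappa)$, $\kappa\in\mathbf C$ depending on the component, the result being again an $\ell$-skew shape. For $D$ with $n$ boxes, a standard Young tableau on $D$ is a bijection $T$ from the boxes of $D$ to $\{1,\dots,n\}$ with $T(b)\le T(c)$ whenever $b=(x,y)$ and $c=(x+k,y+l)$ are boxes of the same $D^j$ with integers $k,l\ge 0$. **The modules $S^D$.** For an $\ell$-partition $\lambda$ of $n$ (boxes $(x,y)$ with $1\le x\le\lambda^j_y$), $S^\lambda$ is the irreducible $G(\ell,1,n)$-module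 with basis $v_T$, $T$ a standard tableau on $\lambda$, given by Young's seminormal form: $\zeta_iv_T=\zeta^{\beta(T^{-1}(i))}v_T$; $s_iv_T=v_{s_iT}$ if $T^{-1}(i)$ and $T^{-1}(i+1)$ have different coordinates, and otherwise $s_iv_T=\frac1d v_T+(1+\frac1d)v_{s_iT}$, $d=\mathrm{ct}(T^{-1}(i+1))-\mathrm{ct}(T^{-1}(i))$, where $v_{s_iT}=0$ if $s_iT$ is not standard. For $\ell$-partitions $\mu\subseteq\lambda$ of $m$ and $m+n$, the algebra $H_{\ell,n}$ acts on $S^{\lambda\setminus\mu}=\mathrm{Hom}_{G(\ell,1,m)}(S^\mu,S^\lambda)$ through the homomorphism $H_{\ell,n}\to\mathbf CG(\ell,1,m+n)$, $u_i\mapsto\phi_{m+i}$, $s_j\mapsto s_{m+j}$, $\zeta_i\mapsto\zeta_{m+i}$, where $\phi_i=\sum_{j<i}\sum_{k=0}^{\ell-1}\zeta_i^ks_{ij}\zeta_i^{-k}$. Let $t_\kappa$ be the automorphism of $H_{\ell,n}$ with $u_i\mapsto u_i+\kappa$ that fixes $G(\ell,1,n)$, and $M^{t_\kappa}$ the module $M$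 with $h$ acting by $t_\kappa(h)$. Let $D$ be an $\ell$-skew shape with $n$ boxes and connected components $D_1,\dots,D_k$. Choose $\alpha_i\in\mathbf C$ and $\ell$-partitions $\mu_i\subseteq\lambda_i$ such that $D_i$ is a diagonal slide of $\lambda_i\setminus\mu_i+(\alpha_i,0)$, let $n_i$ be the number of boxes of $D_i$, and put $$S^D=\mathrm{Ind}_{H_{\ell,n_1}\otimes\cdots\otimes H_{\ell,n_k}}^{H_{\ell,n}}\Big(\bigotimes_i\,(S^{\lambda_i\setminus\mu_i})^{t_{\ell\alpha_i}}\Big).$$ **Theorem.** (a) Let $M$ be an irreducible $\mathfrak u$-diagonalizable $H_{\ell,n}$-module and let $0\ne m\in M$ satisfy $u_im=a_im$ and $\zeta_im=\zeta^{b_i}m$ for $1\le i\le n$, with $a_i\in\mathbf C$ and $b_i\in\mathbf Z$. Then there are an $\ell$-skew shape $D$ and a standard Young tableau $T$ on $D$ with $a_i=\ell\,\mathrm{ct}(T^{-1}(i))$ and $b_i\equiv\beta(T^{-1}(i))\pmod\ell$ for $1\le i\le n$, and $M\cong S^D$ for every choice of the data in the construction of $S^D$ (such data exist). Moreover $T$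 and $D$ are unique up to diagonal slides of the connected components: if $T'$ on $D'$ satisfies the same equations, then $D'$ is obtained from $D$ by diagonal slides of its connected components, and the slides carry $T$ to $T'$. (b) Conversely, for every $\ell$-skew shape $D$ with $n$ boxes the data in the construction of $S^D$ exist, and for every choice of them $S^D$ is irreducible and $\mathfrak u$-diagonalizable. For $\ell$-skew shapes $D,D'$ with $n$ boxes, and for any choices, $S^D\cong S^{D'}$ if and only if $D'$ is obtained from $D$ by diagonal slides of its connected components. -/

import Mathlib

noncomputable section

namespace SkewHecke

/-! ### The group `G(ℓ,1,n)` -/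

/-- The wreath product `G(ℓ,1,n)` of the cyclic group of order `ℓ` (written `ℤ/ℓ`) and `S_n`. The
element `⟨a, w⟩` corresponds to the monomial matrix `ζ₁^{a 1} ⋯ ζ_n^{a n} w`. -/
abbrev G (ℓ n : ℕ) : Type :=
  (Fin n → Multiplicative (ZMod ℓ)) ⋊[mulAutArrow] Equiv.Perm (Fin n)

/-- The power `ζ_i ^ c`, for `c ∈ ℤ/ℓ`, of the diagonal generator `ζ_i`. -/
def zetaPow {ℓ n : ℕ} (i : Fin n) (c : ZMod ℓ) : G ℓ n :=
  SemidirectProduct.inl (Pi.mulSingle i (Multiplicative.ofAdd c))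

/-- The diagonal generator `ζ_i`. -/
def zeta {ℓ n : ℕ} (i : Fin n) : G ℓ n := zetaPow i 1

/-- The transposition `s_{ij}`. -/
def s {ℓ n : ℕ} (i j : Fin n) : G ℓ n := SemidirectProduct.inr (Equiv.swap i j)

theorem viaEmbedding_inv_apply {a b : ℕ} (e : Fin a ↪ Fin b) (w : Equiv.Perm (Fin a))
    (x : Fin a) : (Equiv.Perm.viaEmbeddingHom e w)⁻¹ (e x) = e (w⁻¹ x) := by
  rw [← map_inv, Equiv.Perm.viaEmbeddingHom_apply, Equiv.Perm.viaEmbedding_apply]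

/-- The homomorphism `G(ℓ,1,a) → G(ℓ,1,b)` induced by an injection of index sets: the image of `g`
acts by `g` on the coordinates in the image of `e` and trivially on the others. -/
def gMap (ℓ : ℕ) {a b : ℕ} (e : Fin a ↪ Fin b) : G ℓ a →* G ℓ b :=
  SemidirectProduct.map (Function.ExtendByOne.hom (Multiplicative (ZMod ℓ)) e)
    (Equiv.Perm.viaEmbeddingHom e) (by
      intro w
      refine MonoidHom.ext fun f => funext fun x => ?_
      change Function.extend e (fun y => f (w⁻¹ y)) 1 x =
        Function.extend e f 1 ((Equiv.Perm.viaEmbeddingHom e w)⁻¹ x)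
      by_cases hx : x ∈ Set.range e
      · obtain ⟨y, rfl⟩ := hx
        rw [viaEmbedding_inv_apply, e.injective.extend_apply, e.injective.extend_apply]
      · rw [Function.extend_apply' _ _ _ (by simpa using hx), ← map_inv,
          Equiv.Perm.viaEmbeddingHom_apply, Equiv.Perm.viaEmbedding_apply_of_notMem _ _ _ hx,
          Function.extend_apply' _ _ _ (by simpa using hx)])

theorem gMap_zetaPow {ℓ a b : ℕ} (e : Fin a ↪ Fin b) (i : Fin a) (c : ZMod ℓ) :
    gMap ℓ e (zetaPow i c) = zetaPow (e i) c := by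
  rw [gMap, zetaPow, zetaPow, SemidirectProduct.map_inl]
  congr 1
  funext x
  change Function.extend e (Pi.mulSingle i (Multiplicative.ofAdd c)) 1 x = _
  by_cases hx : x ∈ Set.range e
  · obtain ⟨y, rfl⟩ := hx
    rw [e.injective.extend_apply]
    simp [Pi.mulSingle_apply]
  · rw [Function.extend_apply' _ _ _ (by simpa using hx), Pi.mulSingle_eq_of_ne]
    · rfl
    · rintro rfl
      exact hx ⟨i, rfl⟩

theorem gMap_s {ℓ a b : ℕ} (e : Fin a ↪ Fin b) (i j : Fin a) :
    gMap ℓ e (s i j) = s (e i) (e j) := by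
  rw [gMap, s, s, SemidirectProduct.map_inr]
  congr 1
  refine Equiv.ext fun x => ?_
  by_cases hx : x ∈ Set.range e
  · obtain ⟨y, rfl⟩ := hx
    rw [Equiv.Perm.viaEmbeddingHom_apply, Equiv.Perm.viaEmbedding_apply,
      e.injective.swap_apply]
  · rw [Equiv.Perm.viaEmbeddingHom_apply, Equiv.Perm.viaEmbedding_apply_of_notMem _ _ _ hx,
      Equiv.swap_apply_of_ne_of_ne]
    · rintro rfl
      exact hx ⟨i, rfl⟩
    · rintro rfl
      exact hx ⟨j, rfl⟩

theorem gMap_right_apply {ℓ a b : ℕ} (e : Fin a ↪ Fin b) (g : G ℓ a) (x : Fin a) :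
    (gMap ℓ e g).right (e x) = e (g.right x) :=
  Equiv.Perm.viaEmbedding_apply _ _ _

theorem gMap_right_of_notMem {ℓ a b : ℕ} (e : Fin a ↪ Fin b) (g : G ℓ a) (x : Fin b)
    (hx : x ∉ Set.range e) : (gMap ℓ e g).right x = x :=
  Equiv.Perm.viaEmbedding_apply_of_notMem _ _ _ hx

theorem gMap_left_of_notMem {ℓ a b : ℕ} (e : Fin a ↪ Fin b) (g : G ℓ a) (x : Fin b)
    (hx : x ∉ Set.range e) : (gMap ℓ e g).left x = 1 :=
  Function.extend_apply' _ _ _ (by simpa using hx)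

theorem gMap_commute {ℓ a b c : ℕ} (e : Fin a ↪ Fin b) (f : Fin c ↪ Fin b)
    (h : ∀ x y, e x ≠ f y) (g : G ℓ a) (g' : G ℓ c) : Commute (gMap ℓ e g) (gMap ℓ f g') := by
  have key : ∀ {a c : ℕ} (e : Fin a ↪ Fin b) (f : Fin c ↪ Fin b) (_ : ∀ x y, e x ≠ f y)
      (g : G ℓ a) (g' : G ℓ c) (x : Fin b), x ∉ Set.range e →
      (gMap ℓ e g * gMap ℓ f g').left x = (gMap ℓ f g' * gMap ℓ e g).left x ∧
      (gMap ℓ e g * gMap ℓ f g').right x = (gMap ℓ f g' * gMap ℓ e g).right x := by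
    intro a c e f h g g' x hx
    have hinv : (gMap ℓ f g').right⁻¹ x ∉ Set.range e := by
      rintro ⟨y, hy⟩
      rw [Equiv.Perm.eq_inv_iff_eq, gMap_right_of_notMem f g' (e y)] at hy
      · exact hx ⟨y, hy⟩
      · rintro ⟨z, hz⟩
        exact h y z hz.symm
    have hinv' : (gMap ℓ e g).right⁻¹ x = x := by
      rw [Equiv.Perm.inv_eq_iff_eq, gMap_right_of_notMem e g x hx]
    have hr : (gMap ℓ f g').right x ∉ Set.range e := by
      rintro ⟨y, hy⟩
      have : (gMap ℓ f g').right (e y) = e y := by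
        apply gMap_right_of_notMem
        rintro ⟨z, hz⟩
        exact h y z hz.symm
      rw [← this] at hy
      exact hx ⟨y, (gMap ℓ f g').right.injective hy⟩
    constructor
    · change (gMap ℓ e g).left x * (gMap ℓ f g').left ((gMap ℓ e g).right⁻¹ x) =
        (gMap ℓ f g').left x * (gMap ℓ e g).left ((gMap ℓ f g').right⁻¹ x)
      rw [hinv', gMap_left_of_notMem e g x hx, gMap_left_of_notMem e g _ hinv, one_mul, mul_one]
    · change (gMap ℓ e g).right ((gMap ℓ f g').right x) =
        (gMap ℓ f g').right ((gMap ℓ e g).right x)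
      rw [gMap_right_of_notMem e g _ hr, gMap_right_of_notMem e g x hx]
  have key' : ∀ x : Fin b,
      (gMap ℓ e g * gMap ℓ f g').left x = (gMap ℓ f g' * gMap ℓ e g).left x ∧
      (gMap ℓ e g * gMap ℓ f g').right x = (gMap ℓ f g' * gMap ℓ e g).right x := by
    intro x
    by_cases hx : x ∈ Set.range e
    · have hx' : x ∉ Set.range f := by
        rintro ⟨y, rfl⟩
        obtain ⟨z, hz⟩ := hx
        exact h _ _ hz
      obtain ⟨h1, h2⟩ := key f e (fun x y hxy => h y x hxy.symm) g' g x hx'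
      exact ⟨h1.symm, h2.symm⟩
    · exact key e f h g g' x hx
  exact SemidirectProduct.ext (funext fun x => (key' x).1) (Equiv.ext fun x => (key' x).2)

/-! ### Jucys-Murphy elements -/

/-- The sum `∑_{0 ≤ c < ℓ} ζ_i^c s_{ij} ζ_i^{-c}` in the group algebra. -/
def reflSum {ℓ n : ℕ} [NeZero ℓ] (i j : Fin n) : MonoidAlgebra ℂ (G ℓ n) :=
  ∑ c : ZMod ℓ, MonoidAlgebra.of ℂ (G ℓ n) (zetaPow i c * s i j * zetaPow i (-c))

/-- The Jucys-Murphy element `φ_i = ∑_{j < i} ∑_{0 ≤ c < ℓ} ζ_i^c s_{ij} ζ_i^{-c}`. -/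
def phi {ℓ n : ℕ} [NeZero ℓ] (i : Fin n) : MonoidAlgebra ℂ (G ℓ n) :=
  ∑ j ∈ Finset.Iio i, reflSum i j

theorem act_apply {ℓ n : ℕ} (w : Equiv.Perm (Fin n)) (f : Fin n → Multiplicative (ZMod ℓ))
    (x : Fin n) : (mulAutArrow w) f x = f (w⁻¹ x) := rfl

theorem refl_eq {ℓ n : ℕ} (i j : Fin n) (c : ZMod ℓ) :
    zetaPow i c * s i j * zetaPow i (-c) =
      (⟨Pi.mulSingle i (Multiplicative.ofAdd c) * Pi.mulSingle j (Multiplicative.ofAdd (-c)),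
        Equiv.swap i j⟩ : G ℓ n) := by
  refine SemidirectProduct.ext (funext fun x => ?_) ?_
  · simp only [zetaPow, s, SemidirectProduct.mul_left, SemidirectProduct.left_inl,
      SemidirectProduct.left_inr, SemidirectProduct.right_inl, SemidirectProduct.right_inr,
      SemidirectProduct.mul_right, Pi.mul_apply, act_apply, one_mul, map_one, mul_one,
      Equiv.swap_inv, Pi.mulSingle_apply, Equiv.swap_apply_eq_iff,
      Equiv.swap_apply_left]
  · simp [zetaPow, s]

theorem mul_refl {ℓ n : ℕ} (g : G ℓ n) (i j : Fin n) (h : i ≠ j) (c : ZMod ℓ) :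
    g * (zetaPow i c * s i j * zetaPow i (-c)) =
      (zetaPow (g.right i) (c + ((g.left (g.right i)).toAdd - (g.left (g.right j)).toAdd)) *
        s (g.right i) (g.right j) *
        zetaPow (g.right i) (-(c + ((g.left (g.right i)).toAdd - (g.left (g.right j)).toAdd)))) *
        g := by
  have h' : g.right i ≠ g.right j := fun e => h (g.right.injective e)
  rw [refl_eq, refl_eq]
  refine SemidirectProduct.ext (funext fun x => ?_) ?_
  · apply Multiplicative.toAdd.injective
    simp only [SemidirectProduct.mul_left, Pi.mul_apply, act_apply, toAdd_mul,
      Pi.mulSingle_apply, Equiv.swap_inv, Equiv.Perm.inv_eq_iff_eq]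
    by_cases h1 : x = g.right i
    · subst h1
      simp [h']
      abel
    · by_cases h2 : x = g.right j
      · subst h2
        simp [h'.symm]
        abel
      · simp [h1, h2, Equiv.swap_apply_of_ne_of_ne h1 h2]
  · simp [Equiv.mul_swap_eq_swap_mul]

theorem of_mul_reflSum {ℓ n : ℕ} [NeZero ℓ] (g : G ℓ n) (i j : Fin n) (h : i ≠ j) :
    MonoidAlgebra.of ℂ (G ℓ n) g * reflSum i j =
      reflSum (g.right i) (g.right j) * MonoidAlgebra.of ℂ (G ℓ n) g := by
  rw [reflSum, reflSum, Finset.mul_sum, Finset.sum_mul]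
  refine Fintype.sum_equiv
    (Equiv.addRight ((g.left (g.right i)).toAdd - (g.left (g.right j)).toAdd)) _ _ fun c => ?_
  rw [← map_mul, ← map_mul, mul_refl g i j h c]
  rfl

theorem of_commute_phi {ℓ n : ℕ} [NeZero ℓ] (g : G ℓ n) (i : Fin n) (hi : g.right i = i)
    (hg : ∀ j, j < i ↔ g.right j < i) :
    Commute (MonoidAlgebra.of ℂ (G ℓ n) g) (phi i) := by
  rw [Commute, SemiconjBy, phi, Finset.mul_sum, Finset.sum_mul]
  refine Finset.sum_equiv g.right (fun j => by simpa using hg j) fun j hj => ?_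
  rw [of_mul_reflSum g i j (by rintro rfl; simp at hj), hi]

theorem phi_commute {ℓ n : ℕ} [NeZero ℓ] (i j : Fin n) :
    Commute (phi i : MonoidAlgebra ℂ (G ℓ n)) (phi j) := by
  wlog hij : i < j generalizing i j
  · rcases eq_or_lt_of_le (not_lt.mp hij) with rfl | h
    · exact Commute.refl _
    · exact (this j i h).symm
  rw [phi]
  refine Commute.sum_left _ _ _ fun k hk => Commute.sum_left _ _ _ fun c _ => ?_
  have hk : k < i := by simpa using hk
  rw [refl_eq]
  refine of_commute_phi _ _ ?_ fun x => ?_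
  · exact Equiv.swap_apply_of_ne_of_ne hij.ne' (hk.trans hij).ne'
  · change x < j ↔ Equiv.swap i k x < j
    rw [Equiv.swap_apply_def]
    split_ifs with h1 h2
    · subst h1
      exact iff_of_true hij (hk.trans hij)
    · subst h2
      exact iff_of_true (hk.trans hij) hij
    · rfl

theorem s_mul_phi {ℓ n : ℕ} [NeZero ℓ] (i i' : Fin n) (hi : (i' : ℕ) = i + 1) :
    MonoidAlgebra.of ℂ (G ℓ n) (s i i') * phi i =
      phi i' * MonoidAlgebra.of ℂ (G ℓ n) (s i i') -
        ∑ c : ZMod ℓ, MonoidAlgebra.of ℂ (G ℓ n) (zetaPow i c * zetaPow i' (-c)) := by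
  have hI : Finset.Iio i' = insert i (Finset.Iio i) := by
    ext x
    simp only [Finset.mem_Iio, Finset.mem_insert, Fin.lt_def, Fin.ext_iff]
    omega
  have h1 : MonoidAlgebra.of ℂ (G ℓ n) (s i i') * phi i =
      (∑ j ∈ Finset.Iio i, reflSum i' j) * MonoidAlgebra.of ℂ (G ℓ n) (s i i') := by
    rw [phi, Finset.mul_sum, Finset.sum_mul]
    refine Finset.sum_congr rfl fun j hj => ?_
    have hj : j < i := by simpa using hj
    have hj' : j ≠ i' := by
      rintro rfl
      rw [Fin.lt_def] at hj
      omega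
    have e1 : (s i i' : G ℓ n).right i = i' := Equiv.swap_apply_left i i'
    have e2 : (s i i' : G ℓ n).right j = j := Equiv.swap_apply_of_ne_of_ne hj.ne hj'
    rw [of_mul_reflSum _ _ _ hj.ne', e1, e2]
  have h2 : reflSum i' i * MonoidAlgebra.of ℂ (G ℓ n) (s i i') =
      ∑ c : ZMod ℓ, MonoidAlgebra.of ℂ (G ℓ n) (zetaPow i c * zetaPow i' (-c)) := by
    rw [reflSum, Finset.sum_mul]
    refine Fintype.sum_equiv (Equiv.neg _) _ _ fun c => ?_
    rw [← map_mul, refl_eq]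
    congr 1
    refine SemidirectProduct.ext ?_ ?_
    · simp [zetaPow, s, mul_comm]
    · simp [zetaPow, s, Equiv.swap_comm i' i]
  rw [h1, phi, hI, Finset.sum_insert (by simp), add_mul, h2]
  abel

/-! ### The degenerate affine Hecke algebra -/

/-- The generators of `H_{ℓ,n}`: the polynomial generators `u_i` and the elements of the group. -/
abbrev Free (ℓ n : ℕ) : Type := FreeAlgebra ℂ (Fin n ⊕ G ℓ n)

/-- The generator `u_i` of the free algebra. -/
def freeU {ℓ n : ℕ} (i : Fin n) : Free ℓ n := FreeAlgebra.ι ℂ (Sum.inl i)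

/-- The generator of the free algebra given by an element of the group. -/
def freeG {ℓ n : ℕ} (g : G ℓ n) : Free ℓ n := FreeAlgebra.ι ℂ (Sum.inr g)

/-- The defining relations of `H_{ℓ,n}`. The first three say that the generators come from
`ℂ[u₁, …, u_n]` and from the group `G(ℓ,1,n)`; in the last one the sum is `π_i`. -/
inductive Rel (ℓ n : ℕ) [NeZero ℓ] : Free ℓ n → Free ℓ n → Prop
  | u_comm (i j : Fin n) : Rel ℓ n (freeU i * freeU j) (freeU j * freeU i)
  | g_one : Rel ℓ n (freeG 1) 1
  | g_mul (g h : G ℓ n) : Rel ℓ n (freeG (g * h)) (freeG g * freeG h)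
  | zeta_u (i j : Fin n) : Rel ℓ n (freeG (zeta i) * freeU j) (freeU j * freeG (zeta i))
  | s_u_far (i i' j : Fin n) (hi : (i' : ℕ) = i + 1) (hj : j ≠ i) (hj' : j ≠ i') :
      Rel ℓ n (freeG (s i i') * freeU j) (freeU j * freeG (s i i'))
  | s_u (i i' : Fin n) (hi : (i' : ℕ) = i + 1) :
      Rel ℓ n (freeG (s i i') * freeU i)
        (freeU i' * freeG (s i i') - ∑ c : ZMod ℓ, freeG (zetaPow i c * zetaPow i' (-c)))

/-- The degenerate affine Hecke algebra `H_{ℓ,n}` of type `G(ℓ,1,n)`. -/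
def H (ℓ n : ℕ) [NeZero ℓ] : Type := RingQuot (Rel ℓ n)

instance (ℓ n : ℕ) [NeZero ℓ] : Ring (H ℓ n) := inferInstanceAs (Ring (RingQuot (Rel ℓ n)))

instance (ℓ n : ℕ) [NeZero ℓ] : Algebra ℂ (H ℓ n) :=
  inferInstanceAs (Algebra ℂ (RingQuot (Rel ℓ n)))

/-- The quotient map from the free algebra to `H_{ℓ,n}`. -/
def mkH (ℓ n : ℕ) [NeZero ℓ] : Free ℓ n →ₐ[ℂ] H ℓ n := RingQuot.mkAlgHom ℂ (Rel ℓ n)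

theorem mkH_rel {ℓ n : ℕ} [NeZero ℓ] {x y : Free ℓ n} (h : Rel ℓ n x y) : mkH ℓ n x = mkH ℓ n y :=
  RingQuot.mkAlgHom_rel ℂ h

theorem mkH_surjective (ℓ n : ℕ) [NeZero ℓ] : Function.Surjective (mkH ℓ n) :=
  RingQuot.mkAlgHom_surjective ℂ (Rel ℓ n)

/-- The element `u_i` of `H_{ℓ,n}`. -/
def u (ℓ : ℕ) {n : ℕ} [NeZero ℓ] (i : Fin n) : H ℓ n := mkH ℓ n (freeU i)

/-- The image in `H_{ℓ,n}` of an element of the group. -/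
def gp {ℓ n : ℕ} [NeZero ℓ] (g : G ℓ n) : H ℓ n := mkH ℓ n (freeG g)

/-- The element `ζ_i` of `H_{ℓ,n}`. -/
def z (ℓ : ℕ) {n : ℕ} [NeZero ℓ] (i : Fin n) : H ℓ n := gp (zeta i)

/-- The universal property of `H_{ℓ,n}`. -/
def liftH {ℓ n : ℕ} [NeZero ℓ] {A : Type*} [Ring A] [Algebra ℂ A] (U : Fin n → A)
    (γ : G ℓ n →* A) (huu : ∀ i j, U i * U j = U j * U i)
    (hzu : ∀ i j, γ (zeta i) * U j = U j * γ (zeta i))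
    (hsf : ∀ i i' j : Fin n, (i' : ℕ) = i + 1 → j ≠ i → j ≠ i' →
      γ (s i i') * U j = U j * γ (s i i'))
    (hsu : ∀ i i' : Fin n, (i' : ℕ) = i + 1 →
      γ (s i i') * U i = U i' * γ (s i i') - ∑ c : ZMod ℓ, γ (zetaPow i c * zetaPow i' (-c))) :
    H ℓ n →ₐ[ℂ] A :=
  RingQuot.liftAlgHom ℂ ⟨FreeAlgebra.lift ℂ (Sum.elim U γ), by
    have hU : ∀ i, FreeAlgebra.lift ℂ (Sum.elim U γ) (freeU i) = U i := fun i => by simp [freeU]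
    have hG : ∀ g, FreeAlgebra.lift ℂ (Sum.elim U γ) (freeG g) = γ g := fun g => by simp [freeG]
    intro x y h
    induction h with
    | u_comm i j => simp only [map_mul, hU, huu i j]
    | g_one => simp only [map_one, hG]
    | g_mul g h => simp only [map_mul, hG]
    | zeta_u i j => simp only [map_mul, hG, hU, hzu i j]
    | s_u_far i i' j hi hj hj' => simp only [map_mul, hG, hU, hsf i i' j hi hj hj']
    | s_u i i' hi => rw [map_mul, map_sub, map_mul, map_sum, hG, hU, hU, hsu i i' hi]; simp only [hG]⟩

theorem liftH_mkH {ℓ n : ℕ} [NeZero ℓ] {A : Type*} [Ring A] [Algebra ℂ A] (U : Fin n → A)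
    (γ : G ℓ n →* A) (h1 h2 h3 h4) (x : Free ℓ n) :
    liftH U γ h1 h2 h3 h4 (mkH ℓ n x) = FreeAlgebra.lift ℂ (Sum.elim U γ) x :=
  RingQuot.liftAlgHom_mkAlgHom_apply ℂ _ _ _

theorem gp_one {ℓ n : ℕ} [NeZero ℓ] : gp (1 : G ℓ n) = 1 := by
  rw [gp, mkH_rel (Rel.g_one), map_one]

theorem gp_mul {ℓ n : ℕ} [NeZero ℓ] (g h : G ℓ n) : gp (g * h) = gp g * gp h := by
  rw [gp, mkH_rel (Rel.g_mul g h), map_mul]; rfl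

/-- The homomorphism from `G(ℓ,1,n)` to `H_{ℓ,n}`. -/
def gpHom (ℓ n : ℕ) [NeZero ℓ] : G ℓ n →* H ℓ n where
  toFun := gp
  map_one' := gp_one
  map_mul' := gp_mul

theorem u_comm {ℓ n : ℕ} [NeZero ℓ] (i j : Fin n) : u ℓ i * u ℓ j = u ℓ j * u ℓ i := by
  simp only [u, ← map_mul]
  exact mkH_rel (Rel.u_comm i j)

theorem z_u {ℓ n : ℕ} [NeZero ℓ] (i j : Fin n) : gp (zeta i) * u ℓ j = u ℓ j * gp (zeta i) := by
  simp only [u, gp, ← map_mul]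
  exact mkH_rel (Rel.zeta_u i j)

theorem s_u_far {ℓ n : ℕ} [NeZero ℓ] (i i' j : Fin n) (hi : (i' : ℕ) = i + 1) (hj : j ≠ i)
    (hj' : j ≠ i') : gp (s i i') * u ℓ j = u ℓ j * gp (s i i') := by
  simp only [u, gp, ← map_mul]
  exact mkH_rel (Rel.s_u_far i i' j hi hj hj')

theorem s_u {ℓ n : ℕ} [NeZero ℓ] (i i' : Fin n) (hi : (i' : ℕ) = i + 1) :
    gp (s i i') * u ℓ i =
      u ℓ i' * gp (s i i') - ∑ c : ZMod ℓ, gp (zetaPow i c * zetaPow i' (-c)) := by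
  simp only [u, gp, ← map_mul, ← map_sum, ← map_sub]
  exact mkH_rel (Rel.s_u i i' hi)

/-- The automorphism `t_κ` of `H_{ℓ,n}`: `u_i ↦ u_i + κ`, identity on the group. -/
def twist (ℓ n : ℕ) [NeZero ℓ] (κ : ℂ) : H ℓ n →ₐ[ℂ] H ℓ n :=
  liftH (fun i => u ℓ i + algebraMap ℂ _ κ) (gpHom ℓ n)
    (fun i j => by
      simp only [mul_add, add_mul, u_comm i j, Algebra.commutes]
      abel)
    (fun i j => by
      simp only [mul_add, add_mul, Algebra.commutes]
      exact congrArg (· + _) (z_u i j))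
    (fun i i' j hi hj hj' => by
      simp only [mul_add, add_mul, Algebra.commutes]
      exact congrArg (· + _) (s_u_far i i' j hi hj hj'))
    (fun i i' hi => by
      simp only [mul_add, add_mul, Algebra.commutes]
      rw [add_sub_right_comm]
      exact congrArg (· + _) (s_u i i' hi))

/-- The order embedding `Fin a → Fin b`, `i ↦ o + i`. -/
def shift {a b : ℕ} (o : ℕ) (h : o + a ≤ b) : Fin a ↪ Fin b where
  toFun i := ⟨o + i, by omega⟩
  inj' i j hij := by
    simp only [Fin.mk.injEq] at hij
    exact Fin.ext (by omega)

theorem shift_val {a b : ℕ} (o : ℕ) (h : o + a ≤ b) (i : Fin a) :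
    (shift o h i : ℕ) = o + i := rfl

/-- The homomorphism `H_{ℓ,a} → H_{ℓ,b}` that sends the generators with index `i` to those
with index `o + i`. -/
def blockHom (ℓ : ℕ) [NeZero ℓ] {a b : ℕ} (o : ℕ) (h : o + a ≤ b) : H ℓ a →ₐ[ℂ] H ℓ b :=
  liftH (fun i => u ℓ (shift o h i)) ((gpHom ℓ b).comp (gMap ℓ (shift o h)))
    (fun i j => u_comm _ _)
    (fun i j => by
      simp only [MonoidHom.comp_apply, zeta, gMap_zetaPow]
      exact z_u _ _)
    (fun i i' j hi hj hj' => by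
      simp only [MonoidHom.comp_apply, gMap_s]
      exact s_u_far _ _ _ (by simp [shift_val, hi, add_assoc])
        (fun e => hj ((shift o h).injective e)) (fun e => hj' ((shift o h).injective e)))
    (fun i i' hi => by
      simp only [MonoidHom.comp_apply, gMap_s, map_mul, gMap_zetaPow]
      simp only [← map_mul]
      exact s_u _ _ (by simp [shift_val, hi, add_assoc]))

/-- The homomorphism `H_{ℓ,n} → ℂ G(ℓ,1,m+n)` given by `u_i ↦ φ_{m+i}`, `s_j ↦ s_{m+j}`,
`ζ_i ↦ ζ_{m+i}`. -/
def toGroupAlg (ℓ m n : ℕ) [NeZero ℓ] : H ℓ n →ₐ[ℂ] MonoidAlgebra ℂ (G ℓ (m + n)) :=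
  liftH (fun i => phi (Fin.natAdd m i))
    ((MonoidAlgebra.of ℂ (G ℓ (m + n))).comp (gMap ℓ (Fin.natAddEmb m)))
    (fun i j => (phi_commute _ _).eq)
    (fun i j => by
      simp only [MonoidHom.comp_apply, zeta, gMap_zetaPow]
      exact (of_commute_phi _ _ rfl fun _ => Iff.rfl).eq)
    (fun i i' j hi hj hj' => by
      simp only [MonoidHom.comp_apply, gMap_s, Fin.natAddEmb_apply]
      have h1 : Fin.natAdd m j ≠ Fin.natAdd m i := by simpa using hj
      have h2 : Fin.natAdd m j ≠ Fin.natAdd m i' := by simpa using hj'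
      refine (of_commute_phi _ _ (Equiv.swap_apply_of_ne_of_ne h1 h2) fun x => ?_).eq
      change _ ↔ Equiv.swap (Fin.natAdd m i) (Fin.natAdd m i') x < _
      rw [Equiv.swap_apply_def]
      simp only [ne_eq, Fin.ext_iff, Fin.lt_def, Fin.val_natAdd] at *
      split_ifs <;> simp only [Fin.val_natAdd] <;> omega)
    (fun i i' hi => by
      simp only [MonoidHom.comp_apply, gMap_s, map_mul, gMap_zetaPow]
      simp only [← map_mul]
      exact s_mul_phi _ _ (by simp [hi, add_assoc]))

/-- The image of `toGroupAlg` centralizes `G(ℓ,1,m)`. -/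
theorem toGroupAlg_commute {ℓ m n : ℕ} [NeZero ℓ] (h : H ℓ n) (g : G ℓ m) :
    Commute (toGroupAlg ℓ m n h)
      (MonoidAlgebra.of ℂ (G ℓ (m + n)) (gMap ℓ (Fin.castAddEmb n) g)) := by
  obtain ⟨x, rfl⟩ := mkH_surjective ℓ n h
  induction x using FreeAlgebra.induction with
  | grade0 r => rw [AlgHom.commutes, AlgHom.commutes]; exact Algebra.commutes _ _
  | grade1 x =>
    rcases x with i | g'
    · have e : toGroupAlg ℓ m n (mkH ℓ n (FreeAlgebra.ι ℂ (Sum.inl i))) =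
          phi (Fin.natAdd m i) := by
        rw [toGroupAlg, liftH_mkH, FreeAlgebra.lift_ι_apply]; rfl
      rw [e]
      have hw : (gMap ℓ (Fin.castAddEmb n) g).right =
          Equiv.Perm.viaEmbedding g.right (Fin.castAddEmb n) := rfl
      refine (of_commute_phi _ _ ?_ fun x => ?_).symm
      · rw [hw, Equiv.Perm.viaEmbedding_apply_of_notMem]
        rintro ⟨y, hy⟩
        simp only [Fin.castAddEmb_apply, Fin.ext_iff, Fin.val_castAdd, Fin.val_natAdd] at hy
        omega
      · rw [hw]
        by_cases hx : x ∈ Set.range (Fin.castAddEmb n)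
        · obtain ⟨y, rfl⟩ := hx
          rw [Equiv.Perm.viaEmbedding_apply]
          simp only [Fin.castAddEmb_apply, Fin.lt_def, Fin.val_castAdd, Fin.val_natAdd]
          omega
        · rw [Equiv.Perm.viaEmbedding_apply_of_notMem _ _ _ hx]
    · have e : toGroupAlg ℓ m n (mkH ℓ n (FreeAlgebra.ι ℂ (Sum.inr g'))) =
          MonoidAlgebra.of ℂ (G ℓ (m + n)) (gMap ℓ (Fin.natAddEmb m) g') := by
        rw [toGroupAlg, liftH_mkH, FreeAlgebra.lift_ι_apply]; rfl
      rw [e]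
      refine (gMap_commute _ _ (fun x y hxy => ?_) g' g).map (MonoidAlgebra.of ℂ (G ℓ (m + n)))
      simp only [Fin.castAddEmb_apply, Fin.natAddEmb_apply, Fin.ext_iff, Fin.val_castAdd,
        Fin.val_natAdd] at hxy
      omega
  | mul x y hx hy => rw [map_mul, map_mul]; exact hx.mul_left hy
  | add x y hx hy => rw [map_add, map_add]; exact hx.add_left hy

/-! ### Boxes, skew shapes and tableaux -/

/-- A box `(x, y)` with coordinate `β`: the first coordinate is the column, the second the row. -/
structure Box (ℓ : ℕ) where
  /-- the coordinate, an index `0, …, ℓ - 1` -/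
  β : ZMod ℓ
  x : ℂ
  y : ℂ

/-- The content of a box. -/
def Box.ct {ℓ : ℕ} (b : Box ℓ) : ℂ := b.x - b.y

/-- The order on boxes: `c` is weakly to the right of and weakly below `b`, at integral distance. -/
def Box.le {ℓ : ℕ} (b c : Box ℓ) : Prop :=
  b.β = c.β ∧ ∃ k l : ℕ, c.x = b.x + k ∧ c.y = b.y + l

/-- Adjacent boxes. -/
def Box.Adj {ℓ : ℕ} (b c : Box ℓ) : Prop :=
  b.β = c.β ∧ ((b.x = c.x ∧ (b.y = c.y + 1 ∨ b.y = c.y - 1)) ∨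
    (b.y = c.y ∧ (b.x = c.x + 1 ∨ b.x = c.x - 1)))

/-- An `ℓ`-skew shape `D = (D⁰, …, D^{ℓ-1})`; the boxes of `D^j` are the boxes of `D` with
coordinate `j`. The last condition is automatic when the boxes have integral coordinates. In general
it says that boxes of `D^j` whose contents are equal or differ by one lie in the same connected
component. -/
structure SkewShape (ℓ : ℕ) where
  boxes : Set (Box ℓ)
  finite : boxes.Finite
  convex : ∀ (j : ZMod ℓ) (x y : ℂ) (k l : ℕ), ⟨j, x, y⟩ ∈ boxes → ⟨j, x + k, y + l⟩ ∈ boxes →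
    ∀ k' ≤ k, ∀ l' ≤ l, (⟨j, x + (k' : ℕ), y + (l' : ℕ)⟩ : Box ℓ) ∈ boxes
  aligned : ∀ b ∈ boxes, ∀ c ∈ boxes, b.β = c.β → (c.ct = b.ct ∨ c.ct = b.ct + 1) →
    ∃ p q : ℤ, c.x = b.x + p ∧ c.y = b.y + q

/-- Two boxes of `D` lie in the same connected component. -/
def SkewShape.Conn {ℓ : ℕ} (D : SkewShape ℓ) : D.boxes → D.boxes → Prop :=
  Relation.ReflTransGen fun b c => b.1.Adj c.1

/-- The standard Young tableaux on a set of boxes, with the numbers `1, …, n` represented by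
`Fin n`. -/
def SYT {ℓ : ℕ} (D : Set (Box ℓ)) (n : ℕ) : Type :=
  {T : D ≃ Fin n // ∀ b c : D, b.1.le c.1 → T b ≤ T c}

/-- The box `T⁻¹(i)`. -/
def SYT.box {ℓ n : ℕ} {D : Set (Box ℓ)} (T : SYT D n) (i : Fin n) : Box ℓ := (T.1.symm i).1

/-- `D'` is obtained from `D` by diagonal slides of the connected components, `e` being the
resulting bijection of boxes: the component of `b` is moved by the vector `(κ b, κ b)`. -/
def IsSlide {ℓ : ℕ} (D D' : SkewShape ℓ) (e : D.boxes ≃ D'.boxes) : Prop :=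
  ∃ κ : D.boxes → ℂ, (∀ b c, D.Conn b c → κ b = κ c) ∧
    ∀ b, (e b).1 = ⟨b.1.β, b.1.x + κ b, b.1.y + κ b⟩

/-! ### The irreducible representations `S^λ` of `G(ℓ,1,n)` -/

/-- An `ℓ`-tuple of partitions. -/
abbrev MultiPartition (ℓ : ℕ) : Type := ZMod ℓ → YoungDiagram

/-- The total number of boxes of an `ℓ`-partition. -/
def MultiPartition.size {ℓ : ℕ} [NeZero ℓ] (lam : MultiPartition ℓ) : ℕ := ∑ j, (lam j).card

/-- The boxes `(x, y)` of an `ℓ`-partition, with `x ≥ 1` the column and `y ≥ 1` the row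
(Mathlib's cells `(i, j)` have the row first, and start at zero). -/
def MultiPartition.boxes {ℓ : ℕ} (lam : MultiPartition ℓ) : Set (Box ℓ) :=
  {b | ∃ p ∈ lam b.β, b.x = (p.2 : ℂ) + 1 ∧ b.y = (p.1 : ℂ) + 1}

/-- The vector space with basis `v_T`, where `T` runs over the standard Young tableaux. -/
def YoungSpace {ℓ : ℕ} (D : Set (Box ℓ)) (n : ℕ) : Type := SYT D n →₀ ℂ

instance {ℓ : ℕ} (D : Set (Box ℓ)) (n : ℕ) : AddCommGroup (YoungSpace D n) :=
  inferInstanceAs (AddCommGroup (SYT D n →₀ ℂ))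

instance {ℓ : ℕ} (D : Set (Box ℓ)) (n : ℕ) : Module ℂ (YoungSpace D n) :=
  inferInstanceAs (Module ℂ (SYT D n →₀ ℂ))

/-- The basis `v_T`. -/
def youngBasis {ℓ : ℕ} (D : Set (Box ℓ)) (n : ℕ) : Module.Basis (SYT D n) ℂ (YoungSpace D n) :=
  Module.Basis.ofRepr (LinearEquiv.refl ℂ (SYT D n →₀ ℂ))

open Classical in
/-- The vector `v_T` attached to a filling `T`, which is zero if `T` is not standard. -/
def youngVec {ℓ n : ℕ} {D : Set (Box ℓ)} (T : D ≃ Fin n) : YoungSpace D n :=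
  if h : ∀ b c : D, b.1.le c.1 → T b ≤ T c then youngBasis D n ⟨T, h⟩ else 0

open Classical in
/-- Young's seminormal form of the transposition `s_{ij}`, `j = i + 1`: let `b`, `c` be the boxes of
`T` that contain `i` and `j`. If they have distinct coordinates then `v_T ↦ v_{sT}`, and otherwise
`v_T ↦ d⁻¹ v_T + (1 + d⁻¹) v_{sT}` with `d = ct(c) - ct(b)`. -/
def youngS {ℓ n : ℕ} (D : Set (Box ℓ)) (i j : Fin n) : YoungSpace D n →ₗ[ℂ] YoungSpace D n :=
  (youngBasis D n).constr ℂ fun T =>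
    if (T.box i).β = (T.box j).β then
      ((T.box j).ct - (T.box i).ct)⁻¹ • youngBasis D n T +
        (1 + ((T.box j).ct - (T.box i).ct)⁻¹) • youngVec (T.1.trans (Equiv.swap i j))
    else youngVec (T.1.trans (Equiv.swap i j))

/-- The action of `ζ_i`: `v_T ↦ ζ^{β(T⁻¹(i))} v_T`. -/
def youngZ {ℓ n : ℕ} (ζ : ℂ) (D : Set (Box ℓ)) (i : Fin n) : YoungSpace D n →ₗ[ℂ] YoungSpace D n :=
  (youngBasis D n).constr ℂ fun T => ζ ^ (T.box i).β.val • youngBasis D n T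

/-- `ρ` is the representation of `G(ℓ,1,n)` on the space with basis the standard tableaux that is
given on the generators by Young's seminormal form. -/
def IsYoungRep {ℓ n : ℕ} (ζ : ℂ) (D : Set (Box ℓ))
    (ρ : Representation ℂ (G ℓ n) (YoungSpace D n)) : Prop :=
  (∀ i j : Fin n, (j : ℕ) = i + 1 → ρ (s i j) = youngS D i j) ∧ ∀ i, ρ (zeta i) = youngZ ζ D i

/-- The irreducible representation `S^λ` of `G(ℓ,1,n)`, for an `ℓ`-partition `λ` of `n`, in
Young's seminormal form: the representation that is given on the generators by the formulas above.
It is unique because the `s_i` and the `ζ_i` generate the group; that the formulas do define a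
representation is the classical theorem of Young. -/
def specht {ℓ : ℕ} (ζ : ℂ) (lam : MultiPartition ℓ) (n : ℕ) :
    Representation ℂ (G ℓ n) (YoungSpace lam.boxes n) :=
  @Classical.epsilon _ ⟨1⟩ (IsYoungRep ζ lam.boxes)

/-! ### The `H_{ℓ,n}`-modules `S^{λ∖μ}` -/

/-- The space `S^{λ∖μ} = Hom_{G(ℓ,1,m)}(S^μ, Res S^λ)`, where `λ` is an `ℓ`-partition of `m + n` and
`μ` one of `m`. -/
def SkewHom {ℓ : ℕ} (ζ : ℂ) (lam mu : MultiPartition ℓ) (m n : ℕ) :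
    Submodule ℂ (YoungSpace mu.boxes m →ₗ[ℂ] YoungSpace lam.boxes (m + n)) where
  carrier := {f | ∀ g : G ℓ m, f ∘ₗ specht ζ mu m g =
    specht ζ lam (m + n) (gMap ℓ (Fin.castAddEmb n) g) ∘ₗ f}
  add_mem' {f f'} hf hf' g := by rw [LinearMap.add_comp, LinearMap.comp_add, hf g, hf' g]
  zero_mem' g := by rw [LinearMap.zero_comp, LinearMap.comp_zero]
  smul_mem' c f hf g := by rw [LinearMap.smul_comp, LinearMap.comp_smul, hf g]

/-- The action of `H_{ℓ,n}` on `S^{λ∖μ}`, through the map to the centralizer of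
`G(ℓ,1,m)` in `ℂ G(ℓ,1,m+n)`. -/
def skewAct {ℓ : ℕ} [NeZero ℓ] (ζ : ℂ) (lam mu : MultiPartition ℓ) (m n : ℕ) :
    H ℓ n →ₐ[ℂ] Module.End ℂ (SkewHom ζ lam mu m n) :=
  AlgHom.ofLinearMap
    { toFun h :=
        { toFun f := ⟨(specht ζ lam (m + n)).asAlgebraHom (toGroupAlg ℓ m n h) ∘ₗ f.1, fun g => by
            have e := congrArg (specht ζ lam (m + n)).asAlgebraHom (toGroupAlg_commute h g).eq
            rw [map_mul, map_mul, Representation.asAlgebraHom_of] at e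
            rw [LinearMap.comp_assoc, f.2 g, ← LinearMap.comp_assoc, ← LinearMap.comp_assoc]
            exact congrArg (· ∘ₗ f.1) e⟩
          map_add' f f' := Subtype.ext (LinearMap.comp_add _ _ _)
          map_smul' c f := Subtype.ext (LinearMap.comp_smul _ _ _) }
      map_add' h h' := by
        refine LinearMap.ext fun f => Subtype.ext ?_
        simp [LinearMap.add_comp]
      map_smul' c h := by
        refine LinearMap.ext fun f => Subtype.ext ?_
        simp [LinearMap.smul_comp] }
    (by
      refine LinearMap.ext fun f => Subtype.ext ?_
      simp [Module.End.one_eq_id])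
    (fun h h' => by
      refine LinearMap.ext fun f => Subtype.ext ?_
      simp [Module.End.mul_eq_comp, LinearMap.comp_assoc])

/-! ### Induction -/

theorem offset_add_le {k : ℕ} {n : Fin k → ℕ} {N : ℕ} (hN : ∑ i, n i = N) (i : Fin k) :
    ∑ j ∈ Finset.Iio i, n j + n i ≤ N := by
  rw [← hN, add_comm, ← Finset.sum_insert (by simp)]
  exact Finset.sum_le_sum_of_subset (Finset.subset_univ _)

/-- The submodule of `H_{ℓ,N} ⊗ (W₁ ⊗ ⋯ ⊗ W_k)` by which one divides to obtain the induced module: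
it is generated by the elements `ι_i(h) ⊗ w - 1 ⊗ h w`, where `h ∈ H_{ℓ,n_i}` acts on the
`i`-th factor and `ι_i` is the embedding of `H_{ℓ,n_i}` as the `i`-th consecutive block. -/
def indRel {ℓ : ℕ} [NeZero ℓ] {k : ℕ} {n : Fin k → ℕ} {N : ℕ} (hN : ∑ i, n i = N)
    {W : Fin k → Type} [∀ i, AddCommGroup (W i)] [∀ i, Module ℂ (W i)]
    (A : ∀ i, H ℓ (n i) →ₐ[ℂ] Module.End ℂ (W i)) :
    Submodule (H ℓ N) (TensorProduct ℂ (H ℓ N) (PiTensorProduct ℂ W)) :=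
  Submodule.span _ {t | ∃ (i : Fin k) (h : H ℓ (n i)) (w : PiTensorProduct ℂ W),
    t = TensorProduct.tmul ℂ (blockHom ℓ _ (offset_add_le hN i) h) w -
      TensorProduct.tmul ℂ 1
        (PiTensorProduct.map (Function.update (fun _ => LinearMap.id) i (A i h)) w)}

/-- The module `Ind_A^{H_{ℓ,N}} (W₁ ⊗ ⋯ ⊗ W_k) = H_{ℓ,N} ⊗_A (W₁ ⊗ ⋯ ⊗ W_k)` for
`A = H_{ℓ,n₁} ⊗ ⋯ ⊗ H_{ℓ,n_k}`. -/
abbrev Ind {ℓ : ℕ} [NeZero ℓ] {k : ℕ} {n : Fin k → ℕ} {N : ℕ} (hN : ∑ i, n i = N)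
    {W : Fin k → Type} [∀ i, AddCommGroup (W i)] [∀ i, Module ℂ (W i)]
    (A : ∀ i, H ℓ (n i) →ₐ[ℂ] Module.End ℂ (W i)) : Type :=
  TensorProduct ℂ (H ℓ N) (PiTensorProduct ℂ W) ⧸ indRel hN A

/-! ### The `H_{ℓ,n}`-modules `S^D` -/

/-- The boxes of the skew diagram `λ∖μ`. -/
def skewBoxes {ℓ : ℕ} (lam mu : MultiPartition ℓ) : Set (Box ℓ) := lam.boxes \ mu.boxes

/-- The choices in the construction of `S^D` for a skew shape `D` with `N` boxes: an enumeration
`D_1, …, D_k` of the connected components of `D`, and integral skew shapes `λ_i∖μ_i` and numbers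
`α_i`, such that `D_i` is a diagonal slide, by some `(κ_i, κ_i)`, of `λ_i∖μ_i + (α_i, 0)`. -/
structure Decomposition {ℓ : ℕ} [NeZero ℓ] (D : SkewShape ℓ) (N : ℕ) where
  k : ℕ
  lam : Fin k → MultiPartition ℓ
  mu : Fin k → MultiPartition ℓ
  m : Fin k → ℕ
  n : Fin k → ℕ
  α : Fin k → ℂ
  κ : Fin k → ℂ
  /-- the correspondence between the boxes of `D` and those of the `λ_i∖μ_i` -/
  e : D.boxes ≃ Σ i, skewBoxes (lam i) (mu i)
  mu_le : ∀ i, mu i ≤ lam i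
  size_mu : ∀ i, (mu i).size = m i
  size_lam : ∀ i, (lam i).size = m i + n i
  sum_n : ∑ i, n i = N
  nonempty : ∀ i, (skewBoxes (lam i) (mu i)).Nonempty
  component : ∀ b c : D.boxes, (e b).1 = (e c).1 ↔ D.Conn b c
  translate : ∀ b : D.boxes, b.1 = ⟨(e b).2.1.β, (e b).2.1.x + α (e b).1 + κ (e b).1,
    (e b).2.1.y + κ (e b).1⟩

/-- The module `S^D`, the module induced from the tensor product of the `S^{λ_i∖μ_i}` twisted
so that `u_j` acts by `u_j + ℓ α_i`. -/
abbrev SD {ℓ : ℕ} [NeZero ℓ] (ζ : ℂ) {D : SkewShape ℓ} {N : ℕ} (P : Decomposition D N) : Type :=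
  Ind (W := fun i => SkewHom ζ (P.lam i) (P.mu i) (P.m i) (P.n i)) P.sum_n
    fun i => (skewAct ζ (P.lam i) (P.mu i) (P.m i) (P.n i)).comp (twist ℓ (P.n i) (ℓ * P.α i))

/-! ### Diagonalizable modules -/

/-- The subalgebra `𝔲` of `H_{ℓ,n}` generated by the `u_i` and the `ζ_i`. -/
def uAlg (ℓ n : ℕ) [NeZero ℓ] : Subalgebra ℂ (H ℓ n) :=
  Algebra.adjoin ℂ (Set.range (u ℓ) ∪ Set.range (z ℓ))

/-- `M` has a basis of simultaneous eigenvectors for `𝔲`. -/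
def IsUDiagonalizable.{v} (ℓ n : ℕ) [NeZero ℓ] (M : Type v) [AddCommGroup M] [Module ℂ M]
    [Module (H ℓ n) M] : Prop :=
  ∃ (ι : Type v) (v : Module.Basis ι ℂ M), ∀ i, ∀ h ∈ uAlg ℓ n, ∃ c : ℂ, h • v i = c • v i

end SkewHecke

/-! Everything is read off from weights. A simultaneous eigenvector of the u_i and ζ_i is recorded
by its sequence of labels (content, coordinate), that is, (a_i/ℓ, b_i). The intertwiner `tau`, which
is s_i minus the scalar `eLab`, turns a weight vector into one with the labels in positions i and
i+1 exchanged, provided that they differ. The intertwiners satisfy the braid relations, and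
exchanging twice gives 1 - `eLab`^2, which vanishes only if the two labels have the same coordinate
and contents that differ by one (`NearLab`).

Diagonalizability enters only through the absence of Jordan blocks of the u_i (`USemi`). Two equal
consecutive labels would produce such a block, and a pattern a, b, a contradicts the braid relation
of s_i and s_{i+1}. Moving labels out of the way by injective intertwiners, one finds that between
any two equal labels of a nonzero weight vector both neighbouring labels occur
(`IsWt.exists_between`). This condition characterizes the label sequences of standard tableaux: a
sequence that satisfies it can be laid out in rows as a skew shape (`Separated.exists_SYT`). The
labels also determine which boxes are adjacent, so that the tableau is unique up to slides
(`SYT.isSlide_of_wt_eq`).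

A weight determines a simple module. Applying intertwiners along one normal-form word for each
permutation gives, up to scalars, all vectors that intertwiners can reach from a weight vector x
(`Reach.step`, `Reach.unique`), so these vectors span a submodule containing x. Among them only x
itself can be nonzero and have the weight of x, because a permutation that inverts two equal labels
yields zero. Hence the vectors of that weight in H x are the multiples of x
(`IsWt.eq_smul_of_isWt_smul`). For two simple modules with weight vectors x, y of the same weight,
apply this to (x, y) in the product: the submodule that it generates is the graph of an isomorphism
(`nonempty_equiv_of_common_weight`).

It remains to realize the weights. The standard tableaux on D span a module `YoungModule` given by
the seminormal formulas. It is simple, because different tableaux have different weights and any two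
are connected by admissible exchanges. It is isomorphic to S^D (`nonempty_SD_equiv`): gluing
tableaux on μ and λ∖μ identifies S^{λ∖μ} with the span of the tableaux on λ∖μ, concatenating
tableaux on the components gives a nonzero map from the induced module to the simple module
`YoungModule`, and counting shuffles bounds the dimension of the induced module from above. Both
parts of the theorem then follow by comparing weights. -/

namespace SkewHecke

/-! ### Reduced words in the symmetric group -/

/-- The transposition of `i` and `i + 1`, viewed in `S_n` (trivial if `i + 1` is out of range). -/
def adj (n i : ℕ) : Equiv.Perm (Fin n) :=
  if h : i + 1 < n then Equiv.swap ⟨i, by omega⟩ ⟨i + 1, h⟩ else 1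

theorem adj_val {n i : ℕ} (h : i + 1 < n) (p : Fin n) :
    (adj n i p : ℕ) = if (p : ℕ) = i then i + 1 else if (p : ℕ) = i + 1 then i else p := by
  rw [adj, dif_pos h, Equiv.swap_apply_def]
  simp only [Fin.ext_iff]
  split_ifs <;> rfl

theorem adj_eq_swap {n : ℕ} (i i' : Fin n) (h : (i' : ℕ) = i + 1) : adj n i = Equiv.swap i i' := by
  have : (i : ℕ) + 1 < n := h ▸ i'.2
  rw [adj, dif_pos this]
  congr 1
  exact Fin.ext h.symm

theorem adj_mul_adj (n i : ℕ) : adj n i * adj n i = 1 := by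
  rw [adj]
  split_ifs <;> simp

theorem adj_mul_cancel (n i : ℕ) (π : Equiv.Perm (Fin n)) : adj n i * (adj n i * π) = π := by
  rw [← mul_assoc, adj_mul_adj, one_mul]

theorem adj_comm {n i j : ℕ} (hij : i + 1 < j) (hj : j + 1 < n) (π : Equiv.Perm (Fin n)) :
    adj n i * (adj n j * π) = adj n j * (adj n i * π) := by
  refine Equiv.ext fun p => Fin.ext ?_
  have hi : i + 1 < n := by omega
  simp only [Equiv.Perm.mul_apply, adj_val hi, adj_val hj]
  split_ifs <;> omega

theorem adj_braid {n i : ℕ} (h : i + 2 < n) (π : Equiv.Perm (Fin n)) :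
    adj n i * (adj n (i + 1) * (adj n i * π)) =
      adj n (i + 1) * (adj n i * (adj n (i + 1) * π)) := by
  refine Equiv.ext fun p => Fin.ext ?_
  have hi : i + 1 < n := by omega
  have hj : (i + 1) + 1 < n := by omega
  simp only [Equiv.Perm.mul_apply, adj_val hi, adj_val hj]
  generalize (π p : ℕ) = q
  have e1 : i + 1 + 1 ≠ i := by omega
  rcases eq_or_ne q i with h0 | h1
  · simp [h0, e1, e1.symm]
  rcases eq_or_ne q (i + 1) with h0 | h2
  · simp [h0, e1, e1.symm]
  rcases eq_or_ne q (i + 1 + 1) with h0 | h3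
  · simp [h0, e1, e1.symm]
  simp [h1, h2, h3]

/-- The adjacent transpositions generate the symmetric group. -/
theorem perm_induction {n : ℕ} {P : Equiv.Perm (Fin n) → Prop} (h1 : P 1)
    (hs : ∀ i π, i + 1 < n → P π → P (adj n i * π)) (π : Equiv.Perm (Fin n)) : P π := by
  rcases n with _ | n
  · exact Subsingleton.elim (1 : Equiv.Perm (Fin 0)) π ▸ h1
  have hπ : π ∈ Submonoid.closure (Set.range fun i : Fin n => Equiv.swap i.castSucc i.succ) := by
    rw [Equiv.Perm.mclosure_swap_castSucc_succ]
    trivial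
  induction hπ using Submonoid.closure_induction_left with
  | one => exact h1
  | mul_left x hx y _ ih =>
    obtain ⟨i, rfl⟩ := hx
    have := hs i y (by omega) ih
    rwa [show adj (n + 1) i = Equiv.swap i.castSucc i.succ from
      adj_eq_swap i.castSucc i.succ (by simp)] at this

/-- A family of operators `τ i π`, to be applied to vectors in `V π`, that satisfy the braid
relations of the symmetric group, and the quadratic relations up to scalars from `C`. -/
structure BraidSystem {n : ℕ} {E : Type*} [AddCommGroup E] [Module ℂ E]
    (τ : ℕ → Equiv.Perm (Fin n) → E →ₗ[ℂ] E) (V : Equiv.Perm (Fin n) → Submodule ℂ E)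
    (C : Submonoid ℂ) : Prop where
  maps : ∀ i π y, i + 1 < n → y ∈ V π → τ i π y ∈ V (adj n i * π)
  sq : ∀ i π y, i + 1 < n → y ∈ V π → ∃ c ∈ C, τ i (adj n i * π) (τ i π y) = c • y
  comm : ∀ i j π y, i + 1 < j → j + 1 < n → y ∈ V π →
    τ i (adj n j * π) (τ j π y) = τ j (adj n i * π) (τ i π y)
  braid : ∀ i π y, i + 2 < n → y ∈ V π →
    τ i (adj n (i + 1) * (adj n i * π)) (τ (i + 1) (adj n i * π) (τ i π y)) =
      τ (i + 1) (adj n i * (adj n (i + 1) * π)) (τ i (adj n (i + 1) * π) (τ (i + 1) π y))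

/-- The vectors obtained from `x` by the operators belonging to the words
`(j … k-1)(j' … k-2) ⋯`, the standard reduced words of the permutations. -/
inductive Reach {n : ℕ} {E : Type*} [AddCommGroup E] [Module ℂ E]
    (τ : ℕ → Equiv.Perm (Fin n) → E →ₗ[ℂ] E) (x : E) :
    ℕ → ℕ → Equiv.Perm (Fin n) → E → Prop
  | base : Reach τ x 0 0 1 x
  | up {k j : ℕ} {π : Equiv.Perm (Fin n)} {y : E} : Reach τ x k j π y →
      Reach τ x (k + 1) (k + 1) π y
  | down {k j : ℕ} {π : Equiv.Perm (Fin n)} {y : E} : Reach τ x k (j + 1) π y →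
      Reach τ x k j (adj n j * π) (τ j π y)

section

variable {n : ℕ} {E : Type*} [AddCommGroup E] [Module ℂ E]
  {τ : ℕ → Equiv.Perm (Fin n) → E →ₗ[ℂ] E} {V : Equiv.Perm (Fin n) → Submodule ℂ E}
  {C : Submonoid ℂ} {x : E}

theorem Reach.le {k j : ℕ} {π : Equiv.Perm (Fin n)} {y : E} (h : Reach τ x k j π y) : j ≤ k := by
  induction h with
  | base => exact le_rfl
  | up _ _ => exact le_rfl
  | down _ ih => omega

theorem Reach.mem (hS : BraidSystem τ V C) (hx : x ∈ V 1) {k j : ℕ} {π : Equiv.Perm (Fin n)}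
    {y : E} (h : Reach τ x k j π y) (hk : k ≤ n - 1) : y ∈ V π := by
  induction h with
  | base => exact hx
  | up _ ih => exact ih (by omega)
  | down h ih =>
    have := h.le
    exact hS.maps _ _ _ (by omega) (ih hk)

/-- The last block of the word carries the point k down to j and no letter touches larger points. So
the end of the word can be read off from the permutation, which makes the normal form unique. -/
theorem Reach.perm {k j : ℕ} {π : Equiv.Perm (Fin n)} {y : E} (h : Reach τ x k j π y)
    (hk : k ≤ n - 1) :
    (∀ p : Fin n, (p : ℕ) = k → (π p : ℕ) = j) ∧ ∀ p : Fin n, k < p → π p = p := by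
  induction h with
  | base => exact ⟨fun p hp => hp, fun p _ => rfl⟩
  | up _ ih =>
    obtain ⟨-, h2⟩ := ih (by omega)
    exact ⟨fun p hp => by rw [h2 p (by omega), hp], fun p hp => h2 p (by omega)⟩
  | down h ih =>
    obtain ⟨h1, h2⟩ := ih hk
    have := h.le
    refine ⟨fun p hp => ?_, fun p hp => Fin.ext ?_⟩
    · rw [Equiv.Perm.mul_apply, adj_val (by omega), h1 p hp]
      simp
    · rw [Equiv.Perm.mul_apply, adj_val (by omega), h2 p hp, if_neg (by omega), if_neg (by omega)]

/-- By `Reach.perm` the image of k tells whether the last block is empty (image k) and what its last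
letter is, so both derivations end with the same constructor. -/
theorem Reach.unique {k j j' : ℕ} {π : Equiv.Perm (Fin n)} {y y' : E} (h : Reach τ x k j π y)
    (hk : k ≤ n - 1) (h' : Reach τ x k j' π y') : y = y' := by
  induction h generalizing j' y' with
  | base =>
    generalize hk0 : 0 = k0 at h'
    generalize hπ : (1 : Equiv.Perm (Fin n)) = π0 at h'
    cases h' with
    | base => rfl
    | up _ => omega
    | down h'' => have := h''.le; omega
  | @up k j π y h ih =>
    generalize hk0 : k + 1 = k0 at h'
    cases h' with
    | base => omega
    | @up k' _ _ _ h'' =>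
      obtain rfl : k = k' := by omega
      exact ih (by omega) h''
    | down h'' =>
      have := h''.le
      have h3 := ((Reach.down h'').perm (by omega)).1 ⟨k + 1, by omega⟩ (by simpa using hk0)
      have h4 := ((h.perm (by omega)).2 ⟨k + 1, by omega⟩ (by simp))
      rw [h4] at h3
      simp only at h3
      omega
  | @down k j π y h ih =>
    have := h.le
    have hp := ((Reach.down h).perm hk).1 ⟨k, by omega⟩ rfl
    generalize hπ : adj n j * π = π0 at h' hp
    cases h' with
    | base => omega
    | up h'' =>
      have := (h''.perm (by omega)).2 ⟨_, show _ + 1 < n by omega⟩ (Nat.lt_succ_self _)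
      rw [this] at hp
      simp only at hp
      omega
    | down h'' =>
      have h3 := ((Reach.down h'').perm hk).1 ⟨k, by omega⟩ rfl
      obtain rfl : j = j' := hp.symm.trans h3
      obtain rfl := mul_left_cancel hπ
      rw [ih hk h'']

/-- The number d = k - j is the length of the last block. A letter other than j - 1 and j is pushed
through this block by commutation and braid relations without changing its end point j. When the
block is used up, the letter acts on the part of lower level, for which the claim is the hypothesis
`IH`. -/
theorem Reach.step_far (hS : BraidSystem τ V C) (hx : x ∈ V 1) (k : ℕ) (hk : k ≤ n - 1)
    (IH : ∀ k', k' + 1 = k → ∀ {j : ℕ} {π : Equiv.Perm (Fin n)} {y : E}, Reach τ x k' j π y →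
      ∀ i < k', ∃ c ∈ C, ∃ j' y', Reach τ x k' j' (adj n i * π) y' ∧ τ i π y = c • y')
    (d : ℕ) : ∀ {j : ℕ} {π : Equiv.Perm (Fin n)} {y : E}, Reach τ x k j π y → k = j + d →
      ∀ i < k, i ≠ j → i + 1 ≠ j →
      ∃ c ∈ C, ∃ y', Reach τ x k j (adj n i * π) y' ∧ τ i π y = c • y' := by
  induction d using Nat.strong_induction_on with
  | _ d ihd =>
    intro j π y h hd i hi hij hij'
    cases h with
    | base => omega
    | @up k j _ _ h =>
      obtain ⟨c, hc, j', y', h', e⟩ := IH k rfl h i (by omega)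
      exact ⟨c, hc, y', h'.up, e⟩
    | @down _ _ π y h =>
      have hle := h.le
      have hy := h.mem hS hx hk
      have caseComm : i ≠ j + 1 → ∃ c ∈ C, ∃ y', Reach τ x k j (adj n i * (adj n j * π)) y' ∧
          τ i (adj n j * π) (τ j π y) = c • y' := by
        intro hne
        obtain ⟨c, hc, y', h', e⟩ := ihd (d - 1) (by omega) h (by omega) i hi hne (by omega)
        rcases lt_or_gt_of_ne hij with hlt | hlt
        · refine ⟨c, hc, τ j (adj n i * π) y', ?_, ?_⟩
          rotate_left
          · rw [hS.comm i j π y (by omega) (by omega) hy, e, map_smul]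
          · rw [adj_comm (by omega) (by omega)]
            exact h'.down
        · refine ⟨c, hc, τ j (adj n i * π) y', ?_, ?_⟩
          rotate_left
          · rw [← hS.comm j i π y (by omega) (by omega) hy, e, map_smul]
          · rw [← adj_comm (by omega) (by omega)]
            exact h'.down
      -- Since i < k, the block continues with the letter j + 1 after j. The relation (j+1) j (j+1)
      -- = j (j+1) j moves the letter inwards as j, where it meets a block that is shorter by two.
      by_cases hne : i = j + 1
      · subst hne
        generalize hj1 : j + 1 = j1 at h hi hle
        cases h with
        | base => omega
        | up _ => omega
        | @down _ j2 π y h =>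
          subst hj1
          have hy := h.mem hS hx hk
          obtain ⟨c, hc, y', h', e⟩ := ihd (d - 2) (by omega) h (by have := h.le; omega) j (by omega)
            (by omega) (by omega)
          refine ⟨c, hc, τ j (adj n (j + 1) * (adj n j * π)) (τ (j + 1) (adj n j * π) y'), ?_, ?_⟩
          rotate_left
          · rw [← hS.braid j π y (by have := h.le; omega) hy, e, map_smul, map_smul]
          · rw [← adj_braid (by have := h.le; omega)]
            exact h'.down.down
      · exact caseComm hne

/-- An exchange property: the letter j - 1 lengthens the last block, the letter j cancels its end by
the quadratic relation, and every other letter passes through it by `Reach.step_far`. Consequently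
the span of the normal-form vectors is stable under all operators. -/
theorem Reach.step (hS : BraidSystem τ V C) (hx : x ∈ V 1) (k : ℕ) (hk : k ≤ n - 1) :
    ∀ {j : ℕ} {π : Equiv.Perm (Fin n)} {y : E}, Reach τ x k j π y →
      ∀ i < k, ∃ c ∈ C, ∃ j' y', Reach τ x k j' (adj n i * π) y' ∧ τ i π y = c • y' := by
  induction k with
  | zero => intro _ _ _ _ i hi; omega
  | succ k ih =>
    intro j π y h i hi
    by_cases h1 : i + 1 = j
    · subst h1
      exact ⟨1, C.one_mem, i, _, h.down, (one_smul _ _).symm⟩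
    by_cases h2 : i = j
    · subst h2
      generalize hk1 : k + 1 = k1 at h
      cases h with
      | base => omega
      | up _ => omega
      | @down _ j π y h =>
        subst hk1
        obtain ⟨c, hc, e⟩ := hS.sq i π y (by omega) (h.mem hS hx hk)
        refine ⟨c, hc, i + 1, y, ?_, e⟩
        rwa [adj_mul_cancel]
    · have hle := h.le
      obtain ⟨c, hc, y', h', e⟩ := Reach.step_far hS hx (k + 1) hk
        (fun k' hk' => by obtain rfl : k' = k := by omega
                          exact ih (by omega)) (k + 1 - j) h (by omega) i hi h2 h1
      exact ⟨c, hc, j, y', h', e⟩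

theorem Reach.top (k : ℕ) : Reach τ x k k 1 x := by
  induction k with
  | zero => exact .base
  | succ k ih => exact ih.up

end

/-- The presentation of the symmetric group by the adjacent transpositions. -/
theorem exists_perm_hom {n : ℕ} {A : Type*} [Ring A] [Algebra ℂ A] (a : ℕ → A)
    (hsq : ∀ i, i + 1 < n → a i * a i = 1)
    (hcomm : ∀ i j, i + 1 < j → j + 1 < n → a i * a j = a j * a i)
    (hbraid : ∀ i, i + 2 < n → a i * a (i + 1) * a i = a (i + 1) * a i * a (i + 1)) :
    ∃ f : Equiv.Perm (Fin n) →* A, ∀ i, i + 1 < n → f (adj n i) = a i := by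
  -- Left multiplication on A with trivial scalars: the value at a permutation will be its
  -- normal-form vector, starting from 1.
  have hS : BraidSystem (n := n) (E := A) (fun i _ => LinearMap.mulLeft ℂ (a i)) (fun _ => ⊤) ⊥ :=
    { maps := fun _ _ _ _ _ => trivial
      sq := fun i π y hi _ => ⟨1, rfl, by
        simp only [LinearMap.mulLeft_apply]
        rw [← mul_assoc, hsq i hi, one_mul, one_smul]⟩
      comm := fun i j π y hij hj _ => by
        simp only [LinearMap.mulLeft_apply]
        rw [← mul_assoc, hcomm i j hij hj, mul_assoc]
      braid := fun i π y hi _ => by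
        simp only [LinearMap.mulLeft_apply]
        rw [← mul_assoc, ← mul_assoc, hbraid i hi, mul_assoc, mul_assoc] }
  have hstep : ∀ i π j y, i + 1 < n → Reach (fun i _ => LinearMap.mulLeft ℂ (a i)) 1 (n - 1) j π y →
      ∃ j', Reach (fun i _ => LinearMap.mulLeft ℂ (a i)) 1 (n - 1) j' (adj n i * π) (a i * y) := by
    intro i π j y hi h
    obtain ⟨c, rfl, j', y', h', e⟩ := Reach.step hS trivial (n - 1) le_rfl h i (by omega)
    rw [one_smul, LinearMap.mulLeft_apply] at e
    exact ⟨j', e ▸ h'⟩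
  have hex : ∀ π : Equiv.Perm (Fin n), ∃ y : A, ∃ j,
      Reach (fun i _ => LinearMap.mulLeft ℂ (a i)) 1 (n - 1) j π y := by
    refine perm_induction ⟨1, _, Reach.top _⟩ fun i π hi ⟨y, j, h⟩ => ?_
    obtain ⟨j', h'⟩ := hstep i π j y hi h
    exact ⟨_, _, h'⟩
  choose F J hF using hex
  have hF1 : F 1 = 1 := (hF 1).unique le_rfl (Reach.top _)
  have hFs : ∀ i π, i + 1 < n → F (adj n i * π) = a i * F π := fun i π hi => by
    obtain ⟨j', h'⟩ := hstep i π _ _ hi (hF π)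
    exact (hF _).unique le_rfl h'
  refine ⟨⟨⟨F, hF1⟩, fun π σ => ?_⟩, fun i hi => ?_⟩
  · change F (π * σ) = F π * F σ
    induction π using perm_induction with
    | h1 => rw [one_mul, hF1, one_mul]
    | hs i π hi ih => rw [mul_assoc, hFs _ _ hi, ih, hFs _ _ hi, mul_assoc]
  · change F (adj n i) = a i
    have := hFs i 1 hi
    rwa [mul_one, hF1, mul_one] at this


/-! ### Combinatorics of skew shapes and standard tableaux -/

theorem Box.ext' {ℓ : ℕ} {b c : Box ℓ} (h1 : b.β = c.β) (h2 : b.x = c.x) (h3 : b.y = c.y) :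
    b = c := by
  cases b; cases c; simp_all

/-- The content and the coordinate of a box. -/
def Box.lab {ℓ : ℕ} (b : Box ℓ) : ℂ × ZMod ℓ := (b.ct, b.β)

theorem Box.ext_lab {ℓ : ℕ} {b c : Box ℓ} (h1 : b.lab = c.lab) (h2 : b.y = c.y) : b = c := by
  simp only [Box.lab, Prod.mk.injEq, Box.ct] at h1
  exact Box.ext' h1.2 (by linear_combination h1.1 + h2) h2

/-- The right neighbour of a box. -/
def Box.right {ℓ : ℕ} (b : Box ℓ) : Box ℓ := ⟨b.β, b.x + 1, b.y⟩

/-- The neighbour below a box. -/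
def Box.down {ℓ : ℕ} (b : Box ℓ) : Box ℓ := ⟨b.β, b.x, b.y + 1⟩

theorem Box.right_ct {ℓ : ℕ} (b : Box ℓ) : b.right.ct = b.ct + 1 := by
  simp only [Box.right, Box.ct]; ring

theorem Box.down_ct {ℓ : ℕ} (b : Box ℓ) : b.down.ct = b.ct - 1 := by
  simp only [Box.down, Box.ct]; ring

theorem Box.right_ne_down {ℓ : ℕ} (b : Box ℓ) : b.right ≠ b.down := by
  intro h
  have := congrArg Box.x h
  simp [Box.right, Box.down] at this

theorem Box.right_ne {ℓ : ℕ} (b : Box ℓ) : b.right ≠ b := by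
  intro h
  have := congrArg Box.x h
  simp [Box.right] at this

theorem Box.down_ne {ℓ : ℕ} (b : Box ℓ) : b.down ≠ b := by
  intro h
  have := congrArg Box.y h
  simp [Box.down] at this

theorem Box.le_refl {ℓ : ℕ} (b : Box ℓ) : b.le b := ⟨rfl, 0, 0, by simp, by simp⟩

theorem Box.le_trans {ℓ : ℕ} {a b c : Box ℓ} (h : a.le b) (h' : b.le c) : a.le c := by
  obtain ⟨h1, k, l, h2, h3⟩ := h
  obtain ⟨h1', k', l', h2', h3'⟩ := h'
  refine ⟨h1.trans h1', k + k', l + l', ?_, ?_⟩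
  · rw [h2', h2]; push_cast; ring
  · rw [h3', h3]; push_cast; ring

theorem Box.le_antisymm {ℓ : ℕ} {a b : Box ℓ} (h : a.le b) (h' : b.le a) : a = b := by
  obtain ⟨h1, k, l, h2, h3⟩ := h
  obtain ⟨h1', k', l', h2', h3'⟩ := h'
  have e1 : ((k + k' : ℕ) : ℂ) = 0 := by push_cast; linear_combination -h2 - h2'
  have e2 : ((l + l' : ℕ) : ℂ) = 0 := by push_cast; linear_combination -h3 - h3'
  rw [Nat.cast_eq_zero] at e1 e2
  obtain rfl : k = 0 := by omega
  obtain rfl : l = 0 := by omega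
  exact Box.ext' h1 (by simp [h2]) (by simp [h3])

theorem Box.le_right {ℓ : ℕ} (b : Box ℓ) : b.le b.right := ⟨rfl, 1, 0, by simp [Box.right]⟩

theorem Box.le_down {ℓ : ℕ} (b : Box ℓ) : b.le b.down := ⟨rfl, 0, 1, by simp [Box.down]⟩

theorem Box.adj_iff {ℓ : ℕ} (b c : Box ℓ) :
    b.Adj c ↔ c = b.right ∨ c = b.down ∨ b = c.right ∨ b = c.down := by
  constructor
  · rintro ⟨h, ⟨h1, h2 | h2⟩ | ⟨h1, h2 | h2⟩⟩
    · exact Or.inr (Or.inr (Or.inr (Box.ext' h h1 h2)))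
    · exact Or.inr (Or.inl (Box.ext' h.symm h1.symm (by simp [Box.down, h2])))
    · exact Or.inr (Or.inr (Or.inl (Box.ext' h h2 h1)))
    · exact Or.inl (Box.ext' h.symm (by simp [Box.right, h2]) h1.symm)
  · rintro (rfl | rfl | rfl | rfl) <;> simp [Box.Adj, Box.right, Box.down]

theorem Box.Adj.symm {ℓ : ℕ} {b c : Box ℓ} (h : b.Adj c) : c.Adj b := by
  rw [Box.adj_iff] at h ⊢
  tauto

namespace SkewShape

variable {ℓ : ℕ} (D : SkewShape ℓ)

theorem between {b c d : Box ℓ} (hb : b ∈ D.boxes) (hc : c ∈ D.boxes) (h : b.le d) (h' : d.le c) :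
    d ∈ D.boxes := by
  obtain ⟨h1, k, l, h2, h3⟩ := h
  obtain ⟨h1', k', l', h2', h3'⟩ := h'
  have := D.convex b.β b.x b.y (k + k') (l + l') hb (by
    convert hc using 1
    refine Box.ext' (h1.trans h1') ?_ ?_
    · simp only [h2', h2]; push_cast; ring
    · simp only [h3', h3]; push_cast; ring) k (by omega) l (by omega)
  convert this using 1
  exact Box.ext' h1.symm h2 h3

theorem exists_diag {b c : Box ℓ} (hb : b ∈ D.boxes) (hc : c ∈ D.boxes) (h : b.lab = c.lab) :
    ∃ p : ℤ, c.x = b.x + p ∧ c.y = b.y + p := by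
  simp only [Box.lab, Prod.mk.injEq] at h
  obtain ⟨p, q, h1, h2⟩ := D.aligned b hb c hc h.2 (Or.inl h.1.symm)
  refine ⟨p, h1, ?_⟩
  have := h.1
  simp only [Box.ct] at this
  linear_combination this + h1

theorem exists_diag_succ {b c : Box ℓ} (hb : b ∈ D.boxes) (hc : c ∈ D.boxes) (h : b.β = c.β)
    (h' : c.ct = b.ct + 1) : ∃ p : ℤ, c.x = b.x + p + 1 ∧ c.y = b.y + p := by
  obtain ⟨p, q, h1, h2⟩ := D.aligned b hb c hc h (Or.inr h')
  refine ⟨q, ?_, h2⟩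
  simp only [Box.ct] at h'
  linear_combination h' + h2

end SkewShape

theorem Box.le_cases {ℓ : ℕ} {b c : Box ℓ} (h : b.le c) : b = c ∨ b.right.le c ∨ b.down.le c := by
  obtain ⟨h1, k, l, h2, h3⟩ := h
  rcases k with _ | k
  · rcases l with _ | l
    · exact Or.inl (Box.ext' h1 (by simp [h2]) (by simp [h3]))
    · refine Or.inr (Or.inr ⟨h1, 0, l, h2, ?_⟩)
      simp only [Box.down]
      rw [h3]; push_cast; ring
  · refine Or.inr (Or.inl ⟨h1, k, l, ?_, h3⟩)
    simp only [Box.right]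
    rw [h2]; push_cast; ring

namespace SkewShape

variable {ℓ : ℕ} (D : SkewShape ℓ)

/-- Comparable boxes are joined by a path of steps to the right and down. -/
theorem chain_of_le {b c : D.boxes} (h : b.1.le c.1) :
    Relation.ReflTransGen (fun b c : D.boxes => c.1 = b.1.right ∨ c.1 = b.1.down) b c := by
  have key : ∀ (m k l : ℕ) (b : D.boxes), k + l = m → b.1.β = c.1.β → c.1.x = b.1.x + k →
      c.1.y = b.1.y + l →
      Relation.ReflTransGen (fun b c : D.boxes => c.1 = b.1.right ∨ c.1 = b.1.down) b c := by
    intro m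
    induction m with
    | zero =>
      intro k l b hm h1 h2 h3
      obtain rfl : k = 0 := by omega
      obtain rfl : l = 0 := by omega
      obtain rfl : b = c := Subtype.ext (Box.ext' h1 (by simp [h2]) (by simp [h3]))
      exact .refl
    | succ m ih =>
      intro k l b hm h1 h2 h3
      rcases k with _ | k
      · rcases l with _ | l
        · omega
        have hle : b.1.down.le c.1 := ⟨h1, 0, l, h2, by
          simp only [Box.down]; rw [h3]; push_cast; ring⟩
        have hm' := D.between b.2 c.2 b.1.le_down hle
        refine .head (b := ⟨_, hm'⟩) (Or.inr rfl) (ih 0 l ⟨_, hm'⟩ (by omega) h1 h2 ?_)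
        simp only [Box.down]; rw [h3]; push_cast; ring
      · have hle : b.1.right.le c.1 := ⟨h1, k, l, by
          simp only [Box.right]; rw [h2]; push_cast; ring, h3⟩
        have hm' := D.between b.2 c.2 b.1.le_right hle
        refine .head (b := ⟨_, hm'⟩) (Or.inl rfl) (ih k l ⟨_, hm'⟩ (by omega) h1 ?_ h3)
        simp only [Box.right]; rw [h2]; push_cast; ring
  obtain ⟨h1, k, l, h2, h3⟩ := h
  exact key _ k l b rfl h1 h2 h3

theorem Conn.symm {D : SkewShape ℓ} {b c : D.boxes} (h : D.Conn b c) : D.Conn c b :=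
  haveI : Std.Symm (fun b c : D.boxes => b.1.Adj c.1) := ⟨fun _ _ h => Box.Adj.symm h⟩
  Relation.ReflTransGen.stdSymm.symm _ _ h

theorem Conn.trans {D : SkewShape ℓ} {a b c : D.boxes} (h : D.Conn a b) (h' : D.Conn b c) :
    D.Conn a c := Relation.ReflTransGen.trans h h'

theorem conn_of_le {b c : D.boxes} (h : b.1.le c.1) : D.Conn b c := by
  refine Relation.ReflTransGen.mono (fun b c h => ?_) _ _ (D.chain_of_le h)
  rw [Box.adj_iff]
  tauto

/-- Alignment makes the difference of the boxes a vector (p + 1, p) with p an integer, and this lies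
in the positive quadrant for p ≥ 0 and in the negative one for p < 0. -/
theorem le_or_le {b c : Box ℓ} (hb : b ∈ D.boxes) (hc : c ∈ D.boxes) (h : b.β = c.β)
    (h' : c.ct = b.ct + 1) : b.le c ∨ c.le b := by
  obtain ⟨p, h1, h2⟩ := D.exists_diag_succ hb hc h h'
  rcases le_or_gt 0 p with hp | hp
  · lift p to ℕ using hp
    refine Or.inl ⟨h, p + 1, p, ?_, by simpa using h2⟩
    rw [h1]; push_cast; ring
  · obtain ⟨q, rfl⟩ : ∃ q : ℕ, p = -(q + 1) := ⟨p.natAbs - 1, by omega⟩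
    refine Or.inr ⟨h.symm, q, q + 1, ?_, ?_⟩
    · rw [h1]; push_cast; ring
    · rw [h2]; push_cast; ring

/-- Boxes on neighbouring diagonals are comparable, hence joined by a path inside the convex shape.
Slides therefore move such boxes together. -/
theorem conn_of_ct_succ {b c : D.boxes} (h : b.1.β = c.1.β) (h' : c.1.ct = b.1.ct + 1) :
    D.Conn b c := by
  rcases D.le_or_le b.2 c.2 h h' with h | h
  · exact D.conn_of_le h
  · exact (D.conn_of_le h).symm

end SkewShape

/-- A filling is standard. -/
def IsStd {ℓ n : ℕ} {S : Set (Box ℓ)} (F : S ≃ Fin n) : Prop :=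
  ∀ b c : S, b.1.le c.1 → F b ≤ F c

namespace SYT

variable {ℓ n : ℕ} {S : Set (Box ℓ)} (T : SYT S n)

/-- The bijection underlying a tableau. -/
def fill : S ≃ Fin n := T.1

theorem isStd_fill : IsStd T.fill := T.2

theorem box_eq (i : Fin n) : T.box i = (T.fill.symm i).1 := rfl

theorem mem (i : Fin n) : T.box i ∈ S := (T.fill.symm i).2

theorem exists_box {b : Box ℓ} (hb : b ∈ S) : ∃ i, T.box i = b :=
  ⟨T.fill ⟨b, hb⟩, by simp [box_eq]⟩

theorem box_apply (b : S) : T.box (T.fill b) = b.1 := by simp [box_eq]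

theorem box_inj {i j : Fin n} (h : T.box i = T.box j) : i = j :=
  T.fill.symm.injective (Subtype.ext h)

theorem le_of_le {i j : Fin n} (h : (T.box i).le (T.box j)) : i ≤ j := by
  have := T.isStd_fill (T.fill.symm i) (T.fill.symm j) h
  simpa using this

theorem lt_of_le {i j : Fin n} (h : (T.box i).le (T.box j)) (hne : T.box i ≠ T.box j) : i < j :=
  lt_of_le_of_ne (T.le_of_le h) fun e => hne (e ▸ rfl)

theorem ext_box {T T' : SYT S n} (h : ∀ i, T.box i = T'.box i) : T = T' := by
  refine Subtype.ext (Equiv.symm_bijective.injective (Equiv.ext fun i => Subtype.ext (h i)))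

/-- The sequence of labels of the boxes of a tableau. -/
def wt (i : Fin n) : ℂ × ZMod ℓ := (T.box i).lab

end SYT

theorem IsStd.exists_fill {ℓ n : ℕ} {S : Set (Box ℓ)} {F : S ≃ Fin n} (h : IsStd F) :
    ∃ T : SYT S n, T.fill = F := ⟨⟨F, h⟩, rfl⟩

theorem isStd_iff {ℓ n : ℕ} {S : Set (Box ℓ)} (F : S ≃ Fin n) :
    IsStd F ↔ ∀ i j, (F.symm i).1.le (F.symm j).1 → i ≤ j := by
  constructor
  · intro h i j hij
    have := h _ _ hij
    simpa using this
  · intro h b c hbc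
    exact h _ _ (by simpa using hbc)

namespace SYT

variable {ℓ n : ℕ} {D : SkewShape ℓ} (T : SYT D.boxes n)

/-- Between two boxes with the same label there are those to the right of and below the first. -/
theorem exists_between {i j : Fin n} (hij : i < j) (h : T.wt i = T.wt j) :
    (∃ k, i < k ∧ k < j ∧ T.box k = (T.box i).right) ∧
      ∃ k, i < k ∧ k < j ∧ T.box k = (T.box i).down := by
  obtain ⟨p, h1, h2⟩ := D.exists_diag (T.mem i) (T.mem j) h
  have hβ : (T.box i).β = (T.box j).β := congrArg Prod.snd h
  obtain ⟨q, rfl⟩ : ∃ q : ℕ, p = q + 1 := by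
    rcases le_or_gt p 0 with hp | hp
    · obtain ⟨q, rfl⟩ : ∃ q : ℕ, p = -q := ⟨p.natAbs, by omega⟩
      have : (T.box j).le (T.box i) :=
        ⟨hβ.symm, q, q, by rw [h1]; push_cast; ring, by rw [h2]; push_cast; ring⟩
      exact absurd (T.le_of_le this) (not_le.mpr hij)
    · exact ⟨p.natAbs - 1, by omega⟩
  have hr : (T.box i).right.le (T.box j) :=
    ⟨hβ, q, q + 1, by simp only [Box.right]; rw [h1]; push_cast; ring, by
      simp only [Box.right]; rw [h2]; push_cast; ring⟩
  have hd : (T.box i).down.le (T.box j) :=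
    ⟨hβ, q + 1, q, by simp only [Box.down]; rw [h1]; push_cast; ring, by
      simp only [Box.down]; rw [h2]; push_cast; ring⟩
  obtain ⟨k, hk⟩ := T.exists_box (D.between (T.mem i) (T.mem j) (Box.le_right _) hr)
  obtain ⟨k', hk'⟩ := T.exists_box (D.between (T.mem i) (T.mem j) (Box.le_down _) hd)
  have hct : (T.box i).ct = (T.box j).ct := congrArg Prod.fst h
  refine ⟨⟨k, ?_, ?_, hk⟩, k', ?_, ?_, hk'⟩
  · exact T.lt_of_le (hk ▸ Box.le_right _) (hk ▸ (Box.right_ne _).symm)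
  · refine T.lt_of_le (hk ▸ hr) fun e => ?_
    rw [hk] at e
    have := Box.right_ct (T.box i)
    rw [e, hct] at this
    simp at this
  · exact T.lt_of_le (hk' ▸ Box.le_down _) (hk' ▸ (Box.down_ne _).symm)
  · refine T.lt_of_le (hk' ▸ hd) fun e => ?_
    rw [hk'] at e
    have := Box.down_ct (T.box i)
    rw [e, hct] at this
    exact one_ne_zero (α := ℂ) (by linear_combination this)

theorem wt_ne_succ {i i' : Fin n} (h : (i' : ℕ) = i + 1) : T.wt i ≠ T.wt i' := fun e => by
  obtain ⟨⟨k, h1, h2, -⟩, -⟩ := T.exists_between (Fin.lt_def.mpr (by omega)) e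
  rw [Fin.lt_def] at h1 h2
  omega

/-- The boxes to the right of and below the box of i would both need an entry strictly between i and
i + 2. Together with `wt_ne_succ` this makes the labels of three consecutive entries distinct, as
the braid relation requires. -/
theorem wt_ne_succ_succ {i i' : Fin n} (h : (i' : ℕ) = i + 2) : T.wt i ≠ T.wt i' := fun e => by
  obtain ⟨⟨k, h1, h2, hk⟩, k', h1', h2', hk'⟩ := T.exists_between (Fin.lt_def.mpr (by omega)) e
  rw [Fin.lt_def] at h1 h2 h1' h2'
  obtain rfl : k = k' := Fin.ext (by omega)
  exact Box.right_ne_down _ (hk.symm.trans hk')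

/-- Two labels are neighbours: same coordinate, and contents that differ by one. -/
def _root_.SkewHecke.NearLab {ℓ : ℕ} (a b : ℂ × ZMod ℓ) : Prop :=
  a.2 = b.2 ∧ (b.1 = a.1 + 1 ∨ b.1 = a.1 - 1)

theorem box_le_of_near {i j : Fin n} (hij : i < j) (h : NearLab (T.wt i) (T.wt j)) :
    (T.box i).le (T.box j) := by
  obtain ⟨hβ, h⟩ := h
  have : (T.box i).le (T.box j) ∨ (T.box j).le (T.box i) := by
    rcases h with h | h
    · exact D.le_or_le (T.mem i) (T.mem j) hβ h
    · exact (D.le_or_le (T.mem j) (T.mem i) hβ.symm (by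
        simp only [SYT.wt, Box.lab] at h
        rw [h]; ring)).symm
  rcases this with h | h
  · exact h
  · exact absurd (T.le_of_le h) (not_le.mpr hij)

/-- A box strictly between two comparable boxes would need an entry between two consecutive numbers,
so the boxes are adjacent. -/
theorem near_of_box_le {i i' : Fin n} (h : (i' : ℕ) = i + 1) (hle : (T.box i).le (T.box i')) :
    NearLab (T.wt i) (T.wt i') := by
  have hlt : i < i' := Fin.lt_def.mpr (by omega)
  have aux : ∀ b : Box ℓ, (T.box i).le b → b ≠ T.box i → b.le (T.box i') → T.box i' = b := by
    intro b h1 h2 h3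
    obtain ⟨k, rfl⟩ := T.exists_box (D.between (T.mem i) (T.mem i') h1 h3)
    have h4 := T.lt_of_le h1 h2.symm
    have h5 := T.le_of_le h3
    congr 1
    rw [Fin.lt_def] at h4
    rw [Fin.le_def] at h5
    exact Fin.ext (by omega)
  refine ⟨hle.1, ?_⟩
  rcases Box.le_cases hle with e | e | e
  · exact absurd (T.box_inj e) hlt.ne
  · left
    have := aux _ (Box.le_right _) (Box.right_ne _) e
    rw [SYT.wt, SYT.wt, this]
    exact Box.right_ct _
  · right
    have := aux _ (Box.le_down _) (Box.down_ne _) e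
    rw [SYT.wt, SYT.wt, this]
    exact Box.down_ct _

/-- Exchanging consecutive entries can only violate the order between their own two boxes, and
whether these are comparable is visible in the labels. This links standardness with the vanishing of
1 - `eLab`^2. -/
theorem isStd_swap_iff {i i' : Fin n} (h : (i' : ℕ) = i + 1) :
    IsStd (T.fill.trans (Equiv.swap i i')) ↔ ¬ NearLab (T.wt i) (T.wt i') := by
  have hlt : i < i' := Fin.lt_def.mpr (by omega)
  constructor
  · intro hstd hnear
    have := hstd (T.fill.symm i) (T.fill.symm i') (T.box_le_of_near hlt hnear)
    have e : ∀ k, (T.fill.trans (Equiv.swap i i')) (T.fill.symm k) = Equiv.swap i i' k := fun k =>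
      congrArg (Equiv.swap i i') (T.fill.apply_symm_apply k)
    rw [e, e, Equiv.swap_apply_left, Equiv.swap_apply_right] at this
    exact absurd this (not_le.mpr hlt)
  · intro hnear b c hbc
    have h1 := T.isStd_fill b c hbc
    rw [Equiv.trans_apply, Equiv.trans_apply]
    by_cases hbc' : T.fill b = i ∧ T.fill c = i'
    · exfalso
      apply hnear
      apply T.near_of_box_le h
      rw [← hbc'.1, ← hbc'.2, T.box_apply, T.box_apply]
      exact hbc
    · rw [Equiv.swap_apply_def, Equiv.swap_apply_def]
      generalize T.fill b = p at h1 hbc' ⊢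
      generalize T.fill c = q at h1 hbc' ⊢
      simp only [Fin.le_def, Fin.ext_iff] at h1 hbc' ⊢
      split_ifs <;> omega

/-- The tableau obtained by exchanging two consecutive numbers. -/
def swap {i i' : Fin n} (h : IsStd (T.fill.trans (Equiv.swap i i'))) : SYT D.boxes n := ⟨_, h⟩

theorem swap_fill {i i' : Fin n} (h : IsStd (T.fill.trans (Equiv.swap i i'))) :
    (T.swap h).fill = T.fill.trans (Equiv.swap i i') := rfl

/-- Any two standard tableaux of the same shape are connected by exchanges of consecutive
numbers. -/
theorem swap_induction {P : SYT D.boxes n → Prop} (T₀ : SYT D.boxes n) (h0 : P T₀)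
    (hs : ∀ (T : SYT D.boxes n) (i i' : Fin n) (_ : (i' : ℕ) = i + 1)
      (hstd : IsStd (T.fill.trans (Equiv.swap i i'))), P T → P (T.swap hstd)) (T : SYT D.boxes n) :
    P T := by
  -- The potential drops when a descent of the sequence `T₀ (T⁻¹ i)` is exchanged. Without descents
  -- the sequence is increasing, which forces T = T₀.
  obtain ⟨m, hm⟩ : ∃ m : ℕ,
      (∑ i : Fin n, (i : ℤ) * (n - (T₀.fill (T.fill.symm i) : ℤ))).toNat = m :=
    ⟨_, rfl⟩
  induction m using Nat.strong_induction_on generalizing T with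
  | _ m ih =>
    by_cases hmono : ∀ i i' : Fin n, (i' : ℕ) = i + 1 →
        T₀.fill (T.fill.symm i) < T₀.fill (T.fill.symm i')
    · have hT : T = T₀ := by
        rcases n with _ | n
        · exact SYT.ext_box fun i => i.elim0
        have hsm : StrictMono (T.fill.symm.trans T₀.fill) :=
          Fin.strictMono_iff_lt_succ.mpr fun i => hmono _ _ (by simp)
        have := Subsingleton.elim (hsm.orderIsoOfSurjective _ (Equiv.surjective _))
          (OrderIso.refl (Fin (n + 1)))
        refine SYT.ext_box fun i => ?_
        have h2 : T₀.fill (T.fill.symm i) = i := congrArg (fun f => f i) this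
        rw [← h2, SYT.box_apply, h2]
        rfl
      exact hT ▸ h0
    · push Not at hmono
      obtain ⟨i, i', hi, hle⟩ := hmono
      have hne : i ≠ i' := fun e => by rw [e] at hi; omega
      have hlt : T₀.fill (T.fill.symm i') < T₀.fill (T.fill.symm i) :=
        lt_of_le_of_ne hle fun e => hne (T.fill.symm.injective (T₀.fill.injective e)).symm
      -- A descent can always be exchanged: otherwise the two boxes would be comparable, and T₀
      -- would have to fill them in the opposite order.
      have hstd : IsStd (T.fill.trans (Equiv.swap i i')) := by
        rw [T.isStd_swap_iff hi]
        intro hnear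
        have hb := T.box_le_of_near (Fin.lt_def.mpr (by omega)) hnear
        exact absurd (T₀.isStd_fill _ _ hb) (not_le.mpr hlt)
      have hback : (T.swap hstd).fill.trans (Equiv.swap i i') = T.fill := by
        refine Equiv.ext fun b => ?_
        simp [swap_fill]
      have hstd' : IsStd ((T.swap hstd).fill.trans (Equiv.swap i i')) := by
        rw [hback]; exact T.isStd_fill
      have : T = (T.swap hstd).swap hstd' := Subtype.ext hback.symm
      rw [this]
      refine hs _ i i' hi hstd' (ih _ ?_ _ rfl)
      have e1 : ∑ j : Fin n, (j : ℤ) * (n - (T₀.fill ((T.swap hstd).fill.symm j) : ℤ)) =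
          ∑ j : Fin n, (Equiv.swap i i' j : ℤ) * (n - (T₀.fill (T.fill.symm j) : ℤ)) := by
        rw [← Equiv.sum_comp (Equiv.swap i i')]
        simp [swap_fill]
      have e2 : ∑ j : Fin n, ((Equiv.swap i i' j : ℤ) - j) * (n - (T₀.fill (T.fill.symm j) : ℤ)) =
          (T₀.fill (T.fill.symm i') : ℤ) - T₀.fill (T.fill.symm i) := by
        rw [Fintype.sum_eq_add i i' hne]
        · simp only [Equiv.swap_apply_left, Equiv.swap_apply_right, hi]
          push_cast
          ring
        · rintro j ⟨h1, h2⟩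
          rw [Equiv.swap_apply_of_ne_of_ne h1 h2, sub_self, zero_mul]
      simp only [sub_mul, Finset.sum_sub_distrib] at e2
      have e3 : 0 ≤ ∑ j : Fin n, (j : ℤ) * (n - (T₀.fill ((T.swap hstd).fill.symm j) : ℤ)) :=
        Finset.sum_nonneg fun j _ => mul_nonneg (by positivity) (by omega)
      rw [Fin.lt_def] at hlt
      omega

end SYT

/-- Standard tableaux exist. -/
theorem exists_SYT {ℓ n : ℕ} (S : Set (Box ℓ)) (hS : S.Finite) (h : S.ncard = n) :
    Nonempty (SYT S n) := by
  let _ : PartialOrder S :=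
    { le := fun b c => b.1.le c.1
      le_refl := fun b => b.1.le_refl
      le_trans := fun _ _ _ => Box.le_trans
      le_antisymm := fun _ _ h h' => Subtype.ext (Box.le_antisymm h h') }
  have := hS.fintype
  let _ : Fintype (LinearExtension S) := inferInstanceAs (Fintype S)
  have hc : Fintype.card (LinearExtension S) = n := by
    rw [← h, Set.ncard_eq_toFinset_card', Set.toFinset_card]
    rfl
  let f : S ≃ Fin n := (Fintype.orderIsoFinOfCardEq (LinearExtension S) hc).symm.toEquiv
  refine ⟨f, fun b c hbc => ?_⟩
  have : toLinearExtension b ≤ toLinearExtension c := toLinearExtension.monotone hbc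
  exact (Fintype.orderIsoFinOfCardEq (LinearExtension S) hc).symm.monotone this

/-- A tableau is determined by its labels; more generally, the first labels of a tableau determine
its restriction to a lower set. -/
theorem SYT.box_eq_of_wt_eq {ℓ N m : ℕ} {D : SkewShape ℓ} {S : Set (Box ℓ)} (hS : S ⊆ D.boxes)
    (hlow : ∀ b ∈ D.boxes, ∀ c ∈ S, b.le c → b ∈ S) (hm : m ≤ N) (T : SYT D.boxes N) (T' : SYT S m)
    (h : ∀ i : Fin m, (T.box (Fin.castLE hm i)).lab = (T'.box i).lab) (i : Fin m) :
    T.box (Fin.castLE hm i) = T'.box i := by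
  induction i using Fin.strong_induction_on with
  | _ i ih =>
    obtain ⟨p, h1, h2⟩ := D.exists_diag (T.mem (Fin.castLE hm i)) (hS (T'.mem i)) (h i)
    have hβ : (T.box (Fin.castLE hm i)).β = (T'.box i).β := congrArg Prod.snd (h i)
    -- The two boxes lie on one diagonal. The upper left one carries a smaller entry in the tableau
    -- that contains the other; by induction both tableaux have this entry in the same box, which
    -- then contains two different entries.
    by_contra hne
    rcases le_total 0 p with hp | hp
    · lift p to ℕ using hp
      have hle : (T.box (Fin.castLE hm i)).le (T'.box i) :=
        ⟨hβ, p, p, by simpa using h1, by simpa using h2⟩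
      obtain ⟨j, hj⟩ := T'.exists_box (hlow _ (T.mem _) _ (T'.mem i) hle)
      have hji : j < i := T'.lt_of_le (hj ▸ hle) (by rw [hj]; exact hne)
      have := T.box_inj ((ih j hji).trans hj)
      rw [Fin.castLE_inj] at this
      exact hji.ne this
    · obtain ⟨q, rfl⟩ : ∃ q : ℕ, p = -q := ⟨p.natAbs, by omega⟩
      have hle : (T'.box i).le (T.box (Fin.castLE hm i)) :=
        ⟨hβ.symm, q, q, by rw [h1]; push_cast; ring, by rw [h2]; push_cast; ring⟩
      obtain ⟨j, hj⟩ := T.exists_box (hS (T'.mem i))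
      have hji : j < Fin.castLE hm i :=
        T.lt_of_le (hj ▸ hle) (by rw [hj]; exact fun e => hne e.symm)
      have hj' : Fin.castLE hm ⟨j, by rw [Fin.lt_def] at hji; simp at hji; omega⟩ = j := Fin.ext rfl
      have := ih ⟨j, by rw [Fin.lt_def] at hji; simp at hji; omega⟩ hji
      rw [hj', hj] at this
      have := T'.box_inj this
      rw [← hj', ← this] at hji
      exact absurd hji (lt_irrefl _)

theorem SYT.wt_injective {ℓ n : ℕ} {D : SkewShape ℓ} {T T' : SYT D.boxes n} (h : T.wt = T'.wt) :
    T = T' := by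
  refine SYT.ext_box fun i => ?_
  have := SYT.box_eq_of_wt_eq (m := n) subset_rfl (fun _ h _ _ _ => h) le_rfl T T'
    (fun i => congrFun h i) i
  simpa using this

namespace SYT

variable {ℓ n : ℕ} {D : SkewShape ℓ} (T : SYT D.boxes n)

/-- An entry with one of the two labels lies on the diagonal of one of the two boxes, hence it comes
no later than i or no earlier than j. The criterion mentions labels only and not the shape, so it
transfers to every tableau with the same labels. -/
theorem box_eq_right_iff {i j : Fin n} : T.box j = (T.box i).right ↔
    i < j ∧ (T.wt i).2 = (T.wt j).2 ∧ (T.wt j).1 = (T.wt i).1 + 1 ∧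
      ∀ k, i < k → k < j → T.wt k ≠ T.wt i ∧ T.wt k ≠ T.wt j := by
  constructor
  · intro h
    have hβ : (T.box i).β = (T.box j).β := by rw [h]; rfl
    have hct : (T.box j).ct = (T.box i).ct + 1 := by rw [h, Box.right_ct]
    refine ⟨T.lt_of_le (h ▸ Box.le_right _) (h ▸ (Box.right_ne _).symm), hβ, hct,
      fun k h1 h2 => ⟨fun e => ?_, fun e => ?_⟩⟩
    · obtain ⟨p, e1, e2⟩ := D.exists_diag (T.mem i) (T.mem k) e.symm
      rcases le_or_gt p 0 with hp | hp
      · obtain ⟨q, rfl⟩ : ∃ q : ℕ, p = -q := ⟨p.natAbs, by omega⟩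
        refine absurd (T.le_of_le (i := k) (j := i) ⟨congrArg Prod.snd e, q, q, ?_, ?_⟩)
          (not_le.mpr h1)
        · rw [e1]; push_cast; ring
        · rw [e2]; push_cast; ring
      · obtain ⟨q, rfl⟩ : ∃ q : ℕ, p = q + 1 := ⟨p.natAbs - 1, by omega⟩
        refine absurd (T.le_of_le (i := j) (j := k) ?_) (not_le.mpr h2)
        rw [h]
        refine ⟨(congrArg Prod.snd e).symm, q, q + 1, ?_, ?_⟩
        · simp only [Box.right]; rw [e1]; push_cast; ring
        · simp only [Box.right]; rw [e2]; push_cast; ring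
    · obtain ⟨p, e1, e2⟩ := D.exists_diag (T.mem j) (T.mem k) e.symm
      rw [h] at e1 e2
      simp only [Box.right] at e1 e2
      rcases le_or_gt 0 p with hp | hp
      · lift p to ℕ using hp
        refine absurd (T.le_of_le (i := j) (j := k) ?_) (not_le.mpr h2)
        rw [h]
        exact ⟨hβ.trans (congrArg Prod.snd e).symm, p, p, e1, e2⟩
      · obtain ⟨q, rfl⟩ : ∃ q : ℕ, p = -(q + 1) := ⟨p.natAbs - 1, by omega⟩
        refine absurd (T.le_of_le (i := k) (j := i) ⟨(congrArg Prod.snd e).trans hβ.symm, q, q + 1,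
          ?_, ?_⟩) (not_le.mpr h1)
        · rw [e1]; push_cast; ring
        · rw [e2]; push_cast; ring
  · rintro ⟨hij, hβ, hct, hk⟩
    obtain ⟨-, k, l, h1, h2⟩ := T.box_le_of_near hij ⟨hβ, Or.inl hct⟩
    have hkl : k = l + 1 := by
      have : ((k : ℕ) : ℂ) = ((l + 1 : ℕ) : ℂ) := by
        simp only [SYT.wt, Box.lab, Box.ct] at hct
        push_cast
        linear_combination hct - h1 + h2
      exact_mod_cast this
    subst hkl
    have hle : (T.box i).right.le (T.box j) := ⟨hβ, l, l, by
      simp only [Box.right]; rw [h1]; push_cast; ring, h2⟩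
    obtain ⟨m, hm⟩ := T.exists_box (D.between (T.mem i) (T.mem j) (Box.le_right _) hle)
    have him : i < m := T.lt_of_le (hm ▸ Box.le_right _) (hm ▸ (Box.right_ne _).symm)
    have hlab : T.wt m = T.wt j := by
      rw [SYT.wt, SYT.wt, hm]
      exact Prod.ext ((Box.right_ct _).trans hct.symm) hβ
    rcases (T.le_of_le (hm ▸ hle)).lt_or_eq with h | rfl
    · exact absurd hlab (hk m him h).2
    · exact hm

theorem box_eq_down_iff {i j : Fin n} : T.box j = (T.box i).down ↔
    i < j ∧ (T.wt i).2 = (T.wt j).2 ∧ (T.wt j).1 = (T.wt i).1 - 1 ∧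
      ∀ k, i < k → k < j → T.wt k ≠ T.wt i ∧ T.wt k ≠ T.wt j := by
  constructor
  · intro h
    have hβ : (T.box i).β = (T.box j).β := by rw [h]; rfl
    have hct : (T.box j).ct = (T.box i).ct - 1 := by rw [h, Box.down_ct]
    refine ⟨T.lt_of_le (h ▸ Box.le_down _) (h ▸ (Box.down_ne _).symm), hβ, hct,
      fun k h1 h2 => ⟨fun e => ?_, fun e => ?_⟩⟩
    · obtain ⟨p, e1, e2⟩ := D.exists_diag (T.mem i) (T.mem k) e.symm
      rcases le_or_gt p 0 with hp | hp
      · obtain ⟨q, rfl⟩ : ∃ q : ℕ, p = -q := ⟨p.natAbs, by omega⟩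
        refine absurd (T.le_of_le (i := k) (j := i) ⟨congrArg Prod.snd e, q, q, ?_, ?_⟩)
          (not_le.mpr h1)
        · rw [e1]; push_cast; ring
        · rw [e2]; push_cast; ring
      · obtain ⟨q, rfl⟩ : ∃ q : ℕ, p = q + 1 := ⟨p.natAbs - 1, by omega⟩
        refine absurd (T.le_of_le (i := j) (j := k) ?_) (not_le.mpr h2)
        rw [h]
        refine ⟨(congrArg Prod.snd e).symm, q + 1, q, ?_, ?_⟩
        · simp only [Box.down]; rw [e1]; push_cast; ring
        · simp only [Box.down]; rw [e2]; push_cast; ring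
    · obtain ⟨p, e1, e2⟩ := D.exists_diag (T.mem j) (T.mem k) e.symm
      rw [h] at e1 e2
      simp only [Box.down] at e1 e2
      rcases le_or_gt 0 p with hp | hp
      · lift p to ℕ using hp
        refine absurd (T.le_of_le (i := j) (j := k) ?_) (not_le.mpr h2)
        rw [h]
        exact ⟨hβ.trans (congrArg Prod.snd e).symm, p, p, e1, e2⟩
      · obtain ⟨q, rfl⟩ : ∃ q : ℕ, p = -(q + 1) := ⟨p.natAbs - 1, by omega⟩
        refine absurd (T.le_of_le (i := k) (j := i) ⟨(congrArg Prod.snd e).trans hβ.symm, q + 1, q,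
          ?_, ?_⟩) (not_le.mpr h1)
        · rw [e1]; push_cast; ring
        · rw [e2]; push_cast; ring
  · rintro ⟨hij, hβ, hct, hk⟩
    obtain ⟨-, k, l, h1, h2⟩ := T.box_le_of_near hij ⟨hβ, Or.inr hct⟩
    have hkl : l = k + 1 := by
      have : ((l : ℕ) : ℂ) = ((k + 1 : ℕ) : ℂ) := by
        simp only [SYT.wt, Box.lab, Box.ct] at hct
        push_cast
        linear_combination h1 - h2 - hct
      exact_mod_cast this
    subst hkl
    have hle : (T.box i).down.le (T.box j) := ⟨hβ, k, k, h1, by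
      simp only [Box.down]; rw [h2]; push_cast; ring⟩
    obtain ⟨m, hm⟩ := T.exists_box (D.between (T.mem i) (T.mem j) (Box.le_down _) hle)
    have him : i < m := T.lt_of_le (hm ▸ Box.le_down _) (hm ▸ (Box.down_ne _).symm)
    have hlab : T.wt m = T.wt j := by
      rw [SYT.wt, SYT.wt, hm]
      exact Prod.ext ((Box.down_ct _).trans hct.symm) hβ
    rcases (T.le_of_le (hm ▸ hle)).lt_or_eq with h | rfl
    · exact absurd hlab (hk m him h).2
    · exact hm

/-- Two tableaux with the same labels differ by diagonal slides. -/
theorem isSlide_of_wt_eq {D' : SkewShape ℓ} (T' : SYT D'.boxes n) (h : T'.wt = T.wt) :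
    IsSlide D D' (T.fill.trans T'.fill.symm) := by
  have hlab : ∀ b : D.boxes, (T.fill.trans T'.fill.symm b).1.lab = b.1.lab := fun b => by
    have := congrFun h (T.fill b)
    simp only [SYT.wt, T.box_apply] at this
    exact this
  -- The amount of the slide has to be the difference of the rows. It is constant along steps right
  -- and down, since adjacency is a condition on the labels.
  refine ⟨fun b => (T.fill.trans T'.fill.symm b).1.y - b.1.y, fun b c hbc => ?_, fun b => ?_⟩
  · induction hbc with
    | refl => rfl
    | @tail c d _ hcd ih =>
      have hr : ∀ i j : Fin n, T.box j = (T.box i).right → T'.box j = (T'.box i).right := by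
        intro i j hij
        rw [box_eq_right_iff] at hij ⊢
        rwa [h]
      have hd : ∀ i j : Fin n, T.box j = (T.box i).down → T'.box j = (T'.box i).down := by
        intro i j hij
        rw [box_eq_down_iff] at hij ⊢
        rwa [h]
      have hr' : ∀ b c : D.boxes, c.1 = b.1.right →
          (T.fill.trans T'.fill.symm c).1 = (T.fill.trans T'.fill.symm b).1.right := fun b c hbc =>
        hr (T.fill b) (T.fill c) (by rw [T.box_apply, T.box_apply, hbc])
      have hd' : ∀ b c : D.boxes, c.1 = b.1.down →
          (T.fill.trans T'.fill.symm c).1 = (T.fill.trans T'.fill.symm b).1.down := fun b c hbc =>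
        hd (T.fill b) (T.fill c) (by rw [T.box_apply, T.box_apply, hbc])
      rw [Box.adj_iff] at hcd
      refine ih.trans ?_
      beta_reduce
      rcases hcd with e | e | e | e
      · rw [hr' _ _ e, e]; rfl
      · rw [hd' _ _ e, e]; simp [Box.down]
      · rw [hr' _ _ e, e]; rfl
      · rw [hd' _ _ e, e]; simp [Box.down]
  · refine Box.ext_lab ((hlab b).trans ?_) ?_
    · simp only [Box.lab, Box.ct, Prod.mk.injEq, and_true]
      ring
    · simp

end SYT

/-! ### Transport of tableaux along slides -/

namespace IsSlide

variable {ℓ : ℕ} {D D' : SkewShape ℓ} {e : D.boxes ≃ D'.boxes}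

theorem lab_eq (h : IsSlide D D' e) (b : D.boxes) : (e b).1.lab = b.1.lab := by
  obtain ⟨κ, -, h⟩ := h
  rw [h]
  simp [Box.lab, Box.ct]

/-- Comparability after the slide is a chain of unit steps. The two boxes of a step have contents
that differ by one, so they were in one component of D already and were moved by the same vector:
the step existed before. -/
theorem le_of_le (h : IsSlide D D' e) {b c : D.boxes} (hbc : (e b).1.le (e c).1) : b.1.le c.1 := by
  have hch := D'.chain_of_le hbc
  generalize hx : e b = x at hch
  generalize hy : e c = y at hch
  clear hbc
  induction hch using Relation.ReflTransGen.head_induction_on generalizing b with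
  | refl =>
    rw [e.injective (hx.trans hy.symm)]
    exact Box.le_refl _
  | @head x z hxz hzy ih =>
    obtain ⟨d, rfl⟩ := e.surjective z
    subst hx
    have hd : d.1 = b.1.right ∨ d.1 = b.1.down := by
      have hl1 := h.lab_eq b
      have hl2 := h.lab_eq d
      obtain ⟨κ, hκ, hs⟩ := h
      rcases hxz with hxz | hxz
      · have hβ : b.1.β = d.1.β := by
          have := congrArg Box.β hxz
          rw [hs, hs] at this
          exact this.symm
        have hct : d.1.ct = b.1.ct + 1 := by
          have e1 : (e b).1.ct = b.1.ct := congrArg Prod.fst hl1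
          have e2 : (e d).1.ct = d.1.ct := congrArg Prod.fst hl2
          rw [← e1, ← e2, hxz, Box.right_ct]
        have hκ' := hκ b d (D.conn_of_ct_succ hβ hct)
        left
        have h1 := congrArg Box.x hxz
        have h2 := congrArg Box.y hxz
        rw [hs, hs] at h1 h2
        simp only [Box.right] at h1 h2
        exact Box.ext' hβ.symm (by simp only [Box.right]; linear_combination h1 + hκ')
          (by simp only [Box.right]; linear_combination h2 + hκ')
      · have hβ : b.1.β = d.1.β := by
          have := congrArg Box.β hxz
          rw [hs, hs] at this
          exact this.symm
        have hct : b.1.ct = d.1.ct + 1 := by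
          have e1 : (e b).1.ct = b.1.ct := congrArg Prod.fst hl1
          have e2 : (e d).1.ct = d.1.ct := congrArg Prod.fst hl2
          rw [← e1, ← e2, hxz, Box.down_ct, sub_add_cancel]
        have hκ' := hκ d b (D.conn_of_ct_succ hβ.symm hct)
        right
        have h1 := congrArg Box.x hxz
        have h2 := congrArg Box.y hxz
        rw [hs, hs] at h1 h2
        simp only [Box.down] at h1 h2
        exact Box.ext' hβ.symm (by simp only [Box.down]; linear_combination h1 - hκ')
          (by simp only [Box.down]; linear_combination h2 - hκ')
    refine Box.le_trans ?_ (ih rfl)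
    rcases hd with hd | hd <;> rw [hd]
    exacts [Box.le_right _, Box.le_down _]

/-- Slides carry standard tableaux to standard tableaux with the same labels. -/
theorem exists_SYT (h : IsSlide D D' e) {n : ℕ} (T : SYT D.boxes n) :
    ∃ T' : SYT D'.boxes n, T'.wt = T.wt := by
  refine ⟨⟨e.symm.trans T.fill, fun b c hbc => ?_⟩, funext fun i => ?_⟩
  · exact T.isStd_fill _ _ (h.le_of_le (by simpa using hbc))
  · simp only [SYT.wt, SYT.box, Equiv.symm_trans_apply, Equiv.symm_symm]
    exact h.lab_eq _

end IsSlide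


/-! ### Young's seminormal form -/

/-- The diagonal coefficient in the seminormal form. -/
def eLab {ℓ : ℕ} (a b : ℂ × ZMod ℓ) : ℂ := open Classical in if a.2 = b.2 then (b.1 - a.1)⁻¹ else 0

/-- The off-diagonal coefficient in the seminormal form, made zero where the exchange of the two
boxes is not allowed. -/
def xLab {ℓ : ℕ} (a b : ℂ × ZMod ℓ) : ℂ := open Classical in
  if eLab a b ^ 2 = 1 then 0 else 1 + eLab a b

theorem eLab_symm {ℓ : ℕ} (a b : ℂ × ZMod ℓ) : eLab b a = -eLab a b := by
  by_cases h : a.2 = b.2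
  · rw [eLab, eLab, if_pos h, if_pos h.symm, ← neg_sub, inv_neg]
  · rw [eLab, eLab, if_neg h, if_neg (Ne.symm h), neg_zero]

theorem xLab_mul {ℓ : ℕ} (a b : ℂ × ZMod ℓ) : xLab a b * xLab b a = 1 - eLab a b ^ 2 := by
  rw [xLab, xLab, eLab_symm a b, neg_sq]
  split_ifs with h
  · rw [h]; ring
  · ring

/-- A partial fraction identity for 1/(b - a), 1/(c - b) and 1/(c - a); if the coordinates are not
all equal, both sides vanish. It is the source of the braid relation, both for the seminormal form
and for the intertwiners. -/
theorem eLab_mul {ℓ : ℕ} {a b c : ℂ × ZMod ℓ} (hab : a ≠ b) (hbc : b ≠ c) (hac : a ≠ c) :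
    eLab a b * eLab b c = eLab a c * (eLab a b + eLab b c) := by
  by_cases h1 : a.2 = b.2
  · by_cases h2 : b.2 = c.2
    · rw [eLab, eLab, eLab, if_pos h1, if_pos h2, if_pos (h1.trans h2)]
      have e1 : b.1 - a.1 ≠ 0 := fun e => hab (Prod.ext (sub_eq_zero.mp e).symm h1)
      have e2 : c.1 - b.1 ≠ 0 := fun e => hbc (Prod.ext (sub_eq_zero.mp e).symm h2)
      have e3 : c.1 - a.1 ≠ 0 := fun e => hac (Prod.ext (sub_eq_zero.mp e).symm (h1.trans h2))
      field_simp
      ring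
    · have h3 : a.2 ≠ c.2 := fun e => h2 (h1.symm.trans e)
      simp [eLab, h2, h3]
  · by_cases h2 : b.2 = c.2
    · have h3 : a.2 ≠ c.2 := fun e => h1 (e.trans h2.symm)
      simp [eLab, h1, h3]
    · simp [eLab, h1, h2]

theorem eLab_sq_eq_one_iff {ℓ : ℕ} (a b : ℂ × ZMod ℓ) : eLab a b ^ 2 = 1 ↔ NearLab a b := by
  rw [NearLab, eLab]
  split_ifs with h
  · rw [inv_pow, inv_eq_one, show (b.1 - a.1) ^ 2 = 1 ↔ b.1 - a.1 = 1 ∨ b.1 - a.1 = -1 from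
      sq_eq_one_iff]
    simp only [h, true_and, sub_eq_iff_eq_add', ← sub_eq_add_neg]
  · simp [h]

theorem eLab_sq_ne {ℓ : ℕ} {a b : ℂ × ZMod ℓ} (h : ¬ NearLab a b) : 1 - eLab a b ^ 2 ≠ 0 := by
  rw [sub_ne_zero]
  exact fun e => h ((eLab_sq_eq_one_iff a b).mp e.symm)

theorem xLab_of_near {ℓ : ℕ} {a b : ℂ × ZMod ℓ} (h : NearLab a b) : xLab a b = 0 :=
  if_pos ((eLab_sq_eq_one_iff a b).mpr h)

theorem xLab_of_not_near {ℓ : ℕ} {a b : ℂ × ZMod ℓ} (h : ¬ NearLab a b) :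
    xLab a b = 1 + eLab a b :=
  if_neg (mt (eLab_sq_eq_one_iff a b).mp h)

theorem xLab_ne_zero {ℓ : ℕ} {a b : ℂ × ZMod ℓ} (h : ¬ NearLab a b) : xLab a b ≠ 0 := by
  intro e
  have := xLab_mul a b
  rw [e, zero_mul] at this
  exact eLab_sq_ne h this.symm

theorem NearLab.symm {ℓ : ℕ} {a b : ℂ × ZMod ℓ} (h : NearLab a b) : NearLab b a :=
  ⟨h.1.symm, by rcases h.2 with h | h <;> rw [h] <;> simp⟩

/-- The label of the box that contains `i`. -/
def flab {ℓ n : ℕ} {S : Set (Box ℓ)} (F : S ≃ Fin n) (i : Fin n) : ℂ × ZMod ℓ := (F.symm i).1.lab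

theorem flab_swap {ℓ n : ℕ} {S : Set (Box ℓ)} (F : S ≃ Fin n) (i j k : Fin n) :
    flab (F.trans (Equiv.swap i j)) k = flab F (Equiv.swap i j k) := by
  simp [flab]

theorem trans_swap_swap {α : Type*} {n : ℕ} (F : α ≃ Fin n) (i j : Fin n) :
    (F.trans (Equiv.swap i j)).trans (Equiv.swap i j) = F := by
  ext b
  simp

section

variable {ℓ n : ℕ} {S : Set (Box ℓ)}

theorem youngVec_std (T : SYT S n) : youngVec T.fill = youngBasis S n T :=
  dif_pos T.isStd_fill

theorem youngVec_eq_zero {F : S ≃ Fin n} (h : ¬ IsStd F) : youngVec F = 0 := dif_neg h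

/-- Two linear maps that agree on all the vectors `v_T` are equal. -/
theorem young_ext {V : Type*} [AddCommGroup V] [Module ℂ V] {f g : YoungSpace S n →ₗ[ℂ] V}
    (h : ∀ T : SYT S n, f (youngVec T.fill) = g (youngVec T.fill)) : f = g :=
  (youngBasis S n).ext fun T => by rw [← youngVec_std, h T]

/-- The operator that multiplies `v_T` by `g T`. -/
def diagOp (S : Set (Box ℓ)) (n : ℕ) (g : (S ≃ Fin n) → ℂ) :
    YoungSpace S n →ₗ[ℂ] YoungSpace S n :=
  (youngBasis S n).constr ℂ fun T => g T.fill • youngBasis S n T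

theorem diagOp_apply (g : (S ≃ Fin n) → ℂ) (F : S ≃ Fin n) :
    diagOp S n g (youngVec F) = g F • youngVec F := by
  by_cases h : IsStd F
  · obtain ⟨T, rfl⟩ := h.exists_fill
    rw [youngVec_std, diagOp, Module.Basis.constr_basis]
  · rw [youngVec_eq_zero h, map_zero, smul_zero]

theorem diagOp_mul (g h : (S ≃ Fin n) → ℂ) :
    (diagOp S n g : Module.End ℂ (YoungSpace S n)) * diagOp S n h = diagOp S n (g * h) :=
  young_ext fun T => by
    rw [Module.End.mul_apply, diagOp_apply, map_smul, diagOp_apply, diagOp_apply, smul_smul,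
      mul_comm, Pi.mul_apply]

theorem diagOp_one : (diagOp S n 1 : Module.End ℂ (YoungSpace S n)) = 1 :=
  young_ext fun T => by
    rw [diagOp_apply, Pi.one_apply, one_smul, Module.End.one_apply]

theorem diagOp_sum {ι : Type*} (s : Finset ι) (g : ι → (S ≃ Fin n) → ℂ) :
    ∑ c ∈ s, diagOp S n (g c) = diagOp S n (∑ c ∈ s, g c) :=
  young_ext fun T => by
    rw [LinearMap.sum_apply, diagOp_apply, Finset.sum_apply, Finset.sum_smul]
    simp only [diagOp_apply]

theorem youngS_basis (T : SYT S n) (i j : Fin n) : youngS S i j (youngBasis S n T) =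
    open Classical in if (T.wt i).2 = (T.wt j).2 then
      ((T.wt j).1 - (T.wt i).1)⁻¹ • youngBasis S n T +
        (1 + ((T.wt j).1 - (T.wt i).1)⁻¹) • youngVec (T.fill.trans (Equiv.swap i j))
    else youngVec (T.fill.trans (Equiv.swap i j)) :=
  Module.Basis.constr_basis _ _ _ _

theorem youngZ_eq (ζ : ℂ) (i : Fin n) :
    youngZ ζ S i = diagOp S n fun F => ζ ^ (flab F i).2.val := rfl

end

section

variable {ℓ n : ℕ} (D : SkewShape ℓ)

/-- One formula for all fillings: if exactly one of F and the exchanged filling is standard, the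
labels are near and `xLab` is zero; for different coordinates the coefficients become 0 and 1. The
relations can then be checked by comparing coefficients, without distinguishing which fillings are
standard. -/
theorem youngS_apply {i i' : Fin n} (hi : (i' : ℕ) = i + 1) (F : D.boxes ≃ Fin n) :
    youngS D.boxes i i' (youngVec F) = eLab (flab F i) (flab F i') • youngVec F +
      xLab (flab F i) (flab F i') • youngVec (F.trans (Equiv.swap i i')) := by
  by_cases h : IsStd F
  · obtain ⟨T, rfl⟩ := h.exists_fill
    rw [youngVec_std, youngS_basis]
    change _ = eLab (T.wt i) (T.wt i') • _ + xLab (T.wt i) (T.wt i') • _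
    by_cases h2 : IsStd (T.fill.trans (Equiv.swap i i'))
    · rw [xLab_of_not_near ((T.isStd_swap_iff hi).mp h2)]
      by_cases h3 : (T.wt i).2 = (T.wt i').2
      · rw [if_pos h3, eLab, if_pos h3]
      · rw [if_neg h3, eLab, if_neg h3, zero_smul, add_zero, one_smul, zero_add]
    · rw [youngVec_eq_zero h2, smul_zero, smul_zero, add_zero]
      have h3 := not_not.mp (mt (T.isStd_swap_iff hi).mpr h2)
      rw [if_pos h3.1, eLab, if_pos h3.1, add_zero]
  · rw [youngVec_eq_zero h, map_zero, smul_zero, zero_add]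
    by_cases h2 : IsStd (F.trans (Equiv.swap i i'))
    · obtain ⟨T, hT⟩ := h2.exists_fill
      have h3 := (T.isStd_swap_iff hi).not.mp (by
        rw [hT, trans_swap_swap]; exact h)
      have h4 : NearLab (flab T.fill i) (flab T.fill i') := not_not.mp h3
      rw [hT] at h4
      rw [flab_swap, flab_swap, Equiv.swap_apply_left, Equiv.swap_apply_right] at h4
      rw [xLab_of_near h4.symm, zero_smul]
    · rw [youngVec_eq_zero h2, smul_zero]

theorem youngS_sq {i i' : Fin n} (hi : (i' : ℕ) = i + 1) :
    (youngS D.boxes i i' : Module.End ℂ (YoungSpace D.boxes n)) * youngS D.boxes i i' = 1 := by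
  refine young_ext fun T => ?_
  have hx := xLab_mul (flab T.fill i) (flab T.fill i')
  rw [Module.End.mul_apply, Module.End.one_apply, youngS_apply D hi, map_add, map_smul, map_smul,
    youngS_apply D hi, youngS_apply D hi, flab_swap, flab_swap, Equiv.swap_apply_left,
    Equiv.swap_apply_right, eLab_symm (flab T.fill i), trans_swap_swap]
  match_scalars
  · linear_combination hx
  · ring

theorem youngS_comm {i i' j j' : Fin n} (hi : (i' : ℕ) = i + 1) (hj : (j' : ℕ) = j + 1)
    (hij : (i : ℕ) + 1 < j) :
    (youngS D.boxes i i' : Module.End ℂ (YoungSpace D.boxes n)) * youngS D.boxes j j' =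
      youngS D.boxes j j' * youngS D.boxes i i' := by
  have h1 : i ≠ j := fun e => by rw [e] at hij; omega
  have h2 : i ≠ j' := fun e => by rw [e] at hij; omega
  have h3 : i' ≠ j := fun e => by rw [← e] at hij; omega
  have h4 : i' ≠ j' := fun e => by rw [e] at hi; omega
  refine young_ext fun T => ?_
  have hsw : (T.fill.trans (Equiv.swap j j')).trans (Equiv.swap i i') =
      (T.fill.trans (Equiv.swap i i')).trans (Equiv.swap j j') := by
    refine Equiv.ext fun b => ?_
    simp only [Equiv.trans_apply]
    generalize T.fill b = k
    simp only [Equiv.swap_apply_def]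
    split_ifs <;> simp_all
  simp only [Module.End.mul_apply, youngS_apply D hi, youngS_apply D hj, map_add, map_smul,
    flab_swap, Equiv.swap_apply_of_ne_of_ne h1 h2, Equiv.swap_apply_of_ne_of_ne h3 h4,
    Equiv.swap_apply_of_ne_of_ne h1.symm h3.symm, Equiv.swap_apply_of_ne_of_ne h2.symm h4.symm, hsw]
  module

theorem youngS_braid {i j k : Fin n} (hj : (j : ℕ) = i + 1) (hk : (k : ℕ) = j + 1) :
    (youngS D.boxes i j : Module.End ℂ (YoungSpace D.boxes n)) * youngS D.boxes j k *
      youngS D.boxes i j = youngS D.boxes j k * youngS D.boxes i j * youngS D.boxes j k := by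
  have hij : i ≠ j := fun e => by rw [e] at hj; omega
  have hjk : j ≠ k := fun e => by rw [e] at hk; omega
  have hik : i ≠ k := fun e => by rw [e] at hj; omega
  refine young_ext fun T => ?_
  -- Three consecutive entries of a standard tableau have distinct labels, so no denominator
  -- vanishes.
  have hY := eLab_mul (T.wt_ne_succ hj) (T.wt_ne_succ hk) (T.wt_ne_succ_succ (by omega))
  have hsw : ((T.fill.trans (Equiv.swap i j)).trans (Equiv.swap j k)).trans (Equiv.swap i j) =
      ((T.fill.trans (Equiv.swap j k)).trans (Equiv.swap i j)).trans (Equiv.swap j k) := by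
    refine Equiv.ext fun b => ?_
    simp only [Equiv.trans_apply]
    generalize T.fill b = m
    simp only [Equiv.swap_apply_def]
    split_ifs <;> simp_all
  have e12 : eLab (flab T.fill j) (flab T.fill i) = _ := eLab_symm _ _
  have e23 : eLab (flab T.fill k) (flab T.fill j) = _ := eLab_symm _ _
  have x12 := xLab_mul (flab T.fill i) (flab T.fill j)
  have x23 := xLab_mul (flab T.fill j) (flab T.fill k)
  simp only [Module.End.mul_apply, youngS_apply D hj, youngS_apply D hk, map_add, map_smul,
    flab_swap, Equiv.swap_apply_left, Equiv.swap_apply_right, trans_swap_swap, hsw,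
    Equiv.swap_apply_of_ne_of_ne hij hik, Equiv.swap_apply_of_ne_of_ne hik.symm hjk.symm]
  change eLab (flab T.fill i) (flab T.fill j) * eLab (flab T.fill j) (flab T.fill k) =
    eLab (flab T.fill i) (flab T.fill k) * (eLab (flab T.fill i) (flab T.fill j) +
      eLab (flab T.fill j) (flab T.fill k)) at hY
  simp only [e12, e23]
  generalize eLab (flab T.fill i) (flab T.fill j) = a at *
  generalize eLab (flab T.fill j) (flab T.fill k) = b at *
  generalize eLab (flab T.fill i) (flab T.fill k) = c at *
  match_scalars
  · linear_combination c * x12 - c * x23 + (a - b) * hY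
  · linear_combination xLab (flab T.fill i) (flab T.fill j) * hY
  · linear_combination -xLab (flab T.fill j) (flab T.fill k) * hY
  all_goals ring

end


/-! ### The modules attached to skew shapes -/

/-- The images of group elements are units, so the universal property of the semidirect product can
be used for the group of units. Compatibility with adjacent transpositions extends to all
permutations word by word. -/
theorem exists_G_hom {ℓ n : ℕ} {A : Type*} [Ring A] (f : Equiv.Perm (Fin n) →* A)
    (δ : (Fin n → Multiplicative (ZMod ℓ)) →* A)
    (h : ∀ i d, i + 1 < n → f (adj n i) * δ d = δ (mulAutArrow (adj n i) d) * f (adj n i)) :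
    ∃ ρ : G ℓ n →* A, (∀ w, ρ (SemidirectProduct.inr w) = f w) ∧
      ∀ d, ρ (SemidirectProduct.inl d) = δ d := by
  have h' : ∀ w d, f w * δ d = δ (mulAutArrow w d) * f w := by
    intro w
    induction w using perm_induction with
    | h1 => intro d; simp
    | hs i π hi ih =>
      intro d
      rw [map_mul, mul_assoc, ih, ← mul_assoc, h i _ hi, mul_assoc, map_mul]
      rfl
  refine ⟨(Units.coeHom A).comp (SemidirectProduct.lift δ.toHomUnits f.toHomUnits fun w => ?_),
    fun w => ?_, fun d => ?_⟩
  · refine MonoidHom.ext fun d => Units.ext ?_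
    change δ (mulAutArrow w d) = f w * δ d * ((f.toHomUnits w)⁻¹ : Aˣ)
    rw [h' w d, mul_assoc]
    change _ = _ * (((f.toHomUnits w) : A) * ((f.toHomUnits w)⁻¹ : Aˣ))
    rw [Units.mul_inv, mul_one]
  · simp
  · simp

/-- The additive character of `ℤ/ℓ` attached to a primitive root of unity. -/
def chi {ℓ : ℕ} [NeZero ℓ] {ζ : ℂ} (hζ : IsPrimitiveRoot ζ ℓ) : AddChar (ZMod ℓ) ℂ :=
  AddChar.zmodChar ℓ hζ.pow_eq_one

theorem chi_apply {ℓ : ℕ} [NeZero ℓ] {ζ : ℂ} (hζ : IsPrimitiveRoot ζ ℓ) (a : ZMod ℓ) :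
    chi hζ a = ζ ^ a.val := AddChar.zmodChar_apply _ _

/-- Orthogonality of characters. It evaluates the correction term in the relation between s_i and
u_i: ℓ if the two coordinates agree and 0 otherwise. -/
theorem sum_chi {ℓ : ℕ} [NeZero ℓ] {ζ : ℂ} (hζ : IsPrimitiveRoot ζ ℓ) (b b' : ZMod ℓ) :
    ∑ c : ZMod ℓ, chi hζ (c * b) * chi hζ (-c * b') = if b = b' then (ℓ : ℂ) else 0 := by
  have := AddChar.sum_mulShift (b - b') (AddChar.zmodChar_primitive_of_primitive_root ℓ hζ)
  rw [ZMod.card] at this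
  simp only [sub_eq_zero, mul_sub] at this
  rw [← Nat.cast_zero, ← Nat.cast_ite, ← this]
  refine Finset.sum_congr rfl fun c _ => ?_
  rw [← AddChar.map_add_eq_mul]
  congr 1
  ring

theorem chi_injective {ℓ : ℕ} [NeZero ℓ] {ζ : ℂ} (hζ : IsPrimitiveRoot ζ ℓ) {a b : ZMod ℓ}
    (h : ζ ^ a.val = ζ ^ b.val) : a = b :=
  ZMod.val_injective ℓ (hζ.pow_inj a.val_lt b.val_lt h)

section

variable {ℓ n : ℕ} [NeZero ℓ] {ζ : ℂ} (hζ : IsPrimitiveRoot ζ ℓ) (D : SkewShape ℓ)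

/-- The off-diagonal part of the exchange permutes the eigenvalues, which the first condition
describes; the diagonal part fixes v_T, so g and g' must agree on fillings where it does not vanish.
-/
theorem youngS_mul_diagOp {i i' : Fin n} (hi : (i' : ℕ) = i + 1)
    (g g' : (D.boxes ≃ Fin n) → ℂ) (h : ∀ F, g F = g' (F.trans (Equiv.swap i i')))
    (h' : ∀ F, eLab (flab F i) (flab F i') ≠ 0 → g F = g' F) :
    (youngS D.boxes i i' : Module.End ℂ (YoungSpace D.boxes n)) * diagOp D.boxes n g =
      diagOp D.boxes n g' * youngS D.boxes i i' := by
  refine young_ext fun T => ?_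
  rw [Module.End.mul_apply, Module.End.mul_apply, diagOp_apply, map_smul, youngS_apply D hi,
    map_add, map_smul, map_smul, diagOp_apply, diagOp_apply, ← h]
  by_cases h0 : eLab (flab T.fill i) (flab T.fill i') = 0
  · rw [h0]; module
  · rw [← h' _ h0]; module

theorem exists_youngRep : ∃ ρ : G ℓ n →* Module.End ℂ (YoungSpace D.boxes n),
    (∀ i i' : Fin n, (i' : ℕ) = i + 1 → ρ (s i i') = youngS D.boxes i i') ∧
      ∀ i c, ρ (zetaPow i c) = diagOp D.boxes n fun F => chi hζ (c * (flab F i).2) := by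
  obtain ⟨f, hf⟩ := exists_perm_hom (n := n) (A := Module.End ℂ (YoungSpace D.boxes n))
    (fun i => if h : i + 1 < n then youngS D.boxes ⟨i, by omega⟩ ⟨i + 1, h⟩ else 1)
    (fun i hi => by
      rw [dif_pos hi]
      exact youngS_sq D rfl)
    (fun i j hij hj => by
      rw [dif_pos hj, dif_pos (by omega)]
      exact youngS_comm D rfl rfl hij)
    (fun i hi => by
      rw [dif_pos (by omega), dif_pos (by omega)]
      exact youngS_braid D rfl rfl)
  let δ : (Fin n → Multiplicative (ZMod ℓ)) →* Module.End ℂ (YoungSpace D.boxes n) :=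
    { toFun := fun d => diagOp D.boxes n fun F => ∏ i, chi hζ ((d i).toAdd * (flab F i).2)
      map_one' := by
        rw [← diagOp_one]
        congr 1
        ext F
        simp
      map_mul' := fun d d' => by
        rw [diagOp_mul]
        congr 1
        ext F
        simp [add_mul, AddChar.map_add_eq_mul, Finset.prod_mul_distrib] }
  have hδ : ∀ d, δ d = diagOp D.boxes n fun F => ∏ i, chi hζ ((d i).toAdd * (flab F i).2) :=
    fun _ => rfl
  obtain ⟨ρ, h1, h2⟩ := exists_G_hom f δ (fun i d hi => by
    rw [hf i hi, dif_pos hi, hδ, hδ]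
    have hadj : adj n i = Equiv.swap ⟨i, by omega⟩ ⟨i + 1, hi⟩ := dif_pos hi
    generalize hi0 : (⟨i, by omega⟩ : Fin n) = i0 at *
    generalize hi1 : (⟨i + 1, hi⟩ : Fin n) = i1 at *
    refine youngS_mul_diagOp D (by rw [← hi0, ← hi1]) _ _ (fun F => ?_) (fun F hF => ?_)
    · rw [← Equiv.prod_comp (Equiv.swap i0 i1)]
      refine Finset.prod_congr rfl fun k _ => ?_
      rw [flab_swap, act_apply, hadj, Equiv.swap_inv]
    -- A nonzero diagonal coefficient means equal coordinates, and then exchanging them does not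
    -- alter the product.
    · have hβ : (flab F i0).2 = (flab F i1).2 := by
        by_contra hne
        exact hF (if_neg hne)
      rw [← Equiv.prod_comp (Equiv.swap i0 i1)]
      refine Finset.prod_congr rfl fun k _ => ?_
      rw [act_apply, hadj, Equiv.swap_inv]
      congr 2
      rw [Equiv.swap_apply_def]
      split_ifs with h1 h2
      · rw [h1, hβ]
      · rw [h2, hβ]
      · rfl)
  refine ⟨ρ, fun i i' hi => ?_, fun i c => ?_⟩
  · have := h1 (adj n i)
    rw [hf i (by omega), dif_pos (by omega), adj_eq_swap i i' hi] at this
    rw [s, this]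
    congr 1
    exact Fin.ext hi.symm
  · rw [zetaPow, h2, hδ]
    congr 1
    ext F
    rw [Finset.prod_eq_single i]
    · simp
    · intro k _ hk
      rw [Pi.mulSingle_eq_of_ne hk]
      simp
    · simp

/-- Young's seminormal representation on the space with basis the standard tableaux of a skew
shape. -/
def youngRep (n : ℕ) : G ℓ n →* Module.End ℂ (YoungSpace D.boxes n) :=
  Classical.choose (exists_youngRep hζ D)

theorem youngRep_s {i i' : Fin n} (hi : (i' : ℕ) = i + 1) :
    youngRep hζ D n (s i i') = youngS D.boxes i i' :=
  (Classical.choose_spec (exists_youngRep hζ D)).1 i i' hi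

theorem youngRep_zetaPow (i : Fin n) (c : ZMod ℓ) :
    youngRep hζ D n (zetaPow i c) = diagOp D.boxes n fun F => chi hζ (c * (flab F i).2) :=
  (Classical.choose_spec (exists_youngRep hζ D)).2 i c

/-- The operator by which `u_i` acts. -/
def youngU (S : Set (Box ℓ)) (i : Fin n) : Module.End ℂ (YoungSpace S n) :=
  diagOp S n fun F => ℓ * (flab F i).1

theorem sum_youngRep_zetaPow (i i' : Fin n) :
    ∑ c : ZMod ℓ, youngRep hζ D n (zetaPow i c * zetaPow i' (-c)) =
      diagOp D.boxes n fun F => if (flab F i).2 = (flab F i').2 then (ℓ : ℂ) else 0 := by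
  simp only [map_mul, youngRep_zetaPow, diagOp_mul]
  rw [diagOp_sum]
  congr 1
  ext F
  rw [Finset.sum_apply]
  simp only [Pi.mul_apply]
  exact sum_chi hζ _ _

theorem youngS_mul_youngU {i i' : Fin n} (hi : (i' : ℕ) = i + 1) :
    (youngS D.boxes i i' : Module.End ℂ (YoungSpace D.boxes n)) * youngU D.boxes i =
      youngU D.boxes i' * youngS D.boxes i i' -
        diagOp D.boxes n fun F => if (flab F i).2 = (flab F i').2 then (ℓ : ℂ) else 0 := by
  refine young_ext fun T => ?_
  rw [LinearMap.sub_apply, Module.End.mul_apply, Module.End.mul_apply, youngU, youngU, diagOp_apply,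
    map_smul, youngS_apply D hi, map_add, map_smul, map_smul, diagOp_apply, diagOp_apply,
    diagOp_apply, flab_swap, Equiv.swap_apply_right]
  -- The diagonal coefficient is the inverse of the difference of contents precisely so that it
  -- produces the correction term of the relation.
  have key : eLab (flab T.fill i) (flab T.fill i') * ((flab T.fill i').1 - (flab T.fill i).1) =
      if (flab T.fill i).2 = (flab T.fill i').2 then 1 else 0 := by
    rw [eLab]
    split_ifs with h
    · refine inv_mul_cancel₀ fun e => T.wt_ne_succ hi (Prod.ext (sub_eq_zero.mp e).symm h)
    · rw [zero_mul]
  have key' : (if (flab T.fill i).2 = (flab T.fill i').2 then (ℓ : ℂ) else 0) =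
      ℓ * if (flab T.fill i).2 = (flab T.fill i').2 then 1 else 0 := by
    rw [mul_ite, mul_one, mul_zero]
  rw [key', ← key]
  module

/-- The action of `H_{ℓ,n}` on the space with basis the standard tableaux of a skew shape. -/
def youngAct (n : ℕ) : H ℓ n →ₐ[ℂ] Module.End ℂ (YoungSpace D.boxes n) :=
  liftH (fun i => youngU D.boxes i) (youngRep hζ D n)
    (fun i j => by
      rw [youngU, youngU, diagOp_mul, diagOp_mul, mul_comm])
    (fun i j => by
      rw [zeta, youngRep_zetaPow, youngU, diagOp_mul, diagOp_mul, mul_comm])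
    (fun i i' j hi hj hj' => by
      rw [youngRep_s hζ D hi]
      refine youngS_mul_diagOp D hi _ _ (fun F => ?_) (fun F _ => rfl)
      rw [flab_swap, Equiv.swap_apply_of_ne_of_ne hj hj'])
    (fun i i' hi => by
      rw [youngRep_s hζ D hi, sum_youngRep_zetaPow]
      exact youngS_mul_youngU D hi)

theorem youngAct_u (i : Fin n) : youngAct hζ D n (u ℓ i) = youngU D.boxes i := by
  rw [youngAct, u, liftH_mkH, freeU, FreeAlgebra.lift_ι_apply]
  rfl

theorem youngAct_gp (g : G ℓ n) : youngAct hζ D n (gp g) = youngRep hζ D n g := by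
  rw [youngAct, gp, liftH_mkH, freeG, FreeAlgebra.lift_ι_apply]
  rfl

end

/-- The `H_{ℓ,n}`-module with basis the standard tableaux of a skew shape. -/
def YoungModule {ℓ : ℕ} [NeZero ℓ] {ζ : ℂ} (_ : IsPrimitiveRoot ζ ℓ) (D : SkewShape ℓ) (n : ℕ) :
    Type := YoungSpace D.boxes n

section

variable {ℓ n : ℕ} [NeZero ℓ] {ζ : ℂ} (hζ : IsPrimitiveRoot ζ ℓ) (D : SkewShape ℓ)

instance : AddCommGroup (YoungModule hζ D n) :=
  inferInstanceAs (AddCommGroup (YoungSpace D.boxes n))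

instance : Module ℂ (YoungModule hζ D n) :=
  inferInstanceAs (Module ℂ (YoungSpace D.boxes n))

instance : Module (H ℓ n) (YoungModule hζ D n) :=
  Module.compHom (YoungSpace D.boxes n) (youngAct hζ D n).toRingHom

theorem youngModule_smul (h : H ℓ n) (v : YoungModule hζ D n) :
    h • v = (youngAct hζ D n h : YoungSpace D.boxes n →ₗ[ℂ] YoungSpace D.boxes n) v := rfl

instance : IsScalarTower ℂ (H ℓ n) (YoungModule hζ D n) where
  smul_assoc c h v := by
    rw [youngModule_smul, youngModule_smul, map_smul]
    rfl

/-- The vector attached to a filling, in the module attached to a skew shape. -/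
def yVec (F : D.boxes ≃ Fin n) : YoungModule hζ D n := youngVec F

theorem u_smul_yVec (i : Fin n) (F : D.boxes ≃ Fin n) :
    u ℓ i • yVec hζ D F = (ℓ * (flab F i).1) • yVec hζ D F := by
  rw [youngModule_smul, youngAct_u]
  exact diagOp_apply _ _

theorem zetaPow_smul_yVec (i : Fin n) (c : ZMod ℓ) (F : D.boxes ≃ Fin n) :
    (gp (zetaPow i c) : H ℓ n) • yVec hζ D F = chi hζ (c * (flab F i).2) • yVec hζ D F := by
  rw [youngModule_smul, youngAct_gp, youngRep_zetaPow]
  exact diagOp_apply _ _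

theorem s_smul_yVec {i i' : Fin n} (hi : (i' : ℕ) = i + 1) (F : D.boxes ≃ Fin n) :
    (gp (s i i') : H ℓ n) • yVec hζ D F = eLab (flab F i) (flab F i') • yVec hζ D F +
      xLab (flab F i) (flab F i') • yVec hζ D (F.trans (Equiv.swap i i')) := by
  rw [youngModule_smul, youngAct_gp, youngRep_s hζ D hi]
  exact youngS_apply D hi F

/-- The basis of the module attached to a skew shape. -/
def yBasis (n : ℕ) : Module.Basis (SYT D.boxes n) ℂ (YoungModule hζ D n) := youngBasis D.boxes n

theorem yBasis_apply (T : SYT D.boxes n) : yBasis hζ D n T = yVec hζ D T.fill :=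
  (youngVec_std T).symm

end


/-! ### Weight vectors -/

section Generators

variable {ℓ n : ℕ} [NeZero ℓ]

theorem zetaPow_mul_s (i j k : Fin n) (c : ZMod ℓ) :
    (zetaPow k c * s i j : G ℓ n) = s i j * zetaPow (Equiv.swap i j k) c := by
  refine SemidirectProduct.ext (funext fun x => ?_) ?_
  · simp only [zetaPow, s, SemidirectProduct.mul_left, SemidirectProduct.left_inl,
      SemidirectProduct.left_inr, SemidirectProduct.right_inl,
      SemidirectProduct.right_inr, Pi.mul_apply, Pi.one_apply, act_apply, one_mul, map_one, mul_one,
      Equiv.swap_inv, Pi.mulSingle_apply, EmbeddingLike.apply_eq_iff_eq]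
  · simp [zetaPow, s]

theorem zetaPow_add (k : Fin n) (c d : ZMod ℓ) :
    (zetaPow k (c + d) : G ℓ n) = zetaPow k c * zetaPow k d := by
  rw [zetaPow, zetaPow, zetaPow, ← map_mul, ofAdd_add, Pi.mulSingle_mul]

theorem s_mul_s (i j : Fin n) : (s i j * s i j : G ℓ n) = 1 := by
  rw [s, ← map_mul, Equiv.swap_mul_self, map_one]

/-- `G(ℓ,1,n)` is generated by the `s_i` and the powers of the `ζ_i`. -/
theorem group_induction {P : G ℓ n → Prop} (h1 : P 1) (hmul : ∀ g h, P g → P h → P (g * h))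
    (hs : ∀ i i' : Fin n, (i' : ℕ) = i + 1 → P (s i i')) (hz : ∀ i c, P (zetaPow i c)) (g : G ℓ n) :
    P g := by
  have hr : ∀ w, P (SemidirectProduct.inr w : G ℓ n) := by
    intro w
    induction w using perm_induction with
    | h1 => rwa [map_one]
    | hs i π hi ih =>
      rw [map_mul, show adj n i = Equiv.swap ⟨i, by omega⟩ ⟨i + 1, hi⟩ from dif_pos hi]
      exact hmul _ _ (hs _ _ rfl) ih
  have hl : ∀ d, P (SemidirectProduct.inl d : G ℓ n) := by
    intro d
    let S : Submonoid (Fin n → Multiplicative (ZMod ℓ)) :=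
      { carrier := {d | P (SemidirectProduct.inl d : G ℓ n)}
        one_mem' := by rwa [Set.mem_ofPred_eq, map_one]
        mul_mem' := fun {a b} ha hb => by
          rw [Set.mem_ofPred_eq, map_mul]
          exact hmul _ _ ha hb }
    have : d ∈ S := by
      rw [← Finset.univ_prod_mulSingle d]
      exact S.prod_mem fun i _ => hz i (d i).toAdd
    exact this
  rw [← SemidirectProduct.inl_left_mul_inr_right g]
  exact hmul _ _ (hl _) (hr _)

/-- `H_{ℓ,n}` is generated by the `u_i`, the `s_i` and the `ζ_i`. -/
theorem subalgebra_eq_top (S : Subalgebra ℂ (H ℓ n)) (hu : ∀ i, u ℓ i ∈ S)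
    (hs : ∀ i i' : Fin n, (i' : ℕ) = i + 1 → gp (s i i') ∈ S)
    (hz : ∀ i c, gp (zetaPow i c) ∈ S) : S = ⊤ := by
  have hg : ∀ g : G ℓ n, gp g ∈ S := group_induction (by rw [gp_one]; exact S.one_mem)
    (fun g h hg hh => by rw [gp_mul]; exact S.mul_mem hg hh) hs hz
  refine eq_top_iff.mpr fun h _ => ?_
  obtain ⟨x, rfl⟩ := mkH_surjective ℓ n h
  induction x using FreeAlgebra.induction with
  | grade0 r => rw [AlgHom.commutes]; exact S.algebraMap_mem r
  | grade1 x =>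
    rcases x with i | g
    exacts [hu i, hg g]
  | mul x y hx hy => rw [map_mul]; exact S.mul_mem (hx trivial) (hy trivial)
  | add x y hx hy => rw [map_add]; exact S.add_mem (hx trivial) (hy trivial)

end Generators

section Weights

variable {ℓ n : ℕ} [NeZero ℓ] {M : Type*} [AddCommGroup M] [Module ℂ M] [Module (H ℓ n) M]

/-- The vector `x` is a simultaneous eigenvector of the `u_i` and `ζ_i`, with the eigenvalues
given by the sequence of labels `w`. -/
def IsWt (ζ : ℂ) (w : Fin n → ℂ × ZMod ℓ) (x : M) : Prop :=
  ∀ i, u ℓ i • x = (ℓ * (w i).1) • x ∧ z ℓ i • x = ζ ^ (w i).2.val • x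

variable [IsScalarTower ℂ (H ℓ n) M]

theorem submodule_stable (Y : Submodule ℂ M) (hu : ∀ i, ∀ y ∈ Y, u ℓ (n := n) i • y ∈ Y)
    (hs : ∀ i i' : Fin n, (i' : ℕ) = i + 1 → ∀ y ∈ Y, gp (ℓ := ℓ) (s i i') • y ∈ Y)
    (hz : ∀ (i : Fin n) (c : ZMod ℓ), ∀ y ∈ Y, gp (zetaPow i c) • y ∈ Y) (h : H ℓ n) {y : M}
    (hy : y ∈ Y) : h • y ∈ Y := by
  let S : Subalgebra ℂ (H ℓ n) :=
    { carrier := {h | ∀ y ∈ Y, h • y ∈ Y}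
      mul_mem' := fun {a b} ha hb y hy => by rw [mul_smul]; exact ha _ (hb _ hy)
      add_mem' := fun {a b} ha hb y hy => by rw [add_smul]; exact Y.add_mem (ha _ hy) (hb _ hy)
      algebraMap_mem' := fun r y hy => by rw [algebraMap_smul]; exact Y.smul_mem _ hy }
  have : h ∈ S := by
    rw [subalgebra_eq_top S hu hs hz]
    trivial
  exact this y hy

variable {ζ : ℂ} (hζ : IsPrimitiveRoot ζ ℓ) {w : Fin n → ℂ × ZMod ℓ} {x : M}

/-- The space of weight vectors of given weight. -/
def wtSpace (ζ : ℂ) (w : Fin n → ℂ × ZMod ℓ) (M : Type*) [AddCommGroup M] [Module ℂ M]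
    [Module (H ℓ n) M] [IsScalarTower ℂ (H ℓ n) M] : Submodule ℂ M where
  carrier := {x | IsWt ζ w x}
  zero_mem' i := by simp
  add_mem' hx hy i := ⟨by rw [smul_add, smul_add, (hx i).1, (hy i).1],
    by rw [smul_add, smul_add, (hx i).2, (hy i).2]⟩
  smul_mem' c x hx i := ⟨by rw [smul_comm, (hx i).1, smul_comm],
    by rw [smul_comm, (hx i).2, smul_comm]⟩

theorem mem_wtSpace : x ∈ wtSpace ζ w M ↔ IsWt ζ w x := Iff.rfl

include hζ in
theorem isWt_iff : IsWt ζ w x ↔ (∀ i, u ℓ i • x = (ℓ * (w i).1) • x) ∧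
    ∀ i c, (gp (zetaPow i c) : H ℓ n) • x = chi hζ (c * (w i).2) • x := by
  constructor
  · refine fun h => ⟨fun i => (h i).1, fun i c => ?_⟩
    have key : ∀ m : ℕ, (gp (zetaPow i (m : ZMod ℓ)) : H ℓ n) • x =
        chi hζ (m * (w i).2) • x := by
      intro m
      induction m with
      | zero =>
        rw [Nat.cast_zero, zero_mul, AddChar.map_zero_eq_one, one_smul]
        have : (zetaPow i 0 : G ℓ n) = 1 := by
          rw [zetaPow, ofAdd_zero, Pi.mulSingle_one, map_one]
        rw [this, gp_one, one_smul]
      | succ m ih =>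
        have h2 : (gp (zetaPow i 1) : H ℓ n) • x = ζ ^ (w i).2.val • x := (h i).2
        rw [Nat.cast_succ, zetaPow_add, gp_mul, mul_smul, h2, smul_comm, ih, smul_smul, add_mul,
          one_mul, AddChar.map_add_eq_mul, chi_apply hζ (w i).2, mul_comm]
    have := key c.val
    rwa [ZMod.natCast_zmod_val] at this
  · rintro ⟨h1, h2⟩ i
    refine ⟨h1 i, ?_⟩
    have := h2 i 1
    rwa [one_mul, chi_apply] at this

include hζ in
theorem IsWt.sum_smul (h : IsWt ζ w x) (i i' : Fin n) :
    (∑ c : ZMod ℓ, (gp (zetaPow i c * zetaPow i' (-c)) : H ℓ n)) • x =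
      (if (w i).2 = (w i').2 then (ℓ : ℂ) else 0) • x := by
  rw [Finset.sum_smul, ← sum_chi hζ, Finset.sum_smul]
  refine Finset.sum_congr rfl fun c _ => ?_
  rw [gp_mul, mul_smul, ((isWt_iff hζ).mp h).2, smul_comm, ((isWt_iff hζ).mp h).2, smul_smul,
    mul_comm]

include hζ in
theorem IsWt.s_zeta (h : IsWt ζ w x) (i j k : Fin n) (c : ZMod ℓ) :
    (gp (zetaPow k c) : H ℓ n) • (gp (s i j) : H ℓ n) • x =
      chi hζ (c * (w (Equiv.swap i j k)).2) • (gp (s i j) : H ℓ n) • x := by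
  rw [← mul_smul, ← gp_mul, zetaPow_mul_s, gp_mul, mul_smul, ((isWt_iff hζ).mp h).2, smul_comm]

include hζ in
theorem IsWt.u_succ_s (h : IsWt ζ w x) {i i' : Fin n} (hi : (i' : ℕ) = i + 1) :
    u ℓ i' • (gp (s i i') : H ℓ n) • x = (ℓ * (w i).1) • (gp (s i i') : H ℓ n) • x +
      (if (w i).2 = (w i').2 then (ℓ : ℂ) else 0) • x := by
  have := congrArg (· • x) (s_u (ℓ := ℓ) i i' hi)
  simp only [sub_smul, mul_smul, h.sum_smul hζ] at this
  rw [← sub_eq_iff_eq_add, ← this, (h i).1, smul_comm]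

theorem s_smul_s (i j : Fin n) (x : M) : (gp (s i j) : H ℓ n) • (gp (s i j) : H ℓ n) • x = x := by
  rw [← mul_smul, ← gp_mul, s_mul_s, gp_one, one_smul]

include hζ in
theorem IsWt.u_s (h : IsWt ζ w x) {i i' : Fin n} (hi : (i' : ℕ) = i + 1) :
    u ℓ i • (gp (s i i') : H ℓ n) • x = (ℓ * (w i').1) • (gp (s i i') : H ℓ n) • x -
      (if (w i).2 = (w i').2 then (ℓ : ℂ) else 0) • x := by
  have := congrArg (· • (gp (s i i') : H ℓ n) • x) (s_u (ℓ := ℓ) i i' hi)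
  have hsum : (∑ c : ZMod ℓ, (gp (zetaPow i c * zetaPow i' (-c)) : H ℓ n)) •
      (gp (s i i') : H ℓ n) • x =
      (if (w i).2 = (w i').2 then (ℓ : ℂ) else 0) • (gp (s i i') : H ℓ n) • x := by
    rw [show (if (w i).2 = (w i').2 then (ℓ : ℂ) else 0) =
      if (w i').2 = (w i).2 then (ℓ : ℂ) else 0 by simp only [eq_comm], Finset.sum_smul,
      ← sum_chi hζ, Finset.sum_smul]
    refine Finset.sum_congr rfl fun c _ => ?_
    rw [gp_mul, mul_smul, h.s_zeta hζ, smul_comm, h.s_zeta hζ, smul_smul, Equiv.swap_apply_left,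
      Equiv.swap_apply_right, mul_comm]
  simp only [sub_smul, mul_smul, hsum, s_smul_s] at this
  have h2 := congrArg ((gp (s i i') : H ℓ n) • ·) this
  simp only [s_smul_s, smul_sub] at h2
  rw [h2, (h i').1, smul_comm, smul_comm (gp (s i i') : H ℓ n), s_smul_s]

theorem IsWt.u_s_far (h : IsWt ζ w x) {i i' j : Fin n} (hi : (i' : ℕ) = i + 1) (hj : j ≠ i)
    (hj' : j ≠ i') :
    u ℓ j • (gp (s i i') : H ℓ n) • x = (ℓ * (w j).1) • (gp (s i i') : H ℓ n) • x := by
  rw [← mul_smul, ← s_u_far i i' j hi hj hj', mul_smul, (h j).1, smul_comm]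

/-- The intertwining operator that exchanges the adjacent labels `a` and `b`. -/
def tau (M : Type*) [AddCommGroup M] [Module ℂ M] [Module (H ℓ n) M] [IsScalarTower ℂ (H ℓ n) M]
    (i i' : Fin n) (a b : ℂ × ZMod ℓ) : M →ₗ[ℂ] M :=
  DistribSMul.toLinearMap ℂ M (gp (s i i') : H ℓ n) - eLab a b • LinearMap.id

theorem tau_apply (i i' : Fin n) (a b : ℂ × ZMod ℓ) (x : M) :
    tau M i i' a b x = (gp (s i i') : H ℓ n) • x - eLab a b • x := rfl

/-- The operator s_i has square 1 and `eLab` is antisymmetric. So an intertwiner is invertible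
unless the two labels are near. -/
theorem tau_tau (i i' : Fin n) (a b : ℂ × ZMod ℓ) (x : M) :
    tau M i i' b a (tau M i i' a b x) = (1 - eLab a b ^ 2) • x := by
  simp only [tau_apply, smul_sub, s_smul_s, eLab_symm a b, smul_comm (gp (s i i') : H ℓ n)]
  generalize (gp (s i i') : H ℓ n) • x = y
  module

include hζ in
-- The vector s_i x fails to be a weight vector only by a multiple of x, coming from the correction
-- term in the relation with u_i. Subtracting `eLab` times x removes it, which is possible since the
-- labels differ.
theorem IsWt.tau (h : IsWt ζ w x) {i i' : Fin n} (hi : (i' : ℕ) = i + 1) (hne : w i ≠ w i') :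
    IsWt ζ (w ∘ Equiv.swap i i') (tau M i i' (w i) (w i') x) := by
  have key : (if (w i).2 = (w i').2 then (ℓ : ℂ) else 0) =
      ℓ * (eLab (w i) (w i') * ((w i').1 - (w i).1)) := by
    rw [eLab]
    split_ifs with h
    · rw [inv_mul_cancel₀, mul_one]
      exact fun e => hne (Prod.ext (sub_eq_zero.mp e).symm h)
    · rw [zero_mul, mul_zero]
  rw [isWt_iff hζ]
  refine ⟨fun k => ?_, fun k c => ?_⟩
  · rw [tau_apply, smul_sub, smul_comm (u ℓ k) (eLab (w i) (w i')), Function.comp_apply]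
    by_cases h1 : k = i
    · subst h1
      rw [h.u_s hζ hi, (h k).1, Equiv.swap_apply_left, key]
      generalize (gp (s _ i') : H ℓ n) • x = y
      module
    by_cases h2 : k = i'
    · subst h2
      rw [h.u_succ_s hζ hi, (h k).1, Equiv.swap_apply_right, key]
      generalize (gp (s i _) : H ℓ n) • x = y
      module
    · rw [h.u_s_far hi h1 h2, (h k).1, Equiv.swap_apply_of_ne_of_ne h1 h2]
      generalize (gp (s i i') : H ℓ n) • x = y
      module
  · rw [tau_apply, smul_sub, smul_comm (gp (zetaPow k c) : H ℓ n) (eLab (w i) (w i')),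
      h.s_zeta hζ, ((isWt_iff hζ).mp h).2, Function.comp_apply, smul_sub]
    by_cases h0 : eLab (w i) (w i') = 0
    · rw [h0]
      generalize (gp (s i i') : H ℓ n) • x = y
      module
    · have hβ : (w i).2 = (w i').2 := by
        by_contra hne
        exact h0 (if_neg hne)
      have : (w (Equiv.swap i i' k)).2 = (w k).2 := by
        rw [Equiv.swap_apply_def]
        split_ifs with h1 h2
        · rw [h1, hβ]
        · rw [h2, hβ]
        · rfl
      rw [this]
      generalize (gp (s i i') : H ℓ n) • x = y
      module

theorem gp_smul_comm {g g' : G ℓ n} (h : g * g' = g' * g) (x : M) :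
    (gp g : H ℓ n) • (gp g' : H ℓ n) • x = (gp g' : H ℓ n) • (gp g : H ℓ n) • x := by
  rw [← mul_smul, ← gp_mul, h, gp_mul, mul_smul]

theorem tau_comm {i i' j j' : Fin n} (hi : (i' : ℕ) = i + 1) (hj : (j' : ℕ) = j + 1)
    (hij : (i : ℕ) + 1 < j) (a b c d : ℂ × ZMod ℓ) (x : M) :
    tau M i i' a b (tau M j j' c d x) = tau M j j' c d (tau M i i' a b x) := by
  have : (s i i' * s j j' : G ℓ n) = s j j' * s i i' := by
    have := adj_comm (n := n) hij (by omega) 1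
    rw [mul_one, mul_one, adj_eq_swap i i' hi, adj_eq_swap j j' hj] at this
    rw [s, s, ← map_mul, this, map_mul]
  simp only [tau_apply, smul_sub, gp_smul_comm this, smul_comm (gp (s i i') : H ℓ n) (_ : ℂ),
    smul_comm (gp (s j j') : H ℓ n) (_ : ℂ)]
  generalize (gp (s i i') : H ℓ n) • x = y
  generalize (gp (s j j') : H ℓ n) • x = y'
  generalize (gp (s j j') : H ℓ n) • y = y''
  module

theorem s_braid {i j k : Fin n} (hj : (j : ℕ) = i + 1) (hk : (k : ℕ) = j + 1) (x : M) :
    (gp (s i j) : H ℓ n) • (gp (s j k) : H ℓ n) • (gp (s i j) : H ℓ n) • x =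
      (gp (s j k) : H ℓ n) • (gp (s i j) : H ℓ n) • (gp (s j k) : H ℓ n) • x := by
  have := adj_braid (n := n) (i := i) (by omega) 1
  rw [mul_one, mul_one, adj_eq_swap i j hj, ← hj, adj_eq_swap j k hk] at this
  simp only [← mul_smul, ← gp_mul]
  rw [s, s, ← map_mul, ← map_mul, this, map_mul, map_mul]

/-- The leading terms agree by the braid relation of the transpositions; the lower terms cancel
because of `eLab_mul`, whence the distinct labels. -/
theorem tau_braid {i j k : Fin n} (hj : (j : ℕ) = i + 1) (hk : (k : ℕ) = j + 1)
    {a b c : ℂ × ZMod ℓ} (hab : a ≠ b) (hbc : b ≠ c) (hac : a ≠ c) (x : M) :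
    tau M i j b c (tau M j k a c (tau M i j a b x)) =
      tau M j k a b (tau M i j a c (tau M j k b c x)) := by
  simp only [tau_apply, smul_sub, s_braid hj hk, s_smul_s,
    smul_comm (gp (s i j) : H ℓ n) (_ : ℂ), smul_comm (gp (s j k) : H ℓ n) (_ : ℂ)]
  have hY := eLab_mul hab hbc hac
  generalize eLab a b = p at *
  generalize eLab a c = q at *
  generalize eLab b c = r at *
  generalize (gp (s j k) : H ℓ n) • (gp (s i j) : H ℓ n) • (gp (s j k) : H ℓ n) • x = y0
  generalize (gp (s i j) : H ℓ n) • (gp (s j k) : H ℓ n) • x = y1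
  generalize (gp (s j k) : H ℓ n) • (gp (s i j) : H ℓ n) • x = y2
  generalize (gp (s i j) : H ℓ n) • x = y3
  generalize (gp (s j k) : H ℓ n) • x = y4
  match_scalars
  all_goals first
    | ring1
    | linear_combination hY
    | linear_combination -hY

end Weights


/-! ### Semisimple modules over the commutative subalgebra -/

section

variable {ℓ n : ℕ} [NeZero ℓ] {M : Type*} [AddCommGroup M] [Module ℂ M] [Module (H ℓ n) M]
  {ζ : ℂ} {w : Fin n → ℂ × ZMod ℓ} {x : M}

/-- The `u_i` have no generalized eigenvectors other than eigenvectors. -/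
def USemi (ℓ n : ℕ) [NeZero ℓ] (M : Type*) [AddCommGroup M] [Module ℂ M] [Module (H ℓ n) M] :
    Prop :=
  ∀ (i : Fin n) (a : ℂ) (x y : M), u ℓ i • x = a • x + y → u ℓ i • y = a • y → y = 0

/-- Two modules will be compared inside their product. The absence of Jordan blocks passes to it
factor by factor. -/
theorem USemi.prod {N : Type*} [AddCommGroup N] [Module ℂ N] [Module (H ℓ n) N]
    (hM : USemi ℓ n M) (hN : USemi ℓ n N) : USemi ℓ n (M × N) := fun i a x y h h' =>
  Prod.ext (hM i a x.1 y.1 (congrArg Prod.fst h) (congrArg Prod.fst h'))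
    (hN i a x.2 y.2 (congrArg Prod.snd h) (congrArg Prod.snd h'))

variable [IsScalarTower ℂ (H ℓ n) M]

theorem repr_smul_of_eigen {ι : Type*} (v : Module.Basis ι ℂ M) {h : H ℓ n} {c : ι → ℂ}
    (hc : ∀ k, h • v k = c k • v k) (x : M) (k : ι) : v.repr (h • x) k = c k * v.repr x k := by
  have : (v.coord k) ∘ₗ DistribSMul.toLinearMap ℂ M h = c k • v.coord k := by
    refine v.ext fun j => ?_
    simp only [LinearMap.comp_apply, DistribSMul.toLinearMap_apply, hc, map_smul,
      LinearMap.smul_apply, Module.Basis.coord_apply, Module.Basis.repr_self, smul_eq_mul]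
    by_cases hjk : j = k
    · rw [hjk]
    · rw [Finsupp.single_eq_of_ne (Ne.symm hjk), mul_zero, mul_zero]
  exact LinearMap.congr_fun this x

theorem IsUDiagonalizable.uSemi (hM : IsUDiagonalizable ℓ n M) : USemi ℓ n M := by
  obtain ⟨ι, v, hv⟩ := hM
  intro i a x y h h'
  choose c hc using fun k => hv k (u ℓ i) (Algebra.subset_adjoin (Or.inl ⟨i, rfl⟩))
  refine v.ext_elem fun k => ?_
  have e := congrArg (v.repr · k) h
  have e' := congrArg (v.repr · k) h'
  simp only [repr_smul_of_eigen v hc, map_add, map_smul, Finsupp.add_apply, Finsupp.smul_apply,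
    smul_eq_mul] at e e'
  rw [map_zero, Finsupp.zero_apply]
  by_cases ha : c k = a
  · rw [ha] at e
    linear_combination -e
  · exact (mul_eq_mul_right_iff.mp e').resolve_left ha

theorem IsWt.mem_uAlg (h : IsWt ζ w x) {a : H ℓ n} (ha : a ∈ uAlg ℓ n) : ∃ c : ℂ, a • x = c • x := by
  induction ha using Algebra.adjoin_induction with
  | mem a ha =>
    rcases ha with ⟨i, rfl⟩ | ⟨i, rfl⟩
    exacts [⟨_, (h i).1⟩, ⟨_, (h i).2⟩]
  | algebraMap r => exact ⟨r, algebraMap_smul _ r x⟩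
  | add a b _ _ ha hb =>
    obtain ⟨⟨c, hc⟩, d, hd⟩ := ha, hb
    exact ⟨c + d, by rw [add_smul, add_smul, hc, hd]⟩
  | mul a b _ _ ha hb =>
    obtain ⟨⟨c, hc⟩, d, hd⟩ := ha, hb
    exact ⟨d * c, by rw [mul_smul, mul_smul, hd, smul_comm, hc]⟩

theorem IsWt.map {N : Type*} [AddCommGroup N] [Module ℂ N] [Module (H ℓ n) N]
    [IsScalarTower ℂ (H ℓ n) N] (f : M →ₗ[H ℓ n] N) (h : IsWt ζ w x) : IsWt ζ w (f x) := by
  intro i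
  have hc : ∀ (c : ℂ), f (c • x) = c • f x := fun c => by
    rw [← algebraMap_smul (H ℓ n), map_smul, algebraMap_smul]
  exact ⟨by rw [← map_smul, (h i).1, hc], by rw [← map_smul, (h i).2, hc]⟩

variable (hζ : IsPrimitiveRoot ζ ℓ)

include hζ in
/-- There is an element of `H_{ℓ,n}` that projects to a given weight space, along finitely many
other ones. -/
theorem exists_projector (M : Type*) [AddCommGroup M] [Module ℂ M] [Module (H ℓ n) M]
    [IsScalarTower ℂ (H ℓ n) M] (w : Fin n → ℂ × ZMod ℓ) (S : Finset (Fin n → ℂ × ZMod ℓ)) :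
    ∃ h : H ℓ n, (∀ x : M, IsWt ζ w x → h • x = x) ∧
      ∀ w' ∈ S, w' ≠ w → ∀ x : M, IsWt ζ w' x → h • x = 0 := by
  classical
  have hℓ : (ℓ : ℂ) ≠ 0 := NeZero.ne _
  have aux : ∀ (w' : Fin n → ℂ × ZMod ℓ), ∃ h : H ℓ n, (∀ x : M, IsWt ζ w x → h • x = x) ∧
      (w' ≠ w → ∀ x : M, IsWt ζ w' x → h • x = 0) ∧
        ∀ (w'' : Fin n → ℂ × ZMod ℓ) (x : M), IsWt ζ w'' x → ∃ c : ℂ, h • x = c • x := by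
    intro w'
    by_cases hw : w' = w
    · exact ⟨1, fun x _ => one_smul _ x, fun h => absurd hw h, fun _ x _ => ⟨1, by simp⟩⟩
    -- If an element a of 𝔲 takes the values c ≠ c' on the two weights, then (a - c')/(c - c')
    -- separates them. As an element of 𝔲 it acts by a scalar on each weight vector, so that the
    -- factors for different w' can be multiplied.
    have key : ∀ (a : H ℓ n) (c c' : ℂ), (∀ x : M, IsWt ζ w x → a • x = c • x) →
        (∀ x : M, IsWt ζ w' x → a • x = c' • x) → c ≠ c' → a ∈ uAlg ℓ n →
        ∃ h : H ℓ n, (∀ x : M, IsWt ζ w x → h • x = x) ∧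
      (w' ≠ w → ∀ x : M, IsWt ζ w' x → h • x = 0) ∧
        ∀ (w'' : Fin n → ℂ × ZMod ℓ) (x : M), IsWt ζ w'' x → ∃ c : ℂ, h • x = c • x := by
      intro a c c' h1 h2 hc ha
      have hsmul : ∀ x : M, ((c - c')⁻¹ • (a - algebraMap ℂ (H ℓ n) c')) • x =
          (c - c')⁻¹ • (a • x - c' • x) := fun x => by
        rw [smul_assoc, sub_smul, algebraMap_smul]
      refine ⟨(c - c')⁻¹ • (a - algebraMap ℂ _ c'), fun x hx => ?_, fun _ x hx => ?_,
        fun w'' x hx => hx.mem_uAlg ?_⟩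
      · rw [hsmul, h1 x hx, ← sub_smul, smul_smul, inv_mul_cancel₀ (sub_ne_zero.mpr hc), one_smul]
      · rw [hsmul, h2 x hx, sub_self, smul_zero]
      · exact Subalgebra.smul_mem _ (Subalgebra.sub_mem _ ha (Subalgebra.algebraMap_mem _ _)) _
    obtain ⟨i, hi⟩ := Function.ne_iff.mp hw
    by_cases h1 : (w i).1 = (w' i).1
    · refine key (z ℓ i) (ζ ^ (w i).2.val) (ζ ^ (w' i).2.val) (fun x hx => (hx i).2)
        (fun x hx => (hx i).2) (fun e => hi (Prod.ext h1.symm (chi_injective hζ e).symm))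
        (Algebra.subset_adjoin (Or.inr ⟨i, rfl⟩))
    · exact key (u ℓ i) _ _ (fun x hx => (hx i).1) (fun x hx => (hx i).1)
        (fun e => h1 (mul_left_cancel₀ hℓ e)) (Algebra.subset_adjoin (Or.inl ⟨i, rfl⟩))
  induction S using Finset.induction with
  | empty => exact ⟨1, fun x _ => one_smul _ x, by simp⟩
  | insert w' S _ ih =>
    obtain ⟨h, h1, h2⟩ := ih
    obtain ⟨f, f1, f2, f3⟩ := aux w'
    refine ⟨h * f, fun x hx => by rw [mul_smul, f1 x hx, h1 x hx], fun v hv hne x hx => ?_⟩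
    rw [mul_smul]
    rcases Finset.mem_insert.mp hv with rfl | hv
    · rw [f2 hne x hx, smul_zero]
    · obtain ⟨c, hc⟩ := f3 v x hx
      rw [hc, smul_comm, h2 v hv hne x hx, smul_zero]

variable (hM : USemi ℓ n M)

include hζ hM in
-- With equal labels, `IsWt.u_s` says that u_i maps s_i x to its eigenvalue times s_i x minus ℓ x: a
-- Jordan block unless x = 0.
theorem IsWt.eq_zero_of_eq_succ (h : IsWt ζ w x) {i i' : Fin n} (hi : (i' : ℕ) = i + 1)
    (hw : w i = w i') : x = 0 := by
  have h1 := h.u_s hζ hi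
  rw [if_pos (by rw [hw]), ← hw, sub_eq_add_neg, ← neg_smul] at h1
  have h2 := hM i _ _ _ h1 (by rw [smul_comm, (h i).1, smul_comm])
  exact (smul_eq_zero.mp h2).resolve_left (neg_ne_zero.mpr (NeZero.ne _))

theorem tau_injective {i i' : Fin n} {a b : ℂ × ZMod ℓ} (hab : ¬ NearLab a b)
    (h : tau (ℓ := ℓ) M i i' a b x = 0) : x = 0 := by
  have := tau_tau (ℓ := ℓ) i i' a b x
  rw [h, map_zero] at this
  exact (smul_eq_zero.mp this.symm).resolve_left (eLab_sq_ne hab)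

include hζ hM in
-- Exchanging b with either neighbour in the pattern a, b, a creates equal consecutive labels, so
-- both intertwiners kill x. Hence s_i and s_{i+1} act on x by e and -e with e = `eLab` a b. Then e²
-- = 1, while the braid relation gives -e³ = e³, which is impossible for x ≠ 0.
theorem IsWt.eq_zero_of_eq_succ_succ (h : IsWt ζ w x) {i j k : Fin n} (hj : (j : ℕ) = i + 1)
    (hk : (k : ℕ) = j + 1) (hw : w i = w k) : x = 0 := by
  have hij : i ≠ j := fun e => by rw [e] at hj; omega
  have hjk : j ≠ k := fun e => by rw [e] at hk; omega
  have hik : i ≠ k := fun e => by rw [e] at hj; omega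
  by_cases h1 : w i = w j
  · exact h.eq_zero_of_eq_succ hζ hM hj h1
  have e1 := (h.tau hζ hj h1).eq_zero_of_eq_succ hζ hM hk (by
    simp [Equiv.swap_apply_of_ne_of_ne hik.symm hjk.symm, hw])
  have e2 := (h.tau hζ hk (hw ▸ Ne.symm h1)).eq_zero_of_eq_succ hζ hM hj (by
    simp [Equiv.swap_apply_of_ne_of_ne hij hik, hw])
  rw [tau_apply, sub_eq_zero] at e1 e2
  rw [← hw, eLab_symm (w i)] at e2
  have hb := s_braid (ℓ := ℓ) hj hk x
  simp only [e1, e2, smul_comm (gp (s i j) : H ℓ n) (_ : ℂ), smul_comm (gp (s j k) : H ℓ n) (_ : ℂ),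
    smul_smul] at hb
  have hs := s_smul_s (ℓ := ℓ) i j x
  rw [e1, smul_comm, e1, smul_smul] at hs
  by_contra hx
  have hb' := smul_left_injective ℂ hx hb
  rw [← one_smul ℂ x, smul_smul, mul_one] at hs
  have hs' := smul_left_injective ℂ hx hs
  have : (2 : ℂ) * eLab (w i) (w j) = 0 := by
    linear_combination (-1 : ℂ) * hb' - 2 * eLab (w i) (w j) * hs'
  rw [mul_eq_zero] at this
  rw [this.resolve_left two_ne_zero] at hs'
  simp at hs'

include hζ hM in
/-- Between two equal labels of a weight vector both neighbouring labels occur. -/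
theorem IsWt.exists_between (h : IsWt ζ w x) (hx : x ≠ 0) {i j : Fin n} (hij : i < j)
    (hw : w i = w j) : (∃ k, i < k ∧ k < j ∧ w k = ((w i).1 + 1, (w i).2)) ∧
      ∃ k, i < k ∧ k < j ∧ w k = ((w i).1 - 1, (w i).2) := by
  obtain ⟨d, hd⟩ : ∃ d : ℕ, (j : ℕ) - i = d := ⟨_, rfl⟩
  induction d using Nat.strong_induction_on generalizing w x i j with
  | _ d ih =>
    obtain ⟨i', hi'⟩ : ∃ i' : Fin n, (i' : ℕ) = i + 1 := ⟨⟨i + 1, by omega⟩, rfl⟩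
    obtain ⟨j', hj'⟩ : ∃ j' : Fin n, (j : ℕ) = j' + 1 := ⟨⟨j - 1, by omega⟩, by simp; omega⟩
    have hi1 : w i ≠ w i' := fun e => hx (h.eq_zero_of_eq_succ hζ hM hi' e)
    have hj1 : w j' ≠ w j := fun e => hx (h.eq_zero_of_eq_succ hζ hM hj' e)
    have hi2 : i' < j := by
      rcases lt_or_ge i' j with h | h
      · exact h
      · exact absurd (by rw [hw]; congr 1; omega) hi1
    -- If the label next to an end of the interval is not near it, an injective intertwiner moves it
    -- outside and the interval becomes shorter. What remains is the case of near labels at both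
    -- ends.
    by_cases hn : NearLab (w i) (w i')
    · by_cases hn' : NearLab (w j') (w j)
      · by_cases he : w i' = w j'
        · rcases eq_or_ne i' j' with hij' | hij'
          · subst hij'
            exact absurd (h.eq_zero_of_eq_succ_succ hζ hM hi' hj' hw) hx
          -- The inner interval has equal ends too, so it contains both neighbours of their label.
          -- One of them is w i, at some p strictly before j, and the shorter interval from i to p
          -- does the job.
          obtain ⟨⟨k, hk⟩, k', hk'⟩ := ih (j' - i') (by omega) h hx (i := i') (j := j') (by omega) he rfl
          obtain ⟨p, hp1, hp2, hp⟩ : ∃ p, i < p ∧ p < j ∧ w i = w p := by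
            rcases hn.2 with h2 | h2
            · refine ⟨k', by omega, by omega, Prod.ext ?_ ?_⟩
              · rw [hk'.2.2, h2]; ring
              · rw [hk'.2.2, hn.1]
            · refine ⟨k, by omega, by omega, Prod.ext ?_ ?_⟩
              · rw [hk.2.2, h2]; ring
              · rw [hk.2.2, hn.1]
          obtain ⟨⟨k, hk⟩, k', hk'⟩ := ih (p - i) (by omega) h hx hp1 hp rfl
          exact ⟨⟨k, hk.1, by omega, hk.2.2⟩, k', hk'.1, by omega, hk'.2.2⟩
        -- The inner end labels are different and both near w i, so they are the two labels sought.
        · have hn'' := hn'.symm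
          rw [← hw] at hn''
          have hj2 : i < j' := by
            rcases eq_or_ne i j' with rfl | h
            · exact absurd hw hj1
            · omega
          have e1 : ∀ {k c}, NearLab (w i) (w k) → (w k).1 = c → w k = (c, (w i).2) :=
            fun h1 h2 => Prod.ext h2 h1.1.symm
          rcases hn.2 with h1 | h1 <;> rcases hn''.2 with h2 | h2
          · exact absurd ((e1 hn h1).trans (e1 hn'' h2).symm) he
          · exact ⟨⟨i', by omega, hi2, e1 hn h1⟩, j', hj2, by omega, e1 hn'' h2⟩
          · exact ⟨⟨j', hj2, by omega, e1 hn'' h2⟩, i', by omega, hi2, e1 hn h1⟩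
          · exact absurd ((e1 hn h1).trans (e1 hn'' h2).symm) he
      · have hj2 : i < j' := by
          rcases eq_or_ne i j' with rfl | h
          · exact absurd hw hj1
          · omega
        obtain ⟨⟨k, hk⟩, k', hk'⟩ := ih (j' - i) (by omega) (h.tau hζ hj' hj1)
          (fun e => hx (tau_injective (ℓ := ℓ) hn' e)) (i := i) (j := j') hj2 (by
            rw [Function.comp_apply, Function.comp_apply, Equiv.swap_apply_left,
              Equiv.swap_apply_of_ne_of_ne hj2.ne hij.ne, hw]) rfl
        have e : ∀ k, k < j' → (w ∘ Equiv.swap j' j) k = w k := fun k hk => by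
          rw [Function.comp_apply, Equiv.swap_apply_of_ne_of_ne (by omega) (by omega)]
        rw [e i hj2] at hk hk'
        rw [e k hk.2.1] at hk
        rw [e k' hk'.2.1] at hk'
        exact ⟨⟨k, hk.1, by omega, hk.2.2⟩, k', hk'.1, by omega, hk'.2.2⟩
    · obtain ⟨⟨k, hk⟩, k', hk'⟩ := ih (j - i') (by omega) (h.tau hζ hi' hi1)
        (fun e => hx (tau_injective (ℓ := ℓ) hn e)) (i := i') (j := j) hi2 (by
          rw [Function.comp_apply, Function.comp_apply, Equiv.swap_apply_right,
            Equiv.swap_apply_of_ne_of_ne hij.ne' hi2.ne', hw]) rfl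
      have e : ∀ k, i' < k → (w ∘ Equiv.swap i i') k = w k := fun k hk => by
        rw [Function.comp_apply, Equiv.swap_apply_of_ne_of_ne (by omega) (by omega)]
      have e0 : (w ∘ Equiv.swap i i') i' = w i := by
        rw [Function.comp_apply, Equiv.swap_apply_right]
      rw [e0] at hk hk'
      rw [e k hk.1] at hk
      rw [e k' hk'.1] at hk'
      exact ⟨⟨k, by omega, hk.2.1, hk.2.2⟩, k', by omega, hk'.2.1, hk'.2.2⟩

/-- The intertwining operators that start from the weight `w`. -/
def tauSys (M : Type*) [AddCommGroup M] [Module ℂ M] [Module (H ℓ n) M] [IsScalarTower ℂ (H ℓ n) M]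
    (w : Fin n → ℂ × ZMod ℓ) (i : ℕ) (π : Equiv.Perm (Fin n)) : M →ₗ[ℂ] M :=
  if h : i + 1 < n then tau M ⟨i, by omega⟩ ⟨i + 1, h⟩ (w (π⁻¹ ⟨i, by omega⟩)) (w (π⁻¹ ⟨i + 1, h⟩))
  else 0

theorem tauSys_eq (i i' : Fin n) (hi : (i' : ℕ) = i + 1) (π : Equiv.Perm (Fin n)) :
    tauSys M w i π = tau M i i' (w (π⁻¹ i)) (w (π⁻¹ i')) := by
  obtain ⟨i', hi'⟩ := i'
  subst hi
  rw [tauSys, dif_pos hi']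

include hζ hM in
-- The relations of the intertwiners need distinct labels. Where labels coincide among the two or
-- three positions involved, the weight space is zero and nothing is to be shown. The scalars are
-- arbitrary, since 1 - `eLab`^2 may vanish.
theorem braidSystem_tau (w : Fin n → ℂ × ZMod ℓ) :
    BraidSystem (tauSys M w) (fun π => wtSpace ζ (w ∘ ⇑π⁻¹) M) ⊤ where
  maps i π y hi hy := by
    obtain ⟨j, hj⟩ : ∃ j : Fin n, (j : ℕ) = i := ⟨⟨i, by omega⟩, rfl⟩
    obtain ⟨j', hj'⟩ : ∃ j' : Fin n, (j' : ℕ) = j + 1 := ⟨⟨i + 1, by omega⟩, by simp [hj]⟩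
    subst hj
    rw [tauSys_eq j j' hj', adj_eq_swap j j' hj']
    by_cases he : w (π⁻¹ j) = w (π⁻¹ j')
    · rw [IsWt.eq_zero_of_eq_succ hζ hM hy hj' he, map_zero]
      exact zero_mem _
    · have := IsWt.tau hζ hy hj' he
      rw [mem_wtSpace, mul_inv_rev, Equiv.swap_inv]
      exact this
  sq i π y hi hy := by
    obtain ⟨j, hj⟩ : ∃ j : Fin n, (j : ℕ) = i := ⟨⟨i, by omega⟩, rfl⟩
    obtain ⟨j', hj'⟩ : ∃ j' : Fin n, (j' : ℕ) = j + 1 := ⟨⟨i + 1, by omega⟩, by simp [hj]⟩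
    subst hj
    rw [tauSys_eq j j' hj', tauSys_eq j j' hj', adj_eq_swap j j' hj', mul_inv_rev, Equiv.swap_inv,
      Equiv.Perm.mul_apply, Equiv.Perm.mul_apply, Equiv.swap_apply_left, Equiv.swap_apply_right,
      tau_tau]
    exact ⟨_, trivial, rfl⟩
  comm i j π y hij hj hy := by
    obtain ⟨a, ha⟩ : ∃ a : Fin n, (a : ℕ) = i := ⟨⟨i, by omega⟩, rfl⟩
    obtain ⟨a', ha'⟩ : ∃ a' : Fin n, (a' : ℕ) = a + 1 := ⟨⟨i + 1, by omega⟩, by simp [ha]⟩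
    obtain ⟨b, hb⟩ : ∃ a : Fin n, (a : ℕ) = j := ⟨⟨j, by omega⟩, rfl⟩
    obtain ⟨b', hb'⟩ : ∃ a' : Fin n, (a' : ℕ) = b + 1 := ⟨⟨j + 1, by omega⟩, by simp [hb]⟩
    subst ha hb
    simp only [tauSys_eq a a' ha', tauSys_eq b b' hb', adj_eq_swap a a' ha', adj_eq_swap b b' hb',
      mul_inv_rev, Equiv.swap_inv, Equiv.Perm.mul_apply]
    rw [Equiv.swap_apply_of_ne_of_ne (a := b) (b := b') (x := a) (by omega) (by omega),
      Equiv.swap_apply_of_ne_of_ne (a := b) (b := b') (x := a') (by omega) (by omega),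
      Equiv.swap_apply_of_ne_of_ne (a := a) (b := a') (x := b) (by omega) (by omega),
      Equiv.swap_apply_of_ne_of_ne (a := a) (b := a') (x := b') (by omega) (by omega)]
    exact tau_comm ha' hb' hij _ _ _ _ y
  braid i π y hi hy := by
    obtain ⟨a, ha⟩ : ∃ a : Fin n, (a : ℕ) = i := ⟨⟨i, by omega⟩, rfl⟩
    obtain ⟨b, hb⟩ : ∃ b : Fin n, (b : ℕ) = a + 1 := ⟨⟨i + 1, by omega⟩, by simp [ha]⟩
    obtain ⟨c, hc⟩ : ∃ c : Fin n, (c : ℕ) = b + 1 := ⟨⟨i + 2, by omega⟩, by simp [ha, hb]⟩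
    subst ha
    rw [← hb]
    by_cases h1 : w (π⁻¹ a) = w (π⁻¹ b)
    · rw [IsWt.eq_zero_of_eq_succ hζ hM hy hb h1]; simp only [map_zero]
    by_cases h2 : w (π⁻¹ b) = w (π⁻¹ c)
    · rw [IsWt.eq_zero_of_eq_succ hζ hM hy hc h2]; simp only [map_zero]
    by_cases h3 : w (π⁻¹ a) = w (π⁻¹ c)
    · rw [IsWt.eq_zero_of_eq_succ_succ hζ hM hy hb hc h3]; simp only [map_zero]
    have hab : a ≠ b := fun e => by rw [e] at hb; omega
    have hbc : b ≠ c := fun e => by rw [e] at hc; omega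
    have hac : a ≠ c := fun e => by rw [e] at hb; omega
    simp only [tauSys_eq a b hb, tauSys_eq b c hc, adj_eq_swap a b hb, adj_eq_swap b c hc,
      mul_inv_rev, Equiv.swap_inv, Equiv.Perm.mul_apply, Equiv.swap_apply_left,
      Equiv.swap_apply_right, Equiv.swap_apply_of_ne_of_ne hac.symm hbc.symm,
      Equiv.swap_apply_of_ne_of_ne hab hac]
    exact tau_braid hb hc h1 h2 h3 y

/-- The permutation maps each class of equal labels to itself and preserves the order in it, so it
fixes every point. -/
theorem eq_one_of_monotone_on_labels {α : Type*} {w : Fin n → α} {π : Equiv.Perm (Fin n)}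
    (hw : w ∘ ⇑π⁻¹ = w) (hmono : ∀ p q, p < q → w p = w q → π p < π q) : π = 1 := by
  refine Equiv.ext fun p => ?_
  change π p = p
  induction p using WellFoundedLT.induction with
  | _ p ih =>
    rcases lt_trichotomy (π p) p with h | h | h
    · exact π.injective (ih _ h)
    · exact h
    · rcases lt_trichotomy (π⁻¹ p) p with h' | h' | h'
      · have := ih _ h'
        rw [show π (π⁻¹ p) = p from π.apply_symm_apply p] at this
        rw [← this] at h'
        exact absurd h' (lt_irrefl _)
      · rw [Equiv.Perm.inv_eq_iff_eq] at h'
        exact h'.symm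
      · have := hmono _ _ h' (congrFun hw p).symm
        rw [show π (π⁻¹ p) = p from π.apply_symm_apply p] at this
        exact absurd (this.trans h) (lt_irrefl _)

include hζ hM in
-- Inverting two equal labels would require, at some stage, an exchange of equal consecutive labels,
-- and a weight vector with such labels is zero.
theorem Reach.monotone_on_labels (hx : IsWt ζ w x) {k j : ℕ} {π : Equiv.Perm (Fin n)} {y : M}
    (h : Reach (tauSys M w) x k j π y) (hk : k ≤ n - 1) (hy : y ≠ 0) :
    ∀ p q, p < q → w p = w q → π p < π q := by
  have hS := braidSystem_tau hζ hM w
  induction h with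
  | base => exact fun p q hpq _ => hpq
  | up _ ih => exact ih (by omega) hy
  | @down k j π y h ih =>
    have hle := h.le
    obtain ⟨a, ha⟩ : ∃ a : Fin n, (a : ℕ) = j := ⟨⟨j, by omega⟩, rfl⟩
    obtain ⟨b, hb⟩ : ∃ b : Fin n, (b : ℕ) = a + 1 := ⟨⟨j + 1, by omega⟩, by simp [ha]⟩
    have hy' : y ≠ 0 := by
      rintro rfl
      exact hy (map_zero _)
    have hwt : IsWt ζ (w ∘ ⇑π⁻¹) y := h.mem hS hx hk
    intro p q hpq hw
    have hlt := ih hk hy' p q hpq hw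
    rw [← ha, adj_eq_swap a b hb, Equiv.Perm.mul_apply, Equiv.Perm.mul_apply]
    have hne : ¬ (π p = a ∧ π q = b) := by
      rintro ⟨rfl, rfl⟩
      exact hy' (hwt.eq_zero_of_eq_succ hζ hM hb (by simpa using hw))
    simp only [Equiv.swap_apply_def]
    split_ifs <;> omega

include hζ hM in
/-- The submodule generated by a weight vector contains no other vectors of the same weight. -/
theorem IsWt.eq_smul_of_isWt_smul (hx : IsWt ζ w x) {g : H ℓ n} (hg : IsWt ζ w (g • x)) :
    ∃ c : ℂ, g • x = c • x := by
  classical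
  have hS := braidSystem_tau hζ hM w
  have hx1 : x ∈ wtSpace ζ (w ∘ ⇑(1 : Equiv.Perm (Fin n))⁻¹) M := hx
  have hwt : ∀ {j π y}, Reach (tauSys M w) x (n - 1) j π y → IsWt ζ (w ∘ ⇑π⁻¹) y :=
    fun h => h.mem hS hx1 le_rfl
  let Y := Submodule.span ℂ {y | ∃ j π, Reach (tauSys M w) x (n - 1) j π y}
  -- By `Reach.step` an s_i sends a reached vector to a combination of itself and another reached
  -- vector, while u_i and the ζ_i act by scalars.
  have hY : g • x ∈ Y := by
    have hst : ∀ {a : H ℓ n}, (∀ j π (y : M), Reach (tauSys M w) x (n - 1) j π y → a • y ∈ Y) →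
        ∀ y : M, y ∈ Y → a • y ∈ Y := by
      intro a ha y hy
      have : Y ≤ Y.comap (DistribSMul.toLinearMap ℂ M a) :=
        Submodule.span_le.mpr fun y ⟨j, π, h⟩ => ha j π y h
      exact this hy
    refine submodule_stable Y (fun i => hst fun j π y h => ?_)
      (fun i i' hi => hst fun j π y h => ?_) (fun i c => hst fun j π y h => ?_) g
      (Submodule.subset_span ⟨_, _, Reach.top _⟩)
    · rw [((isWt_iff hζ).mp (hwt h)).1]
      exact Y.smul_mem _ (Submodule.subset_span ⟨j, π, h⟩)
    · obtain ⟨c, -, j', y', h', e⟩ := Reach.step hS hx1 (n - 1) le_rfl h i (by omega)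
      rw [tauSys_eq i i' hi, tau_apply, sub_eq_iff_eq_add] at e
      rw [e]
      exact Y.add_mem (Y.smul_mem _ (Submodule.subset_span ⟨_, _, h'⟩))
        (Y.smul_mem _ (Submodule.subset_span ⟨_, _, h⟩))
    · rw [((isWt_iff hζ).mp (hwt h)).2]
      exact Y.smul_mem _ (Submodule.subset_span ⟨j, π, h⟩)
  obtain ⟨p, hp1, hp2⟩ := exists_projector hζ M w
    (Finset.univ.image fun π : Equiv.Perm (Fin n) => w ∘ ⇑π⁻¹)
  -- The projector removes the reached vectors of other weights. A nonzero one of weight w belongs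
  -- to a permutation that preserves labels and their order, hence to the identity, and is x.
  have hle : Y ≤ (Submodule.span ℂ {x}).comap (DistribSMul.toLinearMap ℂ M p) := by
    refine Submodule.span_le.mpr fun y ⟨j, π, h⟩ => ?_
    change p • y ∈ Submodule.span ℂ {x}
    by_cases hw : w ∘ ⇑π⁻¹ = w
    · by_cases hy : y = 0
      · rw [hy, smul_zero]; exact zero_mem _
      obtain rfl := eq_one_of_monotone_on_labels hw
        (h.monotone_on_labels hζ hM hx le_rfl hy)
      rw [h.unique le_rfl (Reach.top _), hp1 x hx]
      exact Submodule.mem_span_singleton_self x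
    · rw [hp2 _ (Finset.mem_image_of_mem _ (Finset.mem_univ π)) hw y (hwt h)]
      exact zero_mem _
  have := hle hY
  rw [Submodule.mem_comap, DistribSMul.toLinearMap_apply, hp1 _ hg] at this
  obtain ⟨c, hc⟩ := Submodule.mem_span_singleton.mp this
  exact ⟨c, hc.symm⟩

include hζ in
/-- Simple semisimple modules with a common weight are isomorphic. -/
theorem nonempty_equiv_of_common_weight {M N : Type*} [AddCommGroup M] [Module ℂ M]
    [Module (H ℓ n) M] [IsScalarTower ℂ (H ℓ n) M] [AddCommGroup N] [Module ℂ N]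
    [Module (H ℓ n) N] [IsScalarTower ℂ (H ℓ n) N] [IsSimpleModule (H ℓ n) M]
    [IsSimpleModule (H ℓ n) N] (hM : USemi ℓ n M) (hN : USemi ℓ n N) {x : M} {y : N}
    (hx : IsWt ζ w x) (hy : IsWt ζ w y) (hx0 : x ≠ 0) (hy0 : y ≠ 0) :
    Nonempty (M ≃ₗ[H ℓ n] N) := by
  have hxy : IsWt ζ w ((x, y) : M × N) := fun i =>
    ⟨Prod.ext (hx i).1 (hy i).1, Prod.ext (hx i).2 (hy i).2⟩
  -- This will be the graph of the isomorphism: both projections from Γ are bijective.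
  let Γ := Submodule.span (H ℓ n) {((x, y) : M × N)}
  have hxyΓ : (x, y) ∈ Γ := Submodule.mem_span_singleton_self _
  have key : ∀ a ∈ Γ, IsWt ζ w a → ∃ c : ℂ, a = (c • x, c • y) := by
    intro a ha hw
    obtain ⟨g, rfl⟩ := Submodule.mem_span_singleton.mp ha
    obtain ⟨c, hc⟩ := hxy.eq_smul_of_isWt_smul hζ (hM.prod hN) hw
    exact ⟨c, hc⟩
  have b1 : Function.Bijective ((LinearMap.fst (H ℓ n) M N).comp Γ.subtype) := by
    constructor
    · rw [← LinearMap.ker_eq_bot]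
      rw [Submodule.eq_bot_iff]
      rintro ⟨⟨a, b⟩, hab⟩ h0
      obtain rfl : a = 0 := h0
      -- By simplicity Γ meets 0 × N in zero or contains it. In the second case (0, y) would be a
      -- vector of weight w in Γ, hence a multiple of (x, y), contrary to x, y ≠ 0.
      have : Γ.comap (LinearMap.inr (H ℓ n) M N) = ⊥ := by
        refine (eq_bot_or_eq_top _).resolve_right fun ht => hy0 ?_
        have h1 : y ∈ Γ.comap (LinearMap.inr (H ℓ n) M N) := ht ▸ trivial
        obtain ⟨c, hc⟩ := key (0, y) h1 (hy.map (LinearMap.inr (H ℓ n) M N))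
        have hc0 := (smul_eq_zero.mp (congrArg Prod.fst hc).symm).resolve_right hx0
        exact (congrArg Prod.snd hc).trans (by rw [hc0]; exact zero_smul ℂ y)
      have hb : b ∈ Γ.comap (LinearMap.inr (H ℓ n) M N) := hab
      rw [this, Submodule.mem_bot] at hb
      subst hb
      rfl
    · rw [← LinearMap.range_eq_top]
      refine (eq_bot_or_eq_top _).resolve_left fun hb => hx0 ?_
      have : x ∈ LinearMap.range ((LinearMap.fst (H ℓ n) M N).comp Γ.subtype) := ⟨⟨_, hxyΓ⟩, rfl⟩
      rwa [hb, Submodule.mem_bot] at this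
  have b2 : Function.Bijective ((LinearMap.snd (H ℓ n) M N).comp Γ.subtype) := by
    constructor
    · rw [← LinearMap.ker_eq_bot]
      rw [Submodule.eq_bot_iff]
      rintro ⟨⟨a, b⟩, hab⟩ h0
      obtain rfl : b = 0 := h0
      have : Γ.comap (LinearMap.inl (H ℓ n) M N) = ⊥ := by
        refine (eq_bot_or_eq_top _).resolve_right fun ht => hx0 ?_
        have h1 : x ∈ Γ.comap (LinearMap.inl (H ℓ n) M N) := ht ▸ trivial
        obtain ⟨c, hc⟩ := key (x, 0) h1 (hx.map (LinearMap.inl (H ℓ n) M N))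
        have hc0 := (smul_eq_zero.mp (congrArg Prod.snd hc).symm).resolve_right hy0
        exact (congrArg Prod.fst hc).trans (by rw [hc0]; exact zero_smul ℂ x)
      have hb : a ∈ Γ.comap (LinearMap.inl (H ℓ n) M N) := hab
      rw [this, Submodule.mem_bot] at hb
      subst hb
      rfl
    · rw [← LinearMap.range_eq_top]
      refine (eq_bot_or_eq_top _).resolve_left fun hb => hy0 ?_
      have : y ∈ LinearMap.range ((LinearMap.snd (H ℓ n) M N).comp Γ.subtype) := ⟨⟨_, hxyΓ⟩, rfl⟩
      rwa [hb, Submodule.mem_bot] at this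
  exact ⟨(LinearEquiv.ofBijective _ b1).symm.trans (LinearEquiv.ofBijective _ b2)⟩

end

/-! ### The modules with bases of standard tableaux -/

section

variable {ℓ n : ℕ} [NeZero ℓ] {ζ : ℂ} (hζ : IsPrimitiveRoot ζ ℓ) {D : SkewShape ℓ}

theorem isWt_yVec (F : D.boxes ≃ Fin n) : IsWt ζ (flab F) (yVec hζ D F) :=
  (isWt_iff hζ).mpr ⟨fun i => u_smul_yVec hζ D i F, fun i c => zetaPow_smul_yVec hζ D i c F⟩

theorem isWt_yBasis (T : SYT D.boxes n) : IsWt ζ T.wt (yBasis hζ D n T) := by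
  rw [yBasis_apply]
  exact isWt_yVec hζ T.fill

theorem youngModule_isUDiagonalizable : IsUDiagonalizable ℓ n (YoungModule hζ D n) :=
  ⟨_, yBasis hζ D n, fun T _ hh => (isWt_yBasis hζ T).mem_uAlg hh⟩

theorem exists_wt_eq_of_isWt {w : Fin n → ℂ × ZMod ℓ} {x : YoungModule hζ D n} (h : IsWt ζ w x)
    (hx : x ≠ 0) : ∃ T : SYT D.boxes n, T.wt = w := by
  obtain ⟨T, hT⟩ : ∃ T, (yBasis hζ D n).repr x T ≠ 0 := by
    by_contra! hall
    exact hx ((yBasis hζ D n).ext_elem fun T => by rw [hall T, map_zero, Finsupp.zero_apply])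
  refine ⟨T, funext fun i => ?_⟩
  have h1 := repr_smul_of_eigen (yBasis hζ D n) (fun T => (isWt_yBasis hζ T i).1) x T
  have h2 := repr_smul_of_eigen (yBasis hζ D n) (fun T => (isWt_yBasis hζ T i).2) x T
  rw [(h i).1, map_smul, Finsupp.smul_apply, smul_eq_mul, mul_left_inj' hT,
    mul_right_inj' (NeZero.ne _)] at h1
  rw [(h i).2, map_smul, Finsupp.smul_apply, smul_eq_mul, mul_left_inj' hT] at h2
  exact Prod.ext h1.symm (chi_injective hζ h2).symm

/-- The weights of different tableaux differ, so a projector extracts some v_T from any nonzero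
vector of a submodule. From v_T all other basis vectors arise by admissible exchanges, whose
coefficient `xLab` is nonzero. -/
theorem youngModule_isSimple [Nonempty (SYT D.boxes n)] :
    IsSimpleModule (H ℓ n) (YoungModule hζ D n) := by
  classical
  have : Nontrivial (YoungModule hζ D n) :=
    ⟨⟨yBasis hζ D n (Classical.arbitrary _), 0, (yBasis hζ D n).ne_zero _⟩⟩
  rw [isSimpleModule_iff]
  refine { exists_pair_ne := ⟨⊥, ⊤, bot_ne_top⟩
           eq_bot_or_eq_top := fun N => or_iff_not_imp_left.mpr fun hN => ?_ }
  obtain ⟨v, hv, hv0⟩ := N.ne_bot_iff.mp hN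
  have hC : ∀ (c : ℂ) {v : YoungModule hζ D n}, v ∈ N → c • v ∈ N := fun c v hv => by
    rw [← algebraMap_smul (H ℓ n)]
    exact N.smul_mem _ hv
  obtain ⟨T, hT⟩ : ∃ T, (yBasis hζ D n).repr v T ≠ 0 := by
    by_contra! hall
    exact hv0 ((yBasis hζ D n).ext_elem fun T => by rw [hall T, map_zero, Finsupp.zero_apply])
  obtain ⟨p, hp1, hp2⟩ := exists_projector hζ (YoungModule hζ D n) T.wt
    (((yBasis hζ D n).repr v).support.image SYT.wt)
  have hpv : p • v = (yBasis hζ D n).repr v T • yBasis hζ D n T := by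
    conv_lhs => rw [← (yBasis hζ D n).linearCombination_repr v, Finsupp.linearCombination_apply,
      Finsupp.sum, Finset.smul_sum]
    rw [Finset.sum_eq_single T]
    · rw [smul_comm, hp1 _ (isWt_yBasis hζ T)]
    · intro T' hT' hne
      rw [smul_comm, hp2 _ (Finset.mem_image_of_mem _ hT') (fun e => hne (SYT.wt_injective e)) _
        (isWt_yBasis hζ T'), smul_zero]
    · intro h
      rw [Finsupp.notMem_support_iff.mp h, zero_smul, smul_zero]
  have hTN : yBasis hζ D n T ∈ N := by
    have := hC ((yBasis hζ D n).repr v T)⁻¹ (N.smul_mem p hv)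
    rwa [hpv, smul_smul, inv_mul_cancel₀ hT, one_smul] at this
  have hall : ∀ T', yBasis hζ D n T' ∈ N := fun T' => by
    induction T' using SYT.swap_induction T with
    | h0 => exact hTN
    | hs T' i i' hi hstd ih =>
      rw [yBasis_apply] at ih ⊢
      have hne : xLab (flab T'.fill i) (flab T'.fill i') ≠ 0 :=
        xLab_ne_zero ((T'.isStd_swap_iff hi).mp hstd)
      have e := s_smul_yVec hζ D hi T'.fill
      have h1 := N.sub_mem (N.smul_mem (gp (s i i')) ih)
        (hC (eLab (flab T'.fill i) (flab T'.fill i')) ih)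
      rw [e, add_sub_cancel_left] at h1
      have h2 := hC (xLab (flab T'.fill i) (flab T'.fill i'))⁻¹ h1
      rwa [smul_smul, inv_mul_cancel₀ hne, one_smul] at h2
  refine eq_top_iff.mpr fun v _ => ?_
  rw [← (yBasis hζ D n).linearCombination_repr v, Finsupp.linearCombination_apply]
  exact N.sum_mem fun T' _ => hC _ (hall T')

end


/-! ### The shape belonging to a sequence of labels -/

/-- The label with content moved by `d`. -/
def sh {ℓ : ℕ} (d : ℤ) (a : ℂ × ZMod ℓ) : ℂ × ZMod ℓ := (a.1 + d, a.2)

section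

variable {ℓ : ℕ}

@[simp] theorem sh_sh (d e : ℤ) (a : ℂ × ZMod ℓ) : sh d (sh e a) = sh (e + d) a := by
  simp [sh, add_assoc]

@[simp] theorem sh_zero (a : ℂ × ZMod ℓ) : sh 0 a = a := by simp [sh]

theorem sh_eq_sh {d e : ℤ} {a : ℂ × ZMod ℓ} : sh d a = sh e a ↔ d = e := by simp [sh]

theorem eq_sh_comm {d : ℤ} {a b : ℂ × ZMod ℓ} : b = sh d a ↔ a = sh (-d) b := by
  constructor <;> rintro rfl <;> simp

/-- Between two equal labels both neighbouring labels occur. -/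
def Separated {n : ℕ} (w : Fin n → ℂ × ZMod ℓ) : Prop :=
  ∀ i j, i < j → w i = w j → ∀ ε : ℤ, (ε = 1 ∨ ε = -1) → ∃ k, i < k ∧ k < j ∧ w k = sh ε (w i)

/-- The number of the row that contains an entry: a new entry lies in the row of the previous one if
its content is larger by one, and in the next row if its content is smaller by one. -/
def IsRowFn {n : ℕ} (w : Fin n → ℂ × ZMod ℓ) (Y : Fin n → ℤ) : Prop :=
  ∀ i j, i < j → (∀ k, i < k → k < j → w k ≠ w i ∧ w k ≠ w j) →
    (w j = sh 1 (w i) → Y j = Y i) ∧ (w j = sh (-1) (w i) → Y j = Y i + 1)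

theorem exists_last {n : ℕ} {P : Fin n → Prop} {i j : Fin n} (hij : i < j) (hi : P i) :
    ∃ p, i ≤ p ∧ p < j ∧ P p ∧ ∀ k, p < k → k < j → ¬ P k := by
  classical
  obtain ⟨p, hp, hmax⟩ := (Finset.univ.filter fun p => i ≤ p ∧ p < j ∧ P p).exists_max_image id
    ⟨i, by simp [hij, hi]⟩
  simp only [Finset.mem_filter, Finset.mem_univ, true_and, id] at hp hmax
  exact ⟨p, hp.1, hp.2.1, hp.2.2, fun k hk hkj hP => absurd (hmax k ⟨by omega, hkj, hP⟩) (by omega)⟩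

theorem exists_first {n : ℕ} {P : Fin n → Prop} {i j : Fin n} (hij : i < j) (hj : P j) :
    ∃ p, i < p ∧ p ≤ j ∧ P p ∧ ∀ k, i < k → k < p → ¬ P k := by
  classical
  obtain ⟨p, hp, hmin⟩ := (Finset.univ.filter fun p => i < p ∧ p ≤ j ∧ P p).exists_min_image id
    ⟨j, by simp [hij, hj]⟩
  simp only [Finset.mem_filter, Finset.mem_univ, true_and, id] at hp hmin
  exact ⟨p, hp.1, hp.2.1, hp.2.2, fun k hk hkp hP => absurd (hmin k ⟨hk, by omega, hP⟩) (by omega)⟩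

/-- Induction on the number of entries. A label that has occurred before goes one row below its last
occurrence; a new label may have to join two parts that were placed independently, one of which is
then shifted. -/
theorem Separated.exists_isRowFn {n : ℕ} {w : Fin n → ℂ × ZMod ℓ} (hw : Separated w) :
    ∃ Y, IsRowFn w Y := by
  classical
  induction n with
  | zero => exact ⟨0, fun i => i.elim0⟩
  | succ n ih =>
    have hw0 : Separated (w ∘ Fin.castSucc) := fun i j hij h ε hε => by
      obtain ⟨k, hk1, hk2, hk⟩ := hw i.castSucc j.castSucc hij h ε hε
      exact ⟨⟨k, by have := j.2; have : k.1 < j.1 := hk2; omega⟩, hk1, hk2, hk⟩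
    obtain ⟨Y, hY⟩ := ih hw0
    -- The earlier entry, if any, that the row condition compares with the new one, on either side.
    let Last : Fin n → ℤ → Prop := fun i ε => w (Fin.last n) = sh ε (w i.castSucc) ∧
      ∀ k : Fin n, i < k → w k.castSucc ≠ w i.castSucc ∧ w k.castSucc ≠ w (Fin.last n)
    have huniq : ∀ {i i' ε}, Last i ε → Last i' ε → i = i' := by
      intro i i' ε h h'
      have he : w i.castSucc = w i'.castSucc := by
        have h1 := eq_sh_comm.mp h.1
        have h2 := eq_sh_comm.mp h'.1
        rw [h1, h2]
      rcases lt_trichotomy i i' with hlt | rfl | hlt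
      · exact absurd he.symm (h.2 _ hlt).1
      · rfl
      · exact absurd he (h'.2 _ hlt).1
    have key : ∃ δ y : ℤ, (δ = 0 ∨ ∀ k : Fin n, w k.castSucc ≠ w (Fin.last n)) ∧
        (∀ i, Last i 1 → y = Y i) ∧ ∀ i, Last i (-1) → y = Y i + δ + 1 := by
      -- If the label last occurred at p, an entry compared with the new one comes after p, and its
      -- row relative to p is already prescribed by Y. So the row Y p + 1 is consistent on both
      -- sides and no shift is needed.
      by_cases hc : ∃ p : Fin n, w p.castSucc = w (Fin.last n)
      · obtain ⟨p0, hp0⟩ := hc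
        obtain ⟨p', -, hpn, hp, hpl⟩ := exists_last (P := fun k => w k = w (Fin.last n))
          (i := p0.castSucc) (j := Fin.last n) p0.castSucc_lt_last hp0
        obtain ⟨p, rfl⟩ : ∃ p : Fin n, p.castSucc = p' := ⟨p'.castPred hpn.ne, by simp⟩
        have hpi : ∀ {i ε}, ε ≠ 0 → Last i ε → p < i := by
          intro i ε hε h
          rcases lt_trichotomy p i with hlt | rfl | hlt
          · exact hlt
          · have h1 := h.1
            rw [← hp] at h1
            conv_lhs at h1 => rw [← sh_zero (w p.castSucc)]
            exact absurd (sh_eq_sh.mp h1).symm hε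
          · exact absurd hp (h.2 _ hlt).2
        have hnb : ∀ {i ε}, (ε = 1 ∨ ε = -1) → Last i ε → ∀ k, p < k → k < i →
            (w ∘ Fin.castSucc) k ≠ (w ∘ Fin.castSucc) p ∧
              (w ∘ Fin.castSucc) k ≠ (w ∘ Fin.castSucc) i := by
          intro i ε hε h k h1 h2
          refine ⟨fun e => hpl k.castSucc h1 k.castSucc_lt_last (e.trans hp), fun e => ?_⟩
          obtain ⟨k', hk1, hk2, hk'⟩ := hw0 k i h2 e ε hε
          refine hpl k'.castSucc (h1.trans hk1) k'.castSucc_lt_last (hk'.trans ?_)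
          rw [e, h.1]; rfl
        refine ⟨0, Y p + 1, Or.inl rfl, fun i h => ?_, fun i h => ?_⟩
        · refine ((hY p i (hpi one_ne_zero h) (hnb (Or.inl rfl) h)).2 ?_).symm
          rw [Function.comp_apply, Function.comp_apply, hp]
          exact eq_sh_comm.mp h.1
        · rw [add_zero, (hY p i (hpi (by norm_num) h) (hnb (Or.inr rfl) h)).1]
          rw [Function.comp_apply, Function.comp_apply, hp]
          exact eq_sh_comm.mp h.1
      · push Not at hc
        by_cases h1 : ∃ i, Last i 1
        · obtain ⟨i, hi⟩ := h1
          by_cases h2 : ∃ j, Last j (-1)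
          · obtain ⟨j, hj⟩ := h2
            refine ⟨Y i - Y j - 1, Y i, Or.inr hc, fun i' h => by rw [huniq hi h], fun j' h => ?_⟩
            rw [huniq h hj]; ring
          · exact ⟨0, Y i, Or.inl rfl, fun i' h => by rw [huniq hi h],
              fun j h => absurd ⟨j, h⟩ h2⟩
        · by_cases h2 : ∃ j, Last j (-1)
          · obtain ⟨j, hj⟩ := h2
            exact ⟨0, Y j + 1, Or.inl rfl, fun i h => absurd ⟨i, h⟩ h1,
              fun j' h => by rw [huniq hj h, add_zero]⟩
          · exact ⟨0, 0, Or.inl rfl, fun i h => absurd ⟨i, h⟩ h1, fun j h => absurd ⟨j, h⟩ h2⟩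
    obtain ⟨δ, y, hδ, hy1, hy2⟩ := key
    -- The labels beyond the new one are moved by δ rows. For neighbouring labels both or neither
    -- move, unless the smaller one is the new label, which does not occur earlier if δ ≠ 0.
    let S : ℂ × ZMod ℓ → Prop := fun a => ∃ d : ℕ, a = sh (d + 1) (w (Fin.last n))
    have hS : ∀ a, a ≠ w (Fin.last n) → (S a ↔ S (sh 1 a)) := by
      intro a ha
      constructor
      · rintro ⟨d, rfl⟩
        exact ⟨d + 1, by rw [sh_sh]; push_cast; rfl⟩
      · rintro ⟨d, hd⟩
        rcases d with _ | d
        · refine absurd ?_ ha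
          have := congrArg (sh (-1)) hd
          simpa using this
        · refine ⟨d, ?_⟩
          have := congrArg (sh (-1)) hd
          simpa using this
    refine ⟨Fin.snoc (fun i => if S (w i.castSucc) then Y i + δ else Y i) y, fun i j hij hk => ?_⟩
    obtain ⟨i, rfl⟩ : ∃ i' : Fin n, i'.castSucc = i := ⟨i.castPred (by
      have := j.le_last; exact (hij.trans_le this).ne), by simp⟩
    rw [Fin.snoc_castSucc]
    rcases Fin.eq_castSucc_or_eq_last j with ⟨j, rfl⟩ | rfl
    · rw [Fin.snoc_castSucc]
      have hY' := hY i j hij fun k h1 h2 => hk k.castSucc h1 h2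
      rcases hδ with rfl | hδ
      · simpa using hY'
      · refine ⟨fun h => ?_, fun h => ?_⟩
        · have := hS _ (hδ i)
          rw [← h] at this
          simp only [this]
          rw [hY'.1 h]
        · have := hS _ (hδ j)
          rw [show sh 1 (w j.castSucc) = w i.castSucc by
            rw [show w j.castSucc = sh (-1) (w i.castSucc) from h]; simp] at this
          simp only [this]
          rw [hY'.2 h]
          split_ifs <;> ring
    · rw [Fin.snoc_last]
      have hl : ∀ k : Fin n, i < k → w k.castSucc ≠ w i.castSucc ∧ w k.castSucc ≠ w (Fin.last n) :=
        fun k h => hk _ h k.castSucc_lt_last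
      refine ⟨fun h => ?_, fun h => ?_⟩
      · rw [hy1 i ⟨h, hl⟩, if_neg]
        rintro ⟨d, hd⟩
        rw [eq_sh_comm.mp h, sh_eq_sh] at hd
        omega
      · rw [hy2 i ⟨h, hl⟩, if_pos]
        exact ⟨0, by simpa using eq_sh_comm.mp h⟩

/-! ### Rows of a separated sequence -/

variable {n : ℕ} {w : Fin n → ℂ × ZMod ℓ} {Y : Fin n → ℤ}

/-- Take the first occurrence of the neighbouring label after i. A repetition of w i before it would
force a still earlier one by separation. Thus the row condition applies to the pair found. -/
theorem Separated.exists_next (hw : Separated w) {i j : Fin n} (hij : i < j) {ε : ℤ}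
    (hε : ε = 1 ∨ ε = -1) (h : w j = sh ε (w i)) : ∃ j', i < j' ∧ j' ≤ j ∧ w j' = w j ∧
      ∀ k, i < k → k < j' → w k ≠ w i ∧ w k ≠ w j' := by
  obtain ⟨p, h1, h2, h3, h4⟩ := exists_first (P := fun k => w k = w j) hij rfl
  refine ⟨p, h1, h2, h3, fun k hk hkp => ⟨fun e => ?_, fun e => h4 k hk hkp (e.trans h3)⟩⟩
  obtain ⟨k', a1, a2, a3⟩ := hw i k hk e.symm ε hε
  exact h4 k' a1 (a2.trans hkp) (a3.trans h.symm)

theorem Separated.exists_prev (hw : Separated w) {i j : Fin n} (hij : j < i) {ε : ℤ}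
    (hε : ε = 1 ∨ ε = -1) (h : w j = sh ε (w i)) : ∃ j', j ≤ j' ∧ j' < i ∧ w j' = w j ∧
      ∀ k, j' < k → k < i → w k ≠ w j' ∧ w k ≠ w i := by
  obtain ⟨p, h1, h2, h3, h4⟩ := exists_last (P := fun k => w k = w j) hij rfl
  refine ⟨p, h1, h2, h3, fun k hk hkp => ⟨fun e => h4 k hk hkp (e.trans h3), fun e => ?_⟩⟩
  obtain ⟨k', a1, a2, a3⟩ := hw k i hkp e ε hε
  exact h4 k' (hk.trans a1) a2 (by rw [a3, h, e])

/-- Going from i to the next box of content one larger keeps the row, and from there to the next box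
with the original label adds one. So successive equal labels occupy successive rows, without gaps.
-/
theorem IsRowFn.of_eq (hY : IsRowFn w Y) (hw : Separated w) {i j : Fin n} (hij : i < j)
    (h : w i = w j) : Y i < Y j ∧ ∀ m, Y i ≤ m → m < Y j → (∃ k, w k = w i ∧ Y k = m) ∧
      (∃ k, w k = sh 1 (w i)) ∧ ∃ k, w k = sh (-1) (w i) := by
  obtain ⟨d, hd⟩ : ∃ d : ℕ, (j : ℕ) - i = d := ⟨_, rfl⟩
  induction d using Nat.strong_induction_on generalizing i with
  | _ d ih =>
    obtain ⟨k, hk1, hk2, hk⟩ := hw i j hij h 1 (Or.inl rfl)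
    obtain ⟨k', -, -, hk'⟩ := hw i j hij h (-1) (Or.inr rfl)
    obtain ⟨k1, a1, a2, a3, a4⟩ := hw.exists_next hk1 (Or.inl rfl) hk
    have hYk := (hY i k1 a1 a4).1 (a3.trans hk)
    have hj1 : w j = sh (-1) (w k1) := by rw [a3, hk, ← h]; simp
    obtain ⟨j1, b1, b2, b3, b4⟩ := hw.exists_next (lt_of_le_of_lt a2 hk2) (Or.inr rfl) hj1
    have hYj := (hY k1 j1 b1 b4).2 (b3.trans hj1)
    rcases eq_or_lt_of_le b2 with rfl | b2
    · refine ⟨by omega, fun m h1 h2 => ⟨⟨i, rfl, by omega⟩, ⟨k, hk⟩, k', hk'⟩⟩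
    · have hi1 := h.trans b3.symm
      obtain ⟨c1, c2⟩ := ih (j - j1) (by omega) b2 b3 rfl
      refine ⟨by omega, fun m h1 h2 => ⟨?_, ⟨k, hk⟩, k', hk'⟩⟩
      rcases eq_or_lt_of_le h1 with rfl | h1
      · exact ⟨i, rfl, rfl⟩
      · obtain ⟨⟨q, q1, q2⟩, -⟩ := c2 m (by omega) h2
        exact ⟨q, q1.trans hi1.symm, q2⟩

theorem IsRowFn.le_of_eq (hY : IsRowFn w Y) (hw : Separated w) {i j : Fin n} (hij : i ≤ j)
    (h : w i = w j) : Y i ≤ Y j := by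
  rcases eq_or_lt_of_le hij with rfl | hij
  · exact le_rfl
  · exact (hY.of_eq hw hij h).1.le

theorem IsRowFn.lt_of_lt (hY : IsRowFn w Y) (hw : Separated w) {i j : Fin n} (h : w i = w j)
    (hlt : Y i < Y j) : i < j := by
  by_contra! hij
  exact absurd (hY.le_of_eq hw hij h.symm) (by omega)

/-- Either order of the entries leads, through the nearest occurrence of the neighbouring label, to
an equal or adjacent row, and from there rows increase along equal labels. -/
theorem IsRowFn.lt_iff (hY : IsRowFn w Y) (hw : Separated w) {i j : Fin n} (h : w j = sh 1 (w i)) :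
    i < j ↔ Y i ≤ Y j := by
  constructor
  · intro hij
    obtain ⟨j', a1, a2, a3, a4⟩ := hw.exists_next hij (Or.inl rfl) h
    rw [← (hY i j' a1 a4).1 (a3.trans h)]
    exact hY.le_of_eq hw a2 a3
  · intro hle
    rcases lt_trichotomy i j with hij | rfl | hij
    · exact hij
    · conv_lhs at h => rw [← sh_zero (w i)]
      rw [sh_eq_sh] at h
      omega
    · obtain ⟨j', a1, a2, a3, a4⟩ := hw.exists_prev hij (Or.inl rfl) h
      have := (hY j' i a2 a4).2 (by rw [a3, h]; simp)
      have := hY.le_of_eq hw a1 a3.symm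
      omega

/-- A box with label `a` in row `m` or above, respectively below. -/
def HasLow (w : Fin n → ℂ × ZMod ℓ) (Y : Fin n → ℤ) (a : ℂ × ZMod ℓ) (m : ℤ) : Prop :=
  ∃ k, w k = a ∧ Y k ≤ m

/-- A box with label `a` in row `m` or below. -/
def HasHigh (w : Fin n → ℂ × ZMod ℓ) (Y : Fin n → ℤ) (a : ℂ × ZMod ℓ) (m : ℤ) : Prop :=
  ∃ k, w k = a ∧ m ≤ Y k

variable (hY : IsRowFn w Y) (hw : Separated w) {a : ℂ × ZMod ℓ} {m : ℤ}

include hY hw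

/-- A discrete intermediate value property: the rows of a label have no gaps. -/
theorem HasLow.exists_eq (h : HasLow w Y a m) (h' : HasHigh w Y a m) : ∃ k, w k = a ∧ Y k = m := by
  obtain ⟨⟨k, hk, hm⟩, k', hk', hm'⟩ := h, h'
  rcases eq_or_lt_of_le hm' with e | hlt
  · exact ⟨k', hk', e.symm⟩
  · have he := hk.trans hk'.symm
    obtain ⟨q, q1, q2⟩ := ((hY.of_eq hw (hY.lt_of_lt hw he (by omega)) he).2 m hm hlt).1
    exact ⟨q, q1.trans hk, q2⟩

theorem HasLow.exists_neighbour (h : HasLow w Y a m) (h' : HasHigh w Y a (m + 1)) :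
    (∃ k, w k = sh 1 a) ∧ ∃ k, w k = sh (-1) a := by
  obtain ⟨⟨k, rfl, hm⟩, k', hk', hm'⟩ := h, h'
  exact ((hY.of_eq hw (hY.lt_of_lt hw hk'.symm (by omega)) hk'.symm).2 m hm (by omega)).2

/-- This and the following three lemmas transport bounds on rows from label to label. An upper bound
survives a step to larger content and rises by one in a step to smaller content; a lower bound
survives a step to smaller content and drops by one in a step to larger content. -/
theorem HasLow.right (h : HasLow w Y a m) (hne : ∃ k, w k = sh 1 a) : HasLow w Y (sh 1 a) m := by
  obtain ⟨⟨i, rfl, hm⟩, j, hj⟩ := h, hne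
  by_cases hle : Y j ≤ m
  · exact ⟨j, hj, hle⟩
  · obtain ⟨j', a1, a2, a3, a4⟩ :=
      hw.exists_next ((hY.lt_iff hw hj).mpr (by omega)) (Or.inl rfl) hj
    exact ⟨j', a3.trans hj, ((hY i j' a1 a4).1 (a3.trans hj)).trans_le hm⟩

theorem HasLow.left (h : HasLow w Y a m) (hne : ∃ k, w k = sh (-1) a) :
    HasLow w Y (sh (-1) a) (m + 1) := by
  obtain ⟨⟨i, rfl, hm⟩, j, hj⟩ := h, hne
  by_cases hle : Y j ≤ m + 1
  · exact ⟨j, hj, hle⟩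
  · have hij : i < j := by
      have := mt (hY.lt_iff hw (i := j) (j := i) (by rw [hj]; simp)).mp (by omega)
      refine lt_of_le_of_ne (not_lt.mp this) ?_
      rintro rfl
      omega
    obtain ⟨j', a1, a2, a3, a4⟩ := hw.exists_next hij (Or.inr rfl) hj
    exact ⟨j', a3.trans hj, by rw [(hY i j' a1 a4).2 (a3.trans hj)]; omega⟩

theorem HasHigh.left (h : HasHigh w Y a m) (hne : ∃ k, w k = sh (-1) a) :
    HasHigh w Y (sh (-1) a) m := by
  obtain ⟨⟨i, rfl, hm⟩, j, hj⟩ := h, hne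
  by_cases hle : m ≤ Y j
  · exact ⟨j, hj, hle⟩
  · have hij : j < i := (hY.lt_iff hw (by rw [hj]; simp)).mpr (by omega)
    obtain ⟨j', a1, a2, a3, a4⟩ := hw.exists_prev hij (Or.inr rfl) hj
    exact ⟨j', a3.trans hj, by rwa [← (hY j' i a2 a4).1 (by rw [a3, hj]; simp)]⟩

theorem HasHigh.right (h : HasHigh w Y a m) (hne : ∃ k, w k = sh 1 a) :
    HasHigh w Y (sh 1 a) (m - 1) := by
  obtain ⟨⟨i, rfl, hm⟩, j, hj⟩ := h, hne
  by_cases hle : m - 1 ≤ Y j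
  · exact ⟨j, hj, hle⟩
  · have hij : j < i := by
      have := mt (hY.lt_iff hw hj).mp (by omega)
      refine lt_of_le_of_ne (not_lt.mp this) ?_
      rintro rfl
      omega
    obtain ⟨j', a1, a2, a3, a4⟩ := hw.exists_prev hij (Or.inl rfl) hj
    have := (hY j' i a2 a4).2 (by rw [a3, hj]; simp)
    exact ⟨j', a3.trans hj, by omega⟩

theorem HasHigh.left_many (h : HasHigh w Y a m) (t : ℕ)
    (hne : ∀ s : ℕ, s ≤ t → ∃ k, w k = sh (-s) a) : HasHigh w Y (sh (-t) a) m := by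
  induction t with
  | zero => simpa using h
  | succ t ih =>
    have := (ih fun s hs => hne s (by omega)).left hY hw (by
      have := hne (t + 1) le_rfl
      rw [sh_sh]
      convert this using 3
      push_cast
      ring_nf)
    rw [sh_sh] at this
    convert this using 2
    push_cast
    ring

theorem HasHigh.right_many (h : HasHigh w Y a m) (t : ℕ)
    (hne : ∀ s : ℕ, s ≤ t → ∃ k, w k = sh s a) : HasHigh w Y (sh t a) (m - t) := by
  induction t with
  | zero => simpa using h
  | succ t ih =>
    have := (ih fun s hs => hne s (by omega)).right hY hw (by
      have := hne (t + 1) le_rfl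
      rw [sh_sh]
      convert this using 3
      push_cast
      rfl)
    rw [sh_sh] at this
    rw [show m - ((t + 1 : ℕ) : ℤ) = m - t - 1 by push_cast; ring, Nat.cast_succ]
    exact this

omit hY hw

/-- Two entries are in the same component if all labels between theirs occur. -/
def SameComp (w : Fin n → ℂ × ZMod ℓ) (i j : Fin n) : Prop :=
  ∃ d : ℤ, w j = sh d (w i) ∧ ∀ e ∈ Set.uIcc 0 d, ∃ k, w k = sh e (w i)

theorem SameComp.of_eq {i j : Fin n} {d : ℤ} (h : w j = sh d (w i)) (hd : d = 0 ∨ d = 1) :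
    SameComp w i j := by
  refine ⟨d, h, fun e he => ?_⟩
  have : e = 0 ∨ e = d := by
    rw [Set.mem_uIcc] at he
    omega
  rcases this with rfl | rfl
  exacts [⟨i, by simp⟩, ⟨j, h⟩]

theorem sameComp_equivalence (w : Fin n → ℂ × ZMod ℓ) : Equivalence (SameComp w) where
  refl i := .of_eq (d := 0) (by simp) (Or.inl rfl)
  symm := by
    rintro i j ⟨d, h, hd⟩
    refine ⟨-d, eq_sh_comm.mp h, fun e he => ?_⟩
    obtain ⟨k, hk⟩ := hd (e + d) (by rw [Set.mem_uIcc] at *; omega)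
    exact ⟨k, by rw [hk, h, sh_sh, add_comm]⟩
  trans := by
    rintro i j k ⟨d, h, hd⟩ ⟨d', h', hd'⟩
    refine ⟨d + d', by rw [h', h, sh_sh], fun e he => ?_⟩
    by_cases h1 : e ∈ Set.uIcc 0 d
    · exact hd e h1
    · obtain ⟨q, hq⟩ := hd' (e - d) (by rw [Set.mem_uIcc] at *; omega)
      exact ⟨q, by rw [hq, h, sh_sh]; congr 1; ring⟩

include hY hw

/-- By `HasLow.exists_eq` it suffices to bound the row of the label of the right neighbour from both
sides. The upper bound starts from i. The lower bound is carried from j one label at a time, which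
is possible because all labels between occur. -/
theorem SameComp.exists_right {i j : Fin n} (h : SameComp w i j) {k l : ℕ} (hk : 1 ≤ k)
    (hwj : w j = sh (k - l) (w i)) (hYj : Y j = Y i + l) :
    ∃ p, w p = sh 1 (w i) ∧ Y p = Y i := by
  obtain ⟨d, hd, hrun⟩ := h
  rw [hd, sh_eq_sh] at hwj
  subst hwj
  have hlow : HasLow w Y (w i) (Y i) := ⟨i, rfl, le_rfl⟩
  have hhigh : HasHigh w Y (w j) (Y j) := ⟨j, rfl, le_rfl⟩
  by_cases hkl : l < k
  · have hne := hrun 1 (by rw [Set.mem_uIcc]; omega)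
    refine (hlow.right hY hw hne).exists_eq hY hw ?_
    have := hhigh.left_many hY hw (k - l - 1) fun s hs => by
      obtain ⟨q, hq⟩ := hrun (k - l - s) (by rw [Set.mem_uIcc]; omega)
      exact ⟨q, by rw [hq, hd, sh_sh]; congr 1⟩
    rw [hd, sh_sh, show ((k : ℤ) - l) + -((k - l - 1 : ℕ) : ℤ) = 1 by omega] at this
    obtain ⟨q, hq1, hq2⟩ := this
    exact ⟨q, hq1, by omega⟩
  -- For l ≥ k the walk from j ends on the diagonal of i, at least k ≥ 1 rows below i. A diagonal
  -- with two boxes has both neighbouring labels.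
  · have := hhigh.right_many hY hw (l - k) fun s hs => by
      obtain ⟨q, hq⟩ := hrun (k - l + s) (by rw [Set.mem_uIcc]; omega)
      exact ⟨q, by rw [hq, hd, sh_sh]⟩
    rw [hd, sh_sh, show ((k : ℤ) - l) + ((l - k : ℕ) : ℤ) = 0 by omega, sh_zero] at this
    have h1 : HasHigh w Y (w i) (Y i + 1) := by
      obtain ⟨q, hq1, hq2⟩ := this
      exact ⟨q, hq1, by omega⟩
    have hne := (hlow.exists_neighbour hY hw h1).1
    refine (hlow.right hY hw hne).exists_eq hY hw ?_
    obtain ⟨q, hq1, hq2⟩ := h1.right hY hw hne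
    exact ⟨q, hq1, by omega⟩

theorem SameComp.exists_down {i j : Fin n} (h : SameComp w i j) {k l : ℕ} (hl : 1 ≤ l)
    (hwj : w j = sh (k - l) (w i)) (hYj : Y j = Y i + l) :
    ∃ p, w p = sh (-1) (w i) ∧ Y p = Y i + 1 := by
  obtain ⟨d, hd, hrun⟩ := h
  rw [hd, sh_eq_sh] at hwj
  subst hwj
  have hlow : HasLow w Y (w i) (Y i) := ⟨i, rfl, le_rfl⟩
  have hhigh : HasHigh w Y (w j) (Y j) := ⟨j, rfl, le_rfl⟩
  by_cases hkl : k < l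
  · have hne := hrun (-1) (by rw [Set.mem_uIcc]; omega)
    refine (hlow.left hY hw hne).exists_eq hY hw ?_
    have := hhigh.right_many hY hw (l - k - 1) fun s hs => by
      obtain ⟨q, hq⟩ := hrun (k - l + s) (by rw [Set.mem_uIcc]; omega)
      exact ⟨q, by rw [hq, hd, sh_sh]⟩
    rw [hd, sh_sh, show ((k : ℤ) - l) + ((l - k - 1 : ℕ) : ℤ) = -1 by omega] at this
    obtain ⟨q, hq1, hq2⟩ := this
    exact ⟨q, hq1, by omega⟩
  · have := hhigh.left_many hY hw (k - l) fun s hs => by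
      obtain ⟨q, hq⟩ := hrun (k - l - s) (by rw [Set.mem_uIcc]; omega)
      exact ⟨q, by rw [hq, hd, sh_sh]; congr 1⟩
    rw [hd, sh_sh, show ((k : ℤ) - l) + -((k - l : ℕ) : ℤ) = 0 by omega, sh_zero] at this
    have h1 : HasHigh w Y (w i) (Y i + 1) := by
      obtain ⟨q, hq1, hq2⟩ := this
      exact ⟨q, hq1, by omega⟩
    have hne := (hlow.exists_neighbour hY hw h1).2
    refine (hlow.left hY hw hne).exists_eq hY hw ?_
    obtain ⟨q, hq1, hq2⟩ := h1.left hY hw hne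
    exact ⟨q, hq1, by omega⟩

omit hY hw

/-- A sequence of labels such that between equal labels the neighbouring ones occur belongs to a
standard tableau. -/
theorem Separated.exists_SYT (hw : Separated w) :
    ∃ (D : SkewShape ℓ) (T : SYT D.boxes n), T.wt = w := by
  obtain ⟨Y, hY⟩ := hw.exists_isRowFn
  let st : Setoid (Fin n) := ⟨SameComp w, sameComp_equivalence w⟩
  -- Each component is slid by a different imaginary amount, so boxes at an integral distance always
  -- belong to the same component. This prevents unrelated components from violating convexity or
  -- the tableau order.
  let κ : Fin n → ℂ := fun i => ((Quotient.out (Quotient.mk st i) : Fin n) : ℕ) * Complex.I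
  have hκ : ∀ {i j}, SameComp w i j → κ i = κ j := fun {i j} h => by
    have : Quotient.mk st i = Quotient.mk st j := Quotient.sound h
    simp only [κ, this]
  have hκ' : ∀ {i j} {d : ℤ}, κ j = κ i + d → SameComp w i j ∧ d = 0 := fun {i j d} h => by
    have hre := congrArg Complex.re h
    have him := congrArg Complex.im h
    simp [κ] at hre him
    refine ⟨?_, by exact_mod_cast hre.symm⟩
    have h1 : Quotient.out (Quotient.mk st j) = Quotient.out (Quotient.mk st i) := by
      exact Fin.ext (by exact_mod_cast him)
    exact Quotient.exact (Quotient.out_injective h1).symm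
  let b : Fin n → Box ℓ := fun i => ⟨(w i).2, (w i).1 + Y i + κ i, Y i + κ i⟩
  have hle : ∀ {i j} {k l : ℤ}, (w i).2 = (w j).2 → (b j).x = (b i).x + k → (b j).y = (b i).y + l →
      SameComp w i j ∧ w j = sh (k - l) (w i) ∧ Y j = Y i + l := by
    intro i j k l hβ hx hy
    simp only [b] at hx hy
    obtain ⟨h1, h2⟩ := hκ' (i := i) (j := j) (d := Y i + l - Y j) (by
      push_cast; linear_combination hy)
    refine ⟨h1, Prod.ext ?_ hβ.symm, by omega⟩
    simp only [sh]
    push_cast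
    linear_combination hx - hy
  have hb : ∀ {i p} {k l : ℤ}, SameComp w i p → w p = sh (k - l) (w i) → Y p = Y i + l →
      b p = ⟨(b i).β, (b i).x + k, (b i).y + l⟩ := by
    intro i p k l h h1 h2
    simp only [b, h1, h2, hκ h, sh, Box.mk.injEq, true_and]
    push_cast
    constructor <;> ring
  have hright : ∀ {i j} {k l : ℕ}, b j = ⟨(b i).β, (b i).x + k, (b i).y + l⟩ → 1 ≤ k →
      ∃ p, b p = ⟨(b i).β, (b i).x + 1, (b i).y⟩ ∧ i < p := by
    intro i j k l h hk
    obtain ⟨h1, h2, h3⟩ := hle (i := i) (j := j) (k := k) (l := l) (congrArg Box.β h).symm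
      (congrArg Box.x h) (congrArg Box.y h)
    obtain ⟨p, hp1, hp2⟩ := h1.exists_right hY hw hk h2 h3
    refine ⟨p, ?_, (hY.lt_iff hw hp1).mpr hp2.ge⟩
    have := hb (k := 1) (l := 0) (SameComp.of_eq hp1 (Or.inr rfl)) (by simpa using hp1)
      (by simpa using hp2)
    simpa using this
  have hdown : ∀ {i j} {k l : ℕ}, b j = ⟨(b i).β, (b i).x + k, (b i).y + l⟩ → 1 ≤ l →
      ∃ p, b p = ⟨(b i).β, (b i).x, (b i).y + 1⟩ ∧ i < p := by
    intro i j k l h hl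
    obtain ⟨h1, h2, h3⟩ := hle (i := i) (j := j) (k := k) (l := l) (congrArg Box.β h).symm
      (congrArg Box.x h) (congrArg Box.y h)
    obtain ⟨p, hp1, hp2⟩ := h1.exists_down hY hw hl h2 h3
    have hip : w i = sh 1 (w p) := by rw [hp1]; simp
    refine ⟨p, ?_, ?_⟩
    · have := hb (k := 0) (l := 1)
        ((sameComp_equivalence w).symm (SameComp.of_eq hip (Or.inr rfl))) (by simpa using hp1)
        (by simpa using hp2)
      simpa using this
    · have := mt (hY.lt_iff hw hip).mp (by omega)
      refine lt_of_le_of_ne (not_lt.mp this) ?_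
      rintro rfl
      omega
  have hinj : Function.Injective b := by
    intro i j h
    obtain ⟨-, h2, h3⟩ := hle (i := i) (j := j) (k := 0) (l := 0) (congrArg Box.β h)
      (by simp [h]) (by simp [h])
    rw [sub_zero, sh_zero] at h2
    rcases lt_trichotomy i j with hij | hij | hij
    · have := (hY.of_eq hw hij h2.symm).1
      omega
    · exact hij
    · have := (hY.of_eq hw hij h2).1
      omega
  let D : SkewShape ℓ :=
    { boxes := Set.range b
      finite := Set.finite_range b
      convex := by
        have step : ∀ (k' l' k l : ℕ) (i j : Fin n), b j = ⟨(b i).β, (b i).x + k, (b i).y + l⟩ →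
            k' ≤ k → l' ≤ l → ∃ p, b p = ⟨(b i).β, (b i).x + k', (b i).y + l'⟩ := by
          intro k' l'
          induction k' with
          | zero =>
            induction l' with
            | zero => exact fun k l i j _ _ _ => ⟨i, by simp⟩
            | succ l' ih =>
              intro k l i j h hk hl
              obtain ⟨p, hp, -⟩ := hdown h (by omega)
              obtain ⟨q, hq⟩ := ih k (l - 1) p j (by
                rw [h, hp, Nat.cast_sub (by omega)]; simp) hk (by omega)
              refine ⟨q, ?_⟩
              rw [hq, hp]
              push_cast
              simp only [Box.mk.injEq, true_and]
              ring
          | succ k' ih =>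
            intro k l i j h hk hl
            obtain ⟨p, hp, -⟩ := hright h (by omega)
            obtain ⟨q, hq⟩ := ih (k - 1) l p j (by
              rw [h, hp, Nat.cast_sub (by omega)]; simp) (by omega) hl
            refine ⟨q, ?_⟩
            rw [hq, hp]
            push_cast
            simp only [Box.mk.injEq, true_and, and_true]
            ring
        rintro β x y k l ⟨i, hi⟩ ⟨j, hj⟩ k' hk' l' hl'
        obtain ⟨p, hp⟩ := step k' l' k l i j (by rw [hj, hi]) hk' hl'
        exact ⟨p, by rw [hp, hi]⟩
      aligned := by
        rintro _ ⟨i, rfl⟩ _ ⟨j, rfl⟩ hβ hc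
        have hct : ∀ i, (b i).ct = (w i).1 := fun i => by simp only [Box.ct, b]; ring
        rw [hct, hct] at hc
        have hs : ∀ d : ℤ, (d = 0 ∨ d = 1) → w j = sh d (w i) →
            ∃ p q : ℤ, (b j).x = (b i).x + p ∧ (b j).y = (b i).y + q := by
          intro d hd h
          have h1 := hκ (SameComp.of_eq h hd)
          refine ⟨d + Y j - Y i, Y j - Y i, ?_, ?_⟩
          · simp only [b, ← h1, h, sh]
            push_cast
            ring
          · simp only [b, ← h1]
            push_cast
            ring
        rcases hc with hc | hc
        · exact hs 0 (Or.inl rfl) (Prod.ext (by simpa [sh] using hc) hβ.symm)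
        · exact hs 1 (Or.inr rfl) (Prod.ext (by simpa [sh] using hc) hβ.symm) }
  have hstd : ∀ (m : ℕ) (i j : Fin n) (k l : ℕ), k + l = m →
      b j = ⟨(b i).β, (b i).x + k, (b i).y + l⟩ → i ≤ j := by
    intro m
    induction m with
    | zero =>
      intro i j k l hm h
      obtain rfl : k = 0 := by omega
      obtain rfl : l = 0 := by omega
      exact (hinj (h.trans (by simp))).ge
    | succ m ih =>
      intro i j k l hm h
      rcases Nat.eq_zero_or_pos k with rfl | hk
      · obtain ⟨p, hp, hip⟩ := hdown h (by omega)
        exact hip.le.trans (ih p j 0 (l - 1) (by omega) (by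
          rw [h, hp, Nat.cast_sub (by omega)]; simp))
      · obtain ⟨p, hp, hip⟩ := hright h hk
        exact hip.le.trans (ih p j (k - 1) l (by omega) (by
          rw [h, hp, Nat.cast_sub (by omega)]; simp))
  refine ⟨D, ⟨(Equiv.ofInjective b hinj).symm, ?_⟩, ?_⟩
  · rintro ⟨_, i, rfl⟩ ⟨_, j, rfl⟩ ⟨hβ, k, l, hx, hy⟩
    rw [Equiv.ofInjective_symm_apply, Equiv.ofInjective_symm_apply]
    exact hstd _ i j k l rfl (Box.ext' hβ.symm hx hy)
  · funext i
    change (b i).lab = w i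
    refine Prod.ext ?_ rfl
    change (w i).1 + Y i + κ i - (Y i + κ i) = (w i).1
    ring

end

/-- The weight of a weight vector is the sequence of labels of a standard tableau. -/
theorem IsWt.exists_SYT {ℓ n : ℕ} [NeZero ℓ] {ζ : ℂ} (hζ : IsPrimitiveRoot ζ ℓ) {M : Type*}
    [AddCommGroup M] [Module ℂ M] [Module (H ℓ n) M] [IsScalarTower ℂ (H ℓ n) M]
    (hM : USemi ℓ n M) {w : Fin n → ℂ × ZMod ℓ} {x : M} (h : IsWt ζ w x) (hx : x ≠ 0) :
    ∃ (D : SkewShape ℓ) (T : SYT D.boxes n), T.wt = w := by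
  refine Separated.exists_SYT fun i j hij hwij ε hε => ?_
  obtain ⟨⟨k, hk⟩, k', hk'⟩ := h.exists_between hζ hM hx hij hwij
  rcases hε with rfl | rfl
  · exact ⟨k, hk.1, hk.2.1, by rw [hk.2.2]; simp [sh]⟩
  · exact ⟨k', hk'.1, hk'.2.1, by rw [hk'.2.2]; simp [sh, sub_eq_add_neg]⟩


/-! ### Diagrams of partitions -/

section

variable {ℓ : ℕ}

/-- The box that belongs to a cell of a Young diagram. -/
def cellBox (j : ZMod ℓ) (p : ℕ × ℕ) : Box ℓ := ⟨j, (p.2 : ℂ) + 1, (p.1 : ℂ) + 1⟩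

theorem cellBox_inj {j j' : ZMod ℓ} {p p' : ℕ × ℕ} (h : cellBox j p = cellBox j' p') :
    j = j' ∧ p = p' := by
  simp only [cellBox, Box.mk.injEq, add_left_inj, Nat.cast_inj] at h
  exact ⟨h.1, Prod.ext h.2.2 h.2.1⟩

theorem cellBox_mem {lam : MultiPartition ℓ} {j : ZMod ℓ} {p : ℕ × ℕ} :
    cellBox j p ∈ lam.boxes ↔ p ∈ lam j := by
  constructor
  · rintro ⟨p', hp', h1, h2⟩
    have : cellBox j p = cellBox j p' := Box.ext' rfl h1 h2
    rw [(cellBox_inj this).2]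
    exact hp'
  · exact fun h => ⟨p, h, rfl, rfl⟩

theorem exists_cellBox {lam : MultiPartition ℓ} {b : Box ℓ} (h : b ∈ lam.boxes) :
    ∃ j p, b = cellBox j p := by
  obtain ⟨p, -, h1, h2⟩ := h
  exact ⟨b.β, p, Box.ext' rfl h1 h2⟩

theorem cellBox_mem_skewBoxes {lam mu : MultiPartition ℓ} {j : ZMod ℓ} {p : ℕ × ℕ} :
    cellBox j p ∈ skewBoxes lam mu ↔ p ∈ lam j ∧ p ∉ mu j := by
  rw [skewBoxes, Set.mem_sdiff, cellBox_mem, cellBox_mem]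

theorem cellBox_le {j : ZMod ℓ} {p : ℕ × ℕ} {b : Box ℓ} (h : (cellBox j p).le b) :
    ∃ p', p ≤ p' ∧ b = cellBox j p' := by
  obtain ⟨hβ, k, l, hx, hy⟩ := h
  refine ⟨(p.1 + l, p.2 + k), Prod.mk_le_mk.mpr ⟨Nat.le_add_right _ _, Nat.le_add_right _ _⟩,
    Box.ext' hβ.symm ?_ ?_⟩
  · rw [hx]; simp only [cellBox]; push_cast; ring
  · rw [hy]; simp only [cellBox]; push_cast; ring

theorem boxes_mono {lam mu : MultiPartition ℓ} (h : mu ≤ lam) : mu.boxes ⊆ lam.boxes :=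
  fun b ⟨p, hp, hb⟩ => ⟨p, h b.β hp, hb⟩

variable [NeZero ℓ]

theorem boxes_eq (lam : MultiPartition ℓ) : lam.boxes =
    (fun p : Σ _ : ZMod ℓ, ℕ × ℕ => cellBox p.1 p.2) ''
      ((Finset.univ.sigma fun j => (lam j).cells : Finset _) : Set (Σ _ : ZMod ℓ, ℕ × ℕ)) := by
  ext b
  constructor
  · intro h
    obtain ⟨j, p, rfl⟩ := exists_cellBox h
    exact ⟨⟨j, p⟩, by simpa using cellBox_mem.mp h, rfl⟩
  · rintro ⟨⟨j, p⟩, h, rfl⟩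
    exact cellBox_mem.mpr (by simpa using h)

theorem boxes_finite (lam : MultiPartition ℓ) : lam.boxes.Finite := by
  rw [boxes_eq]
  exact (Finset.finite_toSet _).image _

theorem ncard_boxes (lam : MultiPartition ℓ) : lam.boxes.ncard = lam.size := by
  rw [boxes_eq, Set.ncard_image_of_injective, Set.ncard_coe_finset, Finset.card_sigma]
  · rfl
  · rintro ⟨j, p⟩ ⟨j', p'⟩ h
    obtain ⟨rfl, rfl⟩ := cellBox_inj h
    rfl

theorem ncard_skewBoxes {lam mu : MultiPartition ℓ} (h : mu ≤ lam) :
    (skewBoxes lam mu).ncard = lam.size - mu.size := by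
  rw [skewBoxes, Set.ncard_sdiff (boxes_mono h) (boxes_finite mu), ncard_boxes, ncard_boxes]

/-- The boxes of `λ∖μ` form a skew shape. -/
def skewShape (lam mu : MultiPartition ℓ) : SkewShape ℓ where
  boxes := skewBoxes lam mu
  finite := (boxes_finite lam).sdiff
  convex j x y k l h h' k' hk l' hl := by
    obtain ⟨j', p, e⟩ := exists_cellBox h.1
    obtain rfl : j = j' := congrArg Box.β e
    rw [e] at h
    have e1 : (⟨j, x + (k' : ℕ), y + (l' : ℕ)⟩ : Box ℓ) = cellBox j (p.1 + l', p.2 + k') := by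
      simp only [cellBox, Box.mk.injEq] at e ⊢
      rw [e.2.1, e.2.2]
      push_cast
      exact ⟨trivial, by ring, by ring⟩
    have e2 : (⟨j, x + k, y + l⟩ : Box ℓ) = cellBox j (p.1 + l, p.2 + k) := by
      simp only [cellBox, Box.mk.injEq] at e ⊢
      rw [e.2.1, e.2.2]
      push_cast
      exact ⟨trivial, by ring, by ring⟩
    rw [e2, cellBox_mem_skewBoxes] at h'
    rw [cellBox_mem_skewBoxes] at h
    rw [e1, cellBox_mem_skewBoxes]
    exact ⟨(lam j).isLowerSet (Prod.mk_le_mk.mpr ⟨by omega, by omega⟩) h'.1,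
      fun hm => h.2 ((mu j).isLowerSet (Prod.mk_le_mk.mpr ⟨by simp, by simp⟩) hm)⟩
  aligned b hb c hc hβ _ := by
    obtain ⟨j, p, rfl⟩ := exists_cellBox hb.1
    obtain ⟨j', p', rfl⟩ := exists_cellBox hc.1
    refine ⟨p'.2 - p.2, p'.1 - p.1, ?_, ?_⟩ <;> simp only [cellBox] <;> push_cast <;> ring

theorem boxes_bot : MultiPartition.boxes (ℓ := ℓ) ⊥ = ∅ := by
  rw [Set.eq_empty_iff_forall_notMem]
  rintro b ⟨p, hp, -⟩
  exact YoungDiagram.notMem_bot p hp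

/-- The boxes of `λ` form a skew shape. -/
def partShape (lam : MultiPartition ℓ) : SkewShape ℓ where
  boxes := lam.boxes
  finite := boxes_finite lam
  convex j x y k l h h' k' hk l' hl := by
    have e : lam.boxes = skewBoxes lam ⊥ := by rw [skewBoxes, boxes_bot, Set.sdiff_empty]
    rw [e] at h h' ⊢
    exact (skewShape lam ⊥).convex j x y k l h h' k' hk l' hl
  aligned b hb c hc h h' := by
    have e : lam.boxes = skewBoxes lam ⊥ := by rw [skewBoxes, boxes_bot, Set.sdiff_empty]
    rw [e] at hb hc
    exact (skewShape lam ⊥).aligned b hb c hc h h'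

end

/-! ### Decompositions of shapes -/

section

variable {ℓ : ℕ} (D : SkewShape ℓ)

theorem SkewShape.Conn.integral {D : SkewShape ℓ} {b c : D.boxes} (h : D.Conn b c) :
    c.1.β = b.1.β ∧ ∃ p q : ℤ, c.1.x = b.1.x + p ∧ c.1.y = b.1.y + q := by
  induction h with
  | refl => exact ⟨rfl, 0, 0, by simp, by simp⟩
  | @tail c d _ hcd ih =>
    obtain ⟨hβ, p, q, hx, hy⟩ := ih
    obtain ⟨hβ', h | h⟩ := hcd
    · refine ⟨hβ'.symm.trans hβ, ?_⟩
      rcases h.2 with h2 | h2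
      · exact ⟨p, q - 1, h.1.symm.trans hx, by push_cast; linear_combination hy - h2⟩
      · exact ⟨p, q + 1, h.1.symm.trans hx, by push_cast; linear_combination hy - h2⟩
    · refine ⟨hβ'.symm.trans hβ, ?_⟩
      rcases h.2 with h2 | h2
      · exact ⟨p - 1, q, by push_cast; linear_combination hx - h2, h.1.symm.trans hy⟩
      · exact ⟨p + 1, q, by push_cast; linear_combination hx - h2, h.1.symm.trans hy⟩

theorem SkewShape.exists_cells (r : D.boxes) : ∃ (f : D.boxes → ℕ × ℕ) (α κ : ℂ),
    ∀ b, D.Conn r b → (⟨b.1.β, b.1.x - α - κ, b.1.y - κ⟩ : Box ℓ) = cellBox r.1.β (f b) := by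
  classical
  have : Fintype D.boxes := D.finite.fintype
  have h : ∀ b, ∃ p q : ℤ, D.Conn r b → b.1.x = r.1.x + p ∧ b.1.y = r.1.y + q := by
    intro b
    by_cases hb : D.Conn r b
    · obtain ⟨-, p, q, h⟩ := hb.integral
      exact ⟨p, q, fun _ => h⟩
    · exact ⟨0, 0, fun h => absurd h hb⟩
  choose p q hpq using h
  -- Relative to r all coordinates on the component are integers, and a shift by A makes them
  -- nonnegative. The number α is the content of r; the 1 in κ accounts for cells being counted from
  -- zero.
  obtain ⟨A, hA⟩ : ∃ A : ℕ, ∀ b, 0 ≤ p b + A ∧ 0 ≤ q b + A := by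
    refine ⟨∑ b, ((p b).natAbs + (q b).natAbs), fun b => ?_⟩
    have := Finset.single_le_sum (f := fun b => (p b).natAbs + (q b).natAbs)
      (fun _ _ => Nat.zero_le _) (Finset.mem_univ b)
    omega
  refine ⟨fun b => ((q b + A).toNat, (p b + A).toNat), r.1.x - r.1.y, r.1.y - A - 1,
    fun b hb => ?_⟩
  obtain ⟨h1, h2⟩ := hpq b hb
  have e1 : (((p b + A).toNat : ℕ) : ℂ) = p b + A := by
    exact_mod_cast congrArg (Int.cast (R := ℂ)) (Int.toNat_of_nonneg (hA b).1)
  have e2 : (((q b + A).toNat : ℕ) : ℂ) = q b + A := by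
    exact_mod_cast congrArg (Int.cast (R := ℂ)) (Int.toNat_of_nonneg (hA b).2)
  simp only [cellBox, Box.mk.injEq, e1, e2, h1, h2]
  exact ⟨hb.integral.1, by ring, by ring⟩

/-- A connected component is a diagonal slide of a translate of a diagram `λ∖μ`. -/
theorem SkewShape.exists_partitions (r : D.boxes) : ∃ (lam mu : MultiPartition ℓ) (α κ : ℂ),
    mu ≤ lam ∧ ∀ c, c ∈ skewBoxes lam mu ↔
      ∃ b, D.Conn r b ∧ c = ⟨b.1.β, b.1.x - α - κ, b.1.y - κ⟩ := by
  classical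
  have : Fintype D.boxes := D.finite.fintype
  obtain ⟨f, α, κ, hf⟩ := D.exists_cells r
  let C : Finset (ℕ × ℕ) := (Finset.univ.filter fun b => D.Conn r b).image f
  have hC : ∀ p, p ∈ C ↔ ∃ b, D.Conn r b ∧ f b = p := fun p => by simp [C]
  have hconv : ∀ {p p' p''}, p ≤ p' → p' ≤ p'' → p ∈ C → p'' ∈ C → p' ∈ C := by
    intro p p' p'' h h' hp hp''
    obtain ⟨b, hb, rfl⟩ := (hC _).mp hp
    obtain ⟨c, hc, rfl⟩ := (hC _).mp hp''
    obtain ⟨k', hk'⟩ := Nat.exists_eq_add_of_le h.2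
    obtain ⟨l', hl'⟩ := Nat.exists_eq_add_of_le h.1
    obtain ⟨k, hk⟩ := Nat.exists_eq_add_of_le (h.2.trans h'.2)
    obtain ⟨l, hl⟩ := Nat.exists_eq_add_of_le (h.1.trans h'.1)
    have eb := hf b hb
    have ec := hf c hc
    simp only [cellBox, Box.mk.injEq, hk, hl] at eb ec
    push_cast at ec
    have hD := D.convex b.1.β b.1.x b.1.y k l b.2 (by
      have : (⟨b.1.β, b.1.x + k, b.1.y + l⟩ : Box ℓ) = c.1 := by
        refine Box.ext' (eb.1.trans ec.1.symm) ?_ ?_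
        · linear_combination eb.2.1 - ec.2.1
        · linear_combination eb.2.2 - ec.2.2
      rw [this]
      exact c.2) k' (by have := h'.2; omega) l' (by have := h'.1; omega)
    have hcon : D.Conn r ⟨_, hD⟩ :=
      hb.trans (D.conn_of_le (b := b) (c := ⟨_, hD⟩) ⟨rfl, k', l', rfl, rfl⟩)
    refine (hC _).mpr ⟨⟨_, hD⟩, hcon, ?_⟩
    have e := hf _ hcon
    have e' : (⟨b.1.β, b.1.x + k' - α - κ, b.1.y + l' - κ⟩ : Box ℓ) = cellBox r.1.β p' := by
      simp only [cellBox, Box.mk.injEq, hk', hl']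
      push_cast
      exact ⟨eb.1, by linear_combination eb.2.1, by linear_combination eb.2.2⟩
    exact (cellBox_inj (e.symm.trans e')).2
  -- λ is the order ideal generated by the cells of the component and μ is what remains of it;
  -- convexity makes μ an order ideal.
  let L : YoungDiagram := ⟨C.biUnion Finset.Iic, fun p p' h hp => by
    simp only [Finset.coe_biUnion, Set.mem_iUnion, Finset.coe_Iic, Set.mem_Iic] at hp ⊢
    obtain ⟨c, hc, hpc⟩ := hp
    exact ⟨c, hc, h.trans hpc⟩⟩
  have hL : ∀ p, p ∈ L ↔ ∃ c ∈ C, p ≤ c := fun p => by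
    change p ∈ C.biUnion Finset.Iic ↔ _
    simp
  let L' : YoungDiagram := ⟨L.cells \ C, fun p p' h hp => by
    simp only [Finset.coe_sdiff, Set.mem_sdiff, Finset.mem_coe, YoungDiagram.mem_cells] at hp ⊢
    refine ⟨L.isLowerSet h hp.1, fun hp' => hp.2 ?_⟩
    obtain ⟨c, hc, hpc⟩ := (hL p).mp hp.1
    exact hconv h hpc hp' hc⟩
  have hL' : ∀ p, p ∈ L' ↔ p ∈ L ∧ p ∉ C := fun p => by
    change p ∈ L.cells \ C ↔ _
    simp
  refine ⟨Function.update ⊥ r.1.β L, Function.update ⊥ r.1.β L', α, κ, fun j => ?_, fun c => ?_⟩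
  · by_cases hj : j = r.1.β
    · subst hj
      rw [Function.update_self, Function.update_self]
      exact fun p hp => ((hL' p).mp hp).1
    · rw [Function.update_of_ne hj, Function.update_of_ne hj]
  · constructor
    · intro hc
      obtain ⟨j, p, rfl⟩ := exists_cellBox hc.1
      rw [cellBox_mem_skewBoxes] at hc
      by_cases hj : j = r.1.β
      · subst hj
        rw [Function.update_self, Function.update_self, hL'] at hc
        have hp : p ∈ C := by tauto
        obtain ⟨b, hb, rfl⟩ := (hC _).mp hp
        exact ⟨b, hb, (hf b hb).symm⟩
      · rw [Function.update_of_ne hj] at hc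
        exact absurd hc.1 (YoungDiagram.notMem_bot p)
    · rintro ⟨b, hb, rfl⟩
      rw [hf b hb, cellBox_mem_skewBoxes, Function.update_self, Function.update_self, hL']
      have hp : f b ∈ C := (hC _).mpr ⟨b, hb, rfl⟩
      exact ⟨(hL _).mpr ⟨_, hp, le_rfl⟩, fun h => h.2 hp⟩

theorem SkewShape.nonempty_decomposition [NeZero ℓ] {N : ℕ} (hN : D.boxes.ncard = N) :
    Nonempty (Decomposition D N) := by
  classical
  have : Fintype D.boxes := D.finite.fintype
  let st : Setoid D.boxes := ⟨D.Conn, fun _ => .refl, fun h => h.symm, fun h h' => h.trans h'⟩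
  let q := Fintype.equivFin (Quotient st)
  choose lam mu α κ hle hmem using D.exists_partitions
  let r : Fin (Fintype.card (Quotient st)) → D.boxes := fun i => (q.symm i).out
  let idx : D.boxes → Fin (Fintype.card (Quotient st)) := fun b => q (Quotient.mk st b)
  have hidx : ∀ b, D.Conn (r (idx b)) b := fun b => by
    have : Quotient.mk st (r (idx b)) = Quotient.mk st b := by
      simp only [r, idx, Equiv.symm_apply_apply, Quotient.out_eq]
    exact Quotient.exact this
  have hidx' : ∀ i b, D.Conn (r i) b → idx b = i := fun i b h => by
    have h2 : Quotient.mk st (r i) = Quotient.mk st b := Quotient.sound h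
    simp only [idx, ← h2, r, Quotient.out_eq, Equiv.apply_symm_apply]
  let g : D.boxes → Σ i, skewBoxes (lam (r i)) (mu (r i)) := fun b => ⟨idx b,
    ⟨⟨b.1.β, b.1.x - α (r (idx b)) - κ (r (idx b)), b.1.y - κ (r (idx b))⟩,
      (hmem _ _).mpr ⟨b, hidx b, rfl⟩⟩⟩
  have hg : Function.Bijective g := by
    constructor
    · intro b c h
      have h1 : idx b = idx c := congrArg Sigma.fst h
      have h2 : (g b).2.1 = (g c).2.1 :=
        congrArg (fun s : Σ i, skewBoxes (lam (r i)) (mu (r i)) => s.2.1) h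
      simp only [g, h1, Box.mk.injEq, sub_left_inj] at h2
      exact Subtype.ext (Box.ext' h2.1 h2.2.1 h2.2.2)
    · rintro ⟨i, c, hc⟩
      obtain ⟨b, hb, rfl⟩ := (hmem _ _).mp hc
      obtain rfl := hidx' i b hb
      exact ⟨b, rfl⟩
  have hcard : ∀ i, Nat.card (skewBoxes (lam (r i)) (mu (r i))) =
      (lam (r i)).size - (mu (r i)).size := fun i => by
    rw [← ncard_skewBoxes (hle (r i)), Set.ncard_def, Set.encard, ENat.card]
    rfl
  have hsz : ∀ i, (mu (r i)).size ≤ (lam (r i)).size := fun i =>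
    Finset.sum_le_sum fun j _ => Finset.card_le_card (hle (r i) j)
  exact ⟨{
    k := _
    lam := fun i => lam (r i)
    mu := fun i => mu (r i)
    m := fun i => (mu (r i)).size
    n := fun i => (lam (r i)).size - (mu (r i)).size
    α := fun i => α (r i)
    κ := fun i => κ (r i)
    e := Equiv.ofBijective g hg
    mu_le := fun i => hle (r i)
    size_mu := fun i => rfl
    size_lam := fun i => by have := hsz i; omega
    sum_n := by
      have : ∀ i, Finite (skewBoxes (lam (r i)) (mu (r i))) := fun i =>
        ((boxes_finite (lam (r i))).sdiff).to_subtype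
      rw [← hN, ← Nat.card_coe_set_eq, Nat.card_congr (Equiv.ofBijective g hg), Nat.card_sigma]
      exact Finset.sum_congr rfl fun i _ => (hcard i).symm
    nonempty := fun i => ⟨_, (hmem _ _).mpr ⟨r i, .refl, rfl⟩⟩
    component := fun b c => by
      change idx b = idx c ↔ _
      rw [q.apply_eq_iff_eq]
      exact Quotient.eq (r := st)
    translate := fun b => by
      refine Box.ext' rfl ?_ ?_
      · change _ = b.1.x - α (r (idx b)) - κ (r (idx b)) + α (r (idx b)) + κ (r (idx b))
        ring
      · change _ = b.1.y - κ (r (idx b)) + κ (r (idx b))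
        ring }⟩

end


/-! ### Jucys-Murphy elements act by contents -/

section

variable {ℓ : ℕ} [NeZero ℓ] {ζ : ℂ} (hζ : IsPrimitiveRoot ζ ℓ)

theorem zetaPow_zero {n : ℕ} (i : Fin n) : (zetaPow i 0 : G ℓ n) = 1 := by
  rw [zetaPow, ofAdd_zero, Pi.mulSingle_one, map_one]

theorem zetaPow_eq_pow {n : ℕ} (i : Fin n) (c : ZMod ℓ) :
    (zetaPow i c : G ℓ n) = zeta i ^ c.val := by
  have key : ∀ m : ℕ, (zetaPow i (m : ZMod ℓ) : G ℓ n) = zeta i ^ m := by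
    intro m
    induction m with
    | zero => rw [Nat.cast_zero, zetaPow_zero, pow_zero]
    | succ m ih => rw [Nat.cast_succ, zetaPow_add, ih, pow_succ]; rfl
  rw [← key, ZMod.natCast_zmod_val]

theorem IsYoungRep.unique {S : Set (Box ℓ)} {n : ℕ} {ρ ρ' : Representation ℂ (G ℓ n) (YoungSpace S n)}
    (h : IsYoungRep ζ S ρ) (h' : IsYoungRep ζ S ρ') : ρ = ρ' := by
  refine MonoidHom.ext fun g => ?_
  induction g using group_induction with
  | h1 => rw [map_one, map_one]
  | hmul g h hg hh => rw [map_mul, map_mul, hg, hh]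
  | hs i i' hi => rw [h.1 i i' hi, h'.1 i i' hi]
  | hz i c => rw [zetaPow_eq_pow, map_pow, map_pow, h.2, h'.2]

theorem youngRep_isYoungRep (D : SkewShape ℓ) (n : ℕ) :
    IsYoungRep ζ D.boxes (youngRep hζ D n) := by
  refine ⟨fun i j hij => youngRep_s hζ _ hij, fun i => ?_⟩
  rw [youngZ_eq]
  refine (youngRep_zetaPow hζ _ i 1).trans ?_
  simp only [one_mul, chi_apply]

/-- Young's formulas do define a representation, and only one, so the chosen one is the
representation constructed above and not a default value. -/
theorem specht_eq (lam : MultiPartition ℓ) (n : ℕ) :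
    specht ζ lam n = (youngRep hζ (partShape lam) n : Representation ℂ (G ℓ n) _) :=
  IsYoungRep.unique (Classical.epsilon_spec (p := IsYoungRep ζ lam.boxes)
    ⟨_, youngRep_isYoungRep hζ (partShape lam) n⟩) (youngRep_isYoungRep hζ (partShape lam) n)

include hζ in
theorem specht_s (lam : MultiPartition ℓ) {n : ℕ} {i i' : Fin n} (hi : (i' : ℕ) = i + 1) :
    specht ζ lam n (s i i') = youngS lam.boxes i i' := by
  rw [specht_eq hζ]
  exact youngRep_s hζ _ hi

theorem specht_zetaPow (lam : MultiPartition ℓ) {n : ℕ} (i : Fin n) (c : ZMod ℓ) :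
    specht ζ lam n (zetaPow i c) = diagOp lam.boxes n fun F => chi hζ (c * (flab F i).2) := by
  rw [specht_eq hζ]
  exact youngRep_zetaPow hζ _ i c

theorem partYoungS_apply (lam : MultiPartition ℓ) {n : ℕ} {i i' : Fin n} (hi : (i' : ℕ) = i + 1)
    (F : lam.boxes ≃ Fin n) :
    youngS lam.boxes i i' (youngVec F) = eLab (flab F i) (flab F i') • youngVec F +
      xLab (flab F i) (flab F i') • youngVec (F.trans (Equiv.swap i i')) :=
  youngS_apply (partShape lam) hi F

theorem skewYoungS_apply (lam mu : MultiPartition ℓ) {n : ℕ} {i i' : Fin n}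
    (hi : (i' : ℕ) = i + 1) (F : skewBoxes lam mu ≃ Fin n) :
    youngS (skewBoxes lam mu) i i' (youngVec F) = eLab (flab F i) (flab F i') • youngVec F +
      xLab (flab F i) (flab F i') • youngVec (F.trans (Equiv.swap i i')) :=
  youngS_apply (skewShape lam mu) hi F

theorem SYT.ct_box_zero {lam : MultiPartition ℓ} {n : ℕ} (T : SYT lam.boxes n) (i : Fin n)
    (hi : (i : ℕ) = 0) : (T.wt i).1 = 0 := by
  obtain ⟨j, p, hp⟩ := exists_cellBox (T.mem i)
  have hm := T.mem i
  rw [hp, cellBox_mem] at hm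
  have h0 : cellBox j (0, 0) ∈ lam.boxes :=
    cellBox_mem.mpr ((lam j).isLowerSet (Prod.mk_le_mk.mpr ⟨Nat.zero_le _, Nat.zero_le _⟩) hm)
  obtain ⟨k, hk⟩ := T.exists_box h0
  have hle : (T.box k).le (T.box i) := by
    rw [hk, hp]
    exact ⟨rfl, p.2, p.1, by simp [cellBox, add_comm], by simp [cellBox, add_comm]⟩
  have : k = i := le_antisymm (T.le_of_le hle) (by rw [Fin.le_def]; omega)
  rw [SYT.wt, ← this, hk]
  simp [Box.lab, cellBox, Box.ct]

include hζ in
/-- The Jucys-Murphy element `φ_i` acts on `v_T` by the content of the box that contains `i`. -/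
theorem specht_phi (lam : MultiPartition ℓ) {n : ℕ} (i : Fin n) :
    (specht ζ lam n).asAlgebraHom (phi i) = youngU lam.boxes i := by
  obtain ⟨i, hi⟩ := i
  induction i with
  | zero =>
    have h0 : phi (⟨0, hi⟩ : Fin n) = (0 : MonoidAlgebra ℂ (G ℓ n)) := by
      rw [phi]
      have : Finset.Iio (⟨0, hi⟩ : Fin n) = ∅ := by
        ext x
        simp [Fin.lt_def]
      rw [this, Finset.sum_empty]
    rw [h0, map_zero]
    refine young_ext fun T => ?_
    rw [youngU, diagOp_apply, LinearMap.zero_apply]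
    have := T.ct_box_zero ⟨0, hi⟩ rfl
    change (T.wt ⟨0, hi⟩).1 = 0 at this
    change 0 = ((ℓ : ℂ) * (T.wt ⟨0, hi⟩).1) • _
    rw [this, mul_zero, zero_smul]
  | succ i ih =>
    -- The Jucys-Murphy elements and the operators `youngU` satisfy the same relation with s_i,
    -- which determines the one with index i + 1 from the one with index i.
    have h1 := congrArg (specht ζ lam n).asAlgebraHom
      (s_mul_phi (ℓ := ℓ) (⟨i, by omega⟩ : Fin n) ⟨i + 1, hi⟩ rfl)
    rw [map_mul, map_sub, map_mul, ih, map_sum] at h1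
    simp only [Representation.asAlgebraHom_of] at h1
    rw [specht_s hζ lam rfl] at h1
    have h2 : (youngS lam.boxes ⟨i, by omega⟩ ⟨i + 1, hi⟩ : Module.End ℂ (YoungSpace lam.boxes n)) *
        youngU lam.boxes ⟨i, by omega⟩ = youngU lam.boxes ⟨i + 1, hi⟩ *
          youngS lam.boxes ⟨i, by omega⟩ ⟨i + 1, hi⟩ - ∑ c : ZMod ℓ,
            specht ζ lam n (zetaPow ⟨i, by omega⟩ c * zetaPow ⟨i + 1, hi⟩ (-c)) := by
      rw [specht_eq hζ]
      exact (youngS_mul_youngU (partShape lam) rfl).trans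
        (congrArg _ (sum_youngRep_zetaPow hζ (partShape lam) _ _).symm)
    have h4 := h1.symm.trans h2
    have h5 := sub_left_inj.mp h4
    have hss : ∀ x, youngS lam.boxes (⟨i, by omega⟩ : Fin n) ⟨i + 1, hi⟩
        (youngS lam.boxes (⟨i, by omega⟩ : Fin n) ⟨i + 1, hi⟩ x) = x := by
      intro x
      rw [← specht_s hζ lam rfl, ← Module.End.mul_apply, ← map_mul, s_mul_s, map_one,
        Module.End.one_apply]
    refine LinearMap.ext fun x => ?_
    have h6 := LinearMap.congr_fun h5 (youngS lam.boxes (⟨i, by omega⟩ : Fin n) ⟨i + 1, hi⟩ x)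
    rwa [Module.End.mul_apply, Module.End.mul_apply, hss] at h6

end

/-! ### Gluing tableaux -/

section

variable {ℓ m n : ℕ} {lam mu : MultiPartition ℓ} (h : mu ≤ lam)

open Classical in
/-- The filling of `λ` composed of fillings of `μ` and `λ∖μ`. -/
def glue (F : mu.boxes ≃ Fin m) (E : skewBoxes lam mu ≃ Fin n) : lam.boxes ≃ Fin (m + n) :=
  (Equiv.Set.sumDiffSubset (boxes_mono h)).symm.trans ((Equiv.sumCongr F E).trans finSumFinEquiv)

variable (F : mu.boxes ≃ Fin m) (E : skewBoxes lam mu ≃ Fin n)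

theorem glue_symm_castAdd (i : Fin m) :
    ((glue h F E).symm (Fin.castAdd n i)).1 = (F.symm i).1 := by
  classical
  change (Equiv.Set.sumDiffSubset (boxes_mono h)
    (Sum.map F.symm E.symm (finSumFinEquiv.symm (Fin.castAdd n i)))).1 = _
  rw [finSumFinEquiv_symm_apply_castAdd]
  rfl

theorem glue_symm_natAdd (i : Fin n) :
    ((glue h F E).symm (Fin.natAdd m i)).1 = (E.symm i).1 := by
  classical
  change (Equiv.Set.sumDiffSubset (boxes_mono h)
    (Sum.map F.symm E.symm (finSumFinEquiv.symm (Fin.natAdd m i)))).1 = _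
  rw [finSumFinEquiv_symm_apply_natAdd]
  rfl

theorem flab_glue_castAdd (i : Fin m) : flab (glue h F E) (Fin.castAdd n i) = flab F i := by
  rw [flab, glue_symm_castAdd, flab]

theorem flab_glue_natAdd (i : Fin n) : flab (glue h F E) (Fin.natAdd m i) = flab E i := by
  rw [flab, glue_symm_natAdd, flab]

theorem equiv_ext_symm {α β : Type*} {S : Set α} {f g : S ≃ β}
    (h : ∀ i, (f.symm i).1 = (g.symm i).1) : f = g :=
  Equiv.symm_bijective.injective (Equiv.ext fun i => Subtype.ext (h i))

theorem glue_swap_castAdd (i i' : Fin m) : glue h (F.trans (Equiv.swap i i')) E =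
    (glue h F E).trans (Equiv.swap (Fin.castAdd n i) (Fin.castAdd n i')) := by
  refine equiv_ext_symm fun k => ?_
  rw [Equiv.symm_trans_apply, Equiv.symm_swap]
  induction k using Fin.addCases with
  | left k =>
    rw [glue_symm_castAdd, Equiv.symm_trans_apply, Equiv.symm_swap,
      (Fin.castAdd_injective m n).swap_apply, glue_symm_castAdd]
  | right k =>
    rw [glue_symm_natAdd, Equiv.swap_apply_of_ne_of_ne, glue_symm_natAdd] <;>
      simp [Fin.ext_iff] <;> omega

theorem glue_swap_natAdd (i i' : Fin n) : glue h F (E.trans (Equiv.swap i i')) =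
    (glue h F E).trans (Equiv.swap (Fin.natAdd m i) (Fin.natAdd m i')) := by
  refine equiv_ext_symm fun k => ?_
  rw [Equiv.symm_trans_apply, Equiv.symm_swap]
  induction k using Fin.addCases with
  | left k =>
    rw [glue_symm_castAdd, Equiv.swap_apply_of_ne_of_ne, glue_symm_castAdd] <;>
      simp [Fin.ext_iff] <;> omega
  | right k =>
    rw [glue_symm_natAdd, Equiv.symm_trans_apply, Equiv.symm_swap,
      (Fin.natAdd_injective n m).swap_apply, glue_symm_natAdd]

theorem mem_boxes_of_le {b c : Box ℓ} (hb : b ∈ lam.boxes) (hc : c ∈ mu.boxes) (hbc : b.le c) :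
    b ∈ mu.boxes := by
  obtain ⟨j, p, rfl⟩ := exists_cellBox hb
  obtain ⟨p', hle, rfl⟩ := cellBox_le hbc
  rw [cellBox_mem] at *
  exact (mu j).isLowerSet hle hc

/-- A mixed violation would put a box of λ∖μ before a box of μ, which cannot happen since μ is an
order ideal. -/
theorem isStd_glue_iff : IsStd (glue h F E) ↔ IsStd F ∧ IsStd E := by
  simp only [isStd_iff]
  constructor
  · intro hF
    refine ⟨fun i j hij => ?_, fun i j hij => ?_⟩
    · have := hF (Fin.castAdd n i) (Fin.castAdd n j)
        (by rwa [glue_symm_castAdd, glue_symm_castAdd])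
      exact this
    · have := hF (Fin.natAdd m i) (Fin.natAdd m j)
        (by rwa [glue_symm_natAdd, glue_symm_natAdd])
      exact (Fin.natAdd_le_natAdd_iff m).mp this
  · rintro ⟨hF, hE⟩ i j hij
    induction i using Fin.addCases with
    | left i =>
      induction j using Fin.addCases with
      | left j =>
        rw [glue_symm_castAdd, glue_symm_castAdd] at hij
        exact hF i j hij
      | right j => simp only [Fin.le_def, Fin.val_castAdd, Fin.val_natAdd]; omega
    | right i =>
      induction j using Fin.addCases with
      | left j =>
        rw [glue_symm_castAdd, glue_symm_natAdd] at hij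
        exact absurd (mem_boxes_of_le (E.symm i).2.1 (F.symm j).2 hij) (E.symm i).2.2
      | right j =>
        rw [glue_symm_natAdd, glue_symm_natAdd] at hij
        exact (Fin.natAdd_le_natAdd_iff m).mpr (hE i j hij)

theorem glue_injective {E E' : skewBoxes lam mu ≃ Fin n} (he : glue h F E = glue h F E') :
    E = E' :=
  equiv_ext_symm fun i => by rw [← glue_symm_natAdd h F, he, glue_symm_natAdd]

/-- A tableau on `λ` whose first entries form the tableau `S` on `μ` is obtained by gluing. -/
theorem exists_eq_glue (T : SYT lam.boxes (m + n)) (S : SYT mu.boxes m)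
    (hTS : ∀ i, T.box (Fin.castAdd n i) = S.box i) :
    ∃ E : skewBoxes lam mu ≃ Fin n, T.fill = glue h S.fill E := by
  classical
  have hmem : ∀ i : Fin n, T.box (Fin.natAdd m i) ∈ skewBoxes lam mu := by
    refine fun i => ⟨T.mem _, fun hi => ?_⟩
    obtain ⟨k, hk⟩ := S.exists_box hi
    rw [← hTS] at hk
    have := T.box_inj hk
    simp only [Fin.ext_iff, Fin.val_castAdd, Fin.val_natAdd] at this
    omega
  have hbij : Function.Bijective fun i : Fin n =>
      (⟨T.box (Fin.natAdd m i), hmem i⟩ : skewBoxes lam mu) := by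
    constructor
    · intro i j hij
      have h1 : T.box (Fin.natAdd m i) = T.box (Fin.natAdd m j) := by simpa using hij
      simpa using T.box_inj h1
    · rintro ⟨b, hb⟩
      obtain ⟨k, rfl⟩ := T.exists_box hb.1
      induction k using Fin.addCases with
      | left k =>
        rw [hTS] at hb
        exact absurd (S.mem k) hb.2
      | right k => exact ⟨k, rfl⟩
  refine ⟨(Equiv.ofBijective _ hbij).symm, equiv_ext_symm fun k => ?_⟩
  induction k using Fin.addCases with
  | left k => rw [glue_symm_castAdd]; exact hTS k
  | right k => rw [glue_symm_natAdd]; rfl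

end

/-! ### The modules `S^{λ∖μ}` -/

section

variable {ℓ m n : ℕ} [NeZero ℓ] {ζ : ℂ} (hζ : IsPrimitiveRoot ζ ℓ) {lam mu : MultiPartition ℓ}
  (h : mu ≤ lam)

/-- The bilinear map that sends `v_E`, `v_F` to `v_T`, where `T` is composed of `F` and `E`. -/
def gluePair : YoungSpace (skewBoxes lam mu) n →ₗ[ℂ]
    YoungSpace mu.boxes m →ₗ[ℂ] YoungSpace lam.boxes (m + n) :=
  (youngBasis (skewBoxes lam mu) n).constr ℂ fun T => (youngBasis mu.boxes m).constr ℂ fun S =>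
    youngVec (glue h S.fill T.fill)

omit [NeZero ℓ] in
theorem gluePair_apply (E : skewBoxes lam mu ≃ Fin n) (F : mu.boxes ≃ Fin m) :
    gluePair h (youngVec E) (youngVec F) = youngVec (glue h F E) := by
  by_cases hE : IsStd E
  · obtain ⟨T, rfl⟩ := hE.exists_fill
    rw [youngVec_std, gluePair, Module.Basis.constr_basis]
    by_cases hF : IsStd F
    · obtain ⟨S, rfl⟩ := hF.exists_fill
      rw [youngVec_std, Module.Basis.constr_basis]
    · rw [youngVec_eq_zero hF, map_zero,
        youngVec_eq_zero fun hs => hF ((isStd_glue_iff h _ _).mp hs).1]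
  · rw [youngVec_eq_zero hE, map_zero, LinearMap.zero_apply,
      youngVec_eq_zero fun hs => hE ((isStd_glue_iff h _ _).mp hs).2]

theorem gluePair_youngS {i i' : Fin m} (hi : (i' : ℕ) = i + 1)
    (v : YoungSpace (skewBoxes lam mu) n) (x : YoungSpace mu.boxes m) :
    gluePair h v (youngS mu.boxes i i' x) =
      youngS lam.boxes (Fin.castAdd n i) (Fin.castAdd n i') (gluePair h v x) := by
  have : (gluePair h).compl₂ (youngS mu.boxes i i') = (gluePair (n := n) h).compr₂
      (youngS lam.boxes (Fin.castAdd n i) (Fin.castAdd n i')) := by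
    refine young_ext fun T => young_ext fun S => ?_
    rw [LinearMap.compl₂_apply, LinearMap.compr₂_apply, gluePair_apply,
      partYoungS_apply mu hi,
      partYoungS_apply lam (i := Fin.castAdd n i) (i' := Fin.castAdd n i') (by simpa using hi)]
    rw [flab_glue_castAdd, flab_glue_castAdd, map_add, map_smul, map_smul, gluePair_apply,
      gluePair_apply, glue_swap_castAdd]
  exact LinearMap.congr_fun (LinearMap.congr_fun this v) x

theorem gluePair_diag (i : Fin m) (g : ℂ × ZMod ℓ → ℂ)
    (v : YoungSpace (skewBoxes lam mu) n) (x : YoungSpace mu.boxes m) :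
    gluePair h v (diagOp mu.boxes m (fun F => g (flab F i)) x) =
      diagOp lam.boxes (m + n) (fun F => g (flab F (Fin.castAdd n i))) (gluePair h v x) := by
  have : (gluePair h).compl₂ (diagOp mu.boxes m fun F => g (flab F i)) = (gluePair (n := n) h).compr₂
      (diagOp lam.boxes (m + n) fun F => g (flab F (Fin.castAdd n i))) := by
    refine young_ext fun T => young_ext fun S => ?_
    rw [LinearMap.compl₂_apply, LinearMap.compr₂_apply, gluePair_apply, diagOp_apply, diagOp_apply,
      flab_glue_castAdd, map_smul, gluePair_apply]
  exact LinearMap.congr_fun (LinearMap.congr_fun this v) x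

theorem youngS_gluePair {i i' : Fin n} (hi : (i' : ℕ) = i + 1)
    (v : YoungSpace (skewBoxes lam mu) n) (x : YoungSpace mu.boxes m) :
    gluePair h (youngS (skewBoxes lam mu) i i' v) x =
      youngS lam.boxes (Fin.natAdd m i) (Fin.natAdd m i') (gluePair h v x) := by
  have : (gluePair h).comp (youngS (skewBoxes lam mu) i i') = (gluePair (m := m) h).compr₂
      (youngS lam.boxes (Fin.natAdd m i) (Fin.natAdd m i')) := by
    refine young_ext fun T => young_ext fun S => ?_
    rw [LinearMap.comp_apply, LinearMap.compr₂_apply, gluePair_apply,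
      skewYoungS_apply lam mu hi,
      partYoungS_apply lam (i := Fin.natAdd m i) (i' := Fin.natAdd m i')
        (by simp [hi, add_assoc])]
    rw [flab_glue_natAdd, flab_glue_natAdd, map_add, map_smul, map_smul, LinearMap.add_apply,
      LinearMap.smul_apply, LinearMap.smul_apply, gluePair_apply, gluePair_apply,
      glue_swap_natAdd]
  exact LinearMap.congr_fun (LinearMap.congr_fun this v) x

theorem diag_gluePair (i : Fin n) (g : ℂ × ZMod ℓ → ℂ)
    (v : YoungSpace (skewBoxes lam mu) n) (x : YoungSpace mu.boxes m) :
    gluePair h (diagOp (skewBoxes lam mu) n (fun F => g (flab F i)) v) x =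
      diagOp lam.boxes (m + n) (fun F => g (flab F (Fin.natAdd m i))) (gluePair h v x) := by
  have : (gluePair h).comp (diagOp (skewBoxes lam mu) n fun F => g (flab F i)) =
      (gluePair (m := m) h).compr₂
        (diagOp lam.boxes (m + n) fun F => g (flab F (Fin.natAdd m i))) := by
    refine young_ext fun T => young_ext fun S => ?_
    rw [LinearMap.comp_apply, LinearMap.compr₂_apply, gluePair_apply, diagOp_apply, diagOp_apply,
      flab_glue_natAdd, map_smul, LinearMap.smul_apply, gluePair_apply]
  exact LinearMap.congr_fun (LinearMap.congr_fun this v) x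

include hζ in
theorem gluePair_mem (v : YoungSpace (skewBoxes lam mu) n) :
    gluePair h v ∈ SkewHom ζ lam mu m n := by
  intro g
  induction g using group_induction with
  | h1 => rw [map_one, map_one, map_one]; rfl
  | hmul g g' hg hg' =>
    rw [map_mul, map_mul, map_mul, Module.End.mul_eq_comp, Module.End.mul_eq_comp,
      ← LinearMap.comp_assoc, hg, LinearMap.comp_assoc, hg', LinearMap.comp_assoc]
  | hs i i' hi =>
    rw [gMap_s, specht_s hζ mu hi, Fin.castAddEmb_apply, Fin.castAddEmb_apply,
      specht_s hζ lam (by simpa using hi)]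
    exact LinearMap.ext fun x => gluePair_youngS h hi v x
  | hz i c =>
    rw [gMap_zetaPow, specht_zetaPow hζ, specht_zetaPow hζ]
    exact LinearMap.ext fun x => gluePair_diag h i (fun a => chi hζ (c * a.2)) v x

/-- The map from the space with basis the standard tableaux on `λ∖μ` to `S^{λ∖μ}`. -/
def glueHom : YoungSpace (skewBoxes lam mu) n →ₗ[ℂ] SkewHom ζ lam mu m n :=
  (gluePair h).codRestrict _ fun v => gluePair_mem hζ h v

/-- The action of `H_{ℓ,n}` on the space with basis the standard tableaux on `λ∖μ`. -/
def skewYoungAct (lam mu : MultiPartition ℓ) (n : ℕ) :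
    H ℓ n →ₐ[ℂ] Module.End ℂ (YoungSpace (skewBoxes lam mu) n) :=
  youngAct hζ (skewShape lam mu) n

theorem skewYoungAct_u (i : Fin n) :
    skewYoungAct hζ lam mu n (u ℓ i) = youngU (skewBoxes lam mu) i :=
  youngAct_u hζ (skewShape lam mu) i

theorem skewYoungAct_s {i i' : Fin n} (hi : (i' : ℕ) = i + 1) :
    skewYoungAct hζ lam mu n (gp (s i i')) = youngS (skewBoxes lam mu) i i' :=
  (youngAct_gp hζ (skewShape lam mu) _).trans (youngRep_s hζ (skewShape lam mu) hi)

theorem skewYoungAct_zetaPow (i : Fin n) (c : ZMod ℓ) :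
    skewYoungAct hζ lam mu n (gp (zetaPow i c)) =
      diagOp (skewBoxes lam mu) n fun F => chi hζ (c * (flab F i).2) :=
  (youngAct_gp hζ (skewShape lam mu) _).trans (youngRep_zetaPow hζ (skewShape lam mu) i c)

theorem skewAct_glueHom (a : H ℓ n) (v : YoungSpace (skewBoxes lam mu) n) :
    skewAct ζ lam mu m n a (glueHom hζ h v) =
      glueHom hζ h (skewYoungAct hζ lam mu n a v) := by
  let S : Subalgebra ℂ (H ℓ n) :=
    { carrier := {a | ∀ v, skewAct ζ lam mu m n a (glueHom hζ h v) =
        glueHom hζ h (skewYoungAct hζ lam mu n a v)}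
      mul_mem' := fun {a b} ha hb v => by
        rw [map_mul, map_mul, Module.End.mul_apply, hb v, ha, Module.End.mul_apply]
      add_mem' := fun {a b} ha hb v => by
        rw [map_add, map_add, LinearMap.add_apply, hb v, ha, LinearMap.add_apply, map_add]
      algebraMap_mem' := fun r v => by
        rw [AlgHom.commutes, AlgHom.commutes, Module.algebraMap_end_apply,
          Module.algebraMap_end_apply, map_smul] }
  have : S = ⊤ := by
    have hact : ∀ (a : H ℓ n) (f : SkewHom ζ lam mu m n), (skewAct ζ lam mu m n a f).1 =
      (specht ζ lam (m + n)).asAlgebraHom (toGroupAlg ℓ m n a) ∘ₗ f.1 := fun _ _ => rfl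
    have hgp : ∀ g : G ℓ n, toGroupAlg ℓ m n (gp g) =
        MonoidAlgebra.of ℂ (G ℓ (m + n)) (gMap ℓ (Fin.natAddEmb m) g) := fun g => by
      rw [toGroupAlg, gp, freeG, liftH_mkH, FreeAlgebra.lift_ι_apply]; rfl
    refine subalgebra_eq_top S (fun i v => ?_) (fun i i' hi v => ?_) (fun i c v => ?_)
    · refine Subtype.ext (LinearMap.ext fun x => ?_)
      have e : toGroupAlg ℓ m n (u ℓ i) = phi (Fin.natAdd m i) := by
        rw [toGroupAlg, u, freeU, liftH_mkH, FreeAlgebra.lift_ι_apply]; rfl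
      rw [hact, e, specht_phi hζ, skewYoungAct_u]
      exact (diag_gluePair h i (fun a => ℓ * a.1) v x).symm
    · refine Subtype.ext (LinearMap.ext fun x => ?_)
      rw [hact, hgp, Representation.asAlgebraHom_of, gMap_s, Fin.natAddEmb_apply,
        Fin.natAddEmb_apply, specht_s hζ lam (by simp [hi, add_assoc]), skewYoungAct_s hζ hi]
      exact (youngS_gluePair h hi v x).symm
    · refine Subtype.ext (LinearMap.ext fun x => ?_)
      rw [hact, hgp, Representation.asAlgebraHom_of, gMap_zetaPow, specht_zetaPow hζ,
        skewYoungAct_zetaPow]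
      exact (diag_gluePair h i (fun a => chi hζ (c * a.2)) v x).symm
  have ha : a ∈ S := this ▸ trivial
  exact ha v

/-- Evaluation at a single v_S sends the basis vectors to different basis vectors of S^λ. -/
theorem glueHom_injective (S : SYT mu.boxes m) :
    Function.Injective (glueHom (m := m) (n := n) hζ h) := by
  have hli : LinearIndependent ℂ fun T : SYT (skewBoxes lam mu) n =>
      (youngVec (glue h S.fill T.fill) : YoungSpace lam.boxes (m + n)) := by
    have hstd : ∀ T : SYT (skewBoxes lam mu) n, IsStd (glue h S.fill T.fill) := fun T =>
      (isStd_glue_iff h _ _).mpr ⟨S.isStd_fill, T.isStd_fill⟩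
    have := (youngBasis lam.boxes (m + n)).linearIndependent.comp
      (fun T : SYT (skewBoxes lam mu) n => (⟨_, hstd T⟩ : SYT lam.boxes (m + n)))
      (fun T T' he => Subtype.ext (glue_injective h S.fill (congrArg SYT.fill he)))
    convert this using 1
    funext T
    exact youngVec_std (⟨_, hstd T⟩ : SYT lam.boxes (m + n))
  rw [injective_iff_map_eq_zero]
  intro v hv
  have h0 : gluePair h v (youngVec S.fill) = 0 := by
    have : gluePair h v = 0 := congrArg Subtype.val hv
    rw [this, LinearMap.zero_apply]
  have hrepr := (youngBasis (skewBoxes lam mu) n).linearCombination_repr v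
  rw [← hrepr, Finsupp.linearCombination_apply, Finsupp.sum, map_sum, LinearMap.sum_apply] at h0
  simp only [map_smul, LinearMap.smul_apply, ← youngVec_std, gluePair_apply] at h0
  have := linearIndependent_iff.mp hli ((youngBasis (skewBoxes lam mu) n).repr v) h0
  exact (LinearEquiv.map_eq_zero_iff _).mp this

/-- The embedding of G(ℓ,1,m) keeps the indices and there are no further indices below i, so it
carries a Jucys-Murphy element to the one with the same index. -/
theorem skewHom_phi (f : SkewHom ζ lam mu m n) (i : Fin m) (x : YoungSpace mu.boxes m) :
    f.1 ((specht ζ mu m).asAlgebraHom (phi i) x) =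
      (specht ζ lam (m + n)).asAlgebraHom (phi (Fin.castAdd n i)) (f.1 x) := by
  have hg : ∀ g x, f.1 (specht ζ mu m g x) =
      specht ζ lam (m + n) (gMap ℓ (Fin.castAddEmb n) g) (f.1 x) :=
    fun g x => LinearMap.congr_fun (f.2 g) x
  have hI : Finset.Iio (Fin.castAdd n i) = (Finset.Iio i).map (Fin.castAddEmb n) := by
    ext x
    simp only [Finset.mem_Iio, Finset.mem_map, Fin.castAddEmb_apply]
    constructor
    · intro hx
      have : (x : ℕ) < i := hx
      exact ⟨⟨x, by omega⟩, this, rfl⟩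
    · rintro ⟨y, hy, rfl⟩
      exact hy
  rw [phi, phi, hI, Finset.sum_map]
  simp only [reflSum, map_sum, LinearMap.sum_apply, Representation.asAlgebraHom_of, hg]
  simp only [map_mul, gMap_zetaPow, gMap_s, Fin.castAddEmb_apply]

include hζ in
-- An equivariant map is determined by its value at one v_S, since admissible exchanges lead from S
-- to all tableaux.
theorem skewHom_swap (f : SkewHom ζ lam mu m n) {i i' : Fin m} (hi : (i' : ℕ) = i + 1)
    (F : mu.boxes ≃ Fin m) (hne : xLab (flab F i) (flab F i') ≠ 0) :
    f.1 (youngVec (F.trans (Equiv.swap i i'))) = (xLab (flab F i) (flab F i'))⁻¹ •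
      (youngS lam.boxes (Fin.castAdd n i) (Fin.castAdd n i') (f.1 (youngVec F)) -
        eLab (flab F i) (flab F i') • f.1 (youngVec F)) := by
  have hS := LinearMap.congr_fun (f.2 (s i i')) (youngVec F)
  rw [LinearMap.comp_apply, LinearMap.comp_apply, gMap_s, specht_s hζ mu hi, Fin.castAddEmb_apply,
    Fin.castAddEmb_apply, specht_s hζ lam (by simpa using hi)] at hS
  rw [← hS, partYoungS_apply mu hi, map_add, map_smul, map_smul, add_sub_cancel_left, smul_smul,
    inv_mul_cancel₀ hne, one_smul]

/-- The value f(v_S) is an eigenvector of φ_i and ζ_i for i ≤ m with the labels of S. So it involves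
only tableaux on λ that restrict to S on μ, and these are glued from S and tableaux on λ∖μ. The
other values of f follow by exchanges. -/
theorem glueHom_surjective (hm : Nonempty (SYT mu.boxes m)) :
    Function.Surjective (glueHom (m := m) (n := n) hζ h) := by
  intro f
  obtain ⟨S⟩ := hm
  obtain ⟨v, hv⟩ : ∃ v, gluePair h v (youngVec S.fill) = f.1 (youngVec S.fill) := by
    suffices f.1 (youngVec S.fill) ∈ LinearMap.range
        ((gluePair (n := n) h).flip (youngVec S.fill)) from this
    set y := f.1 (youngVec S.fill) with hy
    have hyu : ∀ i : Fin m, youngU lam.boxes (Fin.castAdd n i) y = (ℓ * (S.wt i).1) • y := by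
      intro i
      have := skewHom_phi f i (youngVec S.fill)
      rw [specht_phi hζ, specht_phi hζ, youngU, diagOp_apply, map_smul] at this
      exact this.symm
    have hyz : ∀ i : Fin m, diagOp lam.boxes (m + n)
        (fun F => chi hζ (1 * (flab F (Fin.castAdd n i)).2)) y = chi hζ (1 * (S.wt i).2) • y := by
      intro i
      have := LinearMap.congr_fun (f.2 (zetaPow i 1)) (youngVec S.fill)
      rw [LinearMap.comp_apply, LinearMap.comp_apply, gMap_zetaPow, specht_zetaPow hζ,
        specht_zetaPow hζ, diagOp_apply, map_smul] at this
      exact this.symm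
    have hrepr : ∀ (g : (lam.boxes ≃ Fin (m + n)) → ℂ) (T : SYT lam.boxes (m + n)),
        (youngBasis lam.boxes (m + n)).repr (diagOp lam.boxes (m + n) g y) T =
          g T.fill * (youngBasis lam.boxes (m + n)).repr y T := by
      intro g T
      have : (youngBasis lam.boxes (m + n)).coord T ∘ₗ diagOp lam.boxes (m + n) g =
          g T.fill • (youngBasis lam.boxes (m + n)).coord T := by
        refine (youngBasis lam.boxes (m + n)).ext fun T' => ?_
        rw [LinearMap.comp_apply, ← youngVec_std, diagOp_apply, youngVec_std, map_smul,
          LinearMap.smul_apply, Module.Basis.coord_apply, Module.Basis.repr_self, smul_eq_mul,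
          smul_eq_mul]
        by_cases hT : T' = T
        · rw [hT]
        · rw [Finsupp.single_eq_of_ne (Ne.symm hT), mul_zero, mul_zero]
      exact LinearMap.congr_fun this y
    rw [← (youngBasis lam.boxes (m + n)).linearCombination_repr y, Finsupp.linearCombination_apply]
    refine Submodule.sum_mem _ fun T hT => Submodule.smul_mem _ _ ?_
    rw [Finsupp.mem_support_iff] at hT
    have hwt : ∀ i : Fin m, (T.box (Fin.castAdd n i)).lab = (S.box i).lab := by
      intro i
      have e1 := congrArg (fun v => (youngBasis lam.boxes (m + n)).repr v T) (hyu i)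
      have e2 := congrArg (fun v => (youngBasis lam.boxes (m + n)).repr v T) (hyz i)
      simp only [youngU, hrepr, map_smul, Finsupp.smul_apply, smul_eq_mul, mul_left_inj' hT,
        mul_right_inj' (NeZero.ne (ℓ : ℂ)), one_mul, chi_apply] at e1 e2
      exact Prod.ext e1 (chi_injective hζ e2)
    have hbox := SYT.box_eq_of_wt_eq (D := partShape lam) (S := mu.boxes) (boxes_mono h)
      (fun b hb c hc hbc => mem_boxes_of_le hb hc hbc) (Nat.le_add_right m n) T S hwt
    obtain ⟨E, hE⟩ := exists_eq_glue h T S hbox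
    refine ⟨youngVec E, ?_⟩
    rw [LinearMap.flip_apply, gluePair_apply, ← hE, youngVec_std]
  refine ⟨v, Subtype.ext (young_ext fun T => ?_)⟩
  change gluePair h v (youngVec T.fill) = f.1 (youngVec T.fill)
  induction T using SYT.swap_induction (D := partShape mu) S with
  | h0 => exact hv
  | hs T i i' hi hstd ih =>
    have hne : xLab (flab T.fill i) (flab T.fill i') ≠ 0 :=
      xLab_ne_zero ((T.isStd_swap_iff hi).mp hstd)
    have k1 := skewHom_swap hζ f hi T.fill hne
    have k2 := skewHom_swap hζ (glueHom hζ h v) hi T.fill hne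
    exact k2.trans ((congrArg (fun y => (xLab (flab T.fill i) (flab T.fill i'))⁻¹ •
      (youngS lam.boxes (Fin.castAdd n i) (Fin.castAdd n i') y -
        eLab (flab T.fill i) (flab T.fill i') • y)) ih).trans k1.symm)

include h in
/-- The standard tableaux on `λ∖μ` form a basis of `S^{λ∖μ}`, on which `H_{ℓ,n}` acts by the
formulas of Young's seminormal form. -/
theorem exists_skewHom_equiv (hm : mu.size = m) :
    ∃ Θ : YoungSpace (skewBoxes lam mu) n ≃ₗ[ℂ] SkewHom ζ lam mu m n,
      ∀ a v, skewAct ζ lam mu m n a (Θ v) = Θ (skewYoungAct hζ lam mu n a v) := by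
  have hne : Nonempty (SYT mu.boxes m) :=
    exists_SYT _ (boxes_finite mu) ((ncard_boxes mu).trans hm)
  exact ⟨LinearEquiv.ofBijective (glueHom hζ h)
    ⟨glueHom_injective hζ h hne.some, glueHom_surjective hζ h hne⟩, skewAct_glueHom hζ h⟩

end


/-! ### Block embeddings and twists on generators -/

section

variable {ℓ : ℕ} [NeZero ℓ]

theorem blockHom_u {a b o : ℕ} (h : o + a ≤ b) (i : Fin a) :
    blockHom ℓ o h (u ℓ i) = u ℓ (shift o h i) := by
  rw [blockHom, u, liftH_mkH, freeU, FreeAlgebra.lift_ι_apply]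
  rfl

theorem blockHom_gp {a b o : ℕ} (h : o + a ≤ b) (g : G ℓ a) :
    blockHom ℓ o h (gp g) = gp (gMap ℓ (shift o h) g) := by
  rw [blockHom, gp, liftH_mkH, freeG, FreeAlgebra.lift_ι_apply]
  rfl

theorem twist_u {n : ℕ} (κ : ℂ) (i : Fin n) :
    twist ℓ n κ (u ℓ i) = u ℓ i + algebraMap ℂ _ κ := by
  rw [twist, u, liftH_mkH, freeU, FreeAlgebra.lift_ι_apply]
  rfl

theorem twist_gp {n : ℕ} (κ : ℂ) (g : G ℓ n) : twist ℓ n κ (gp g) = gp g := by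
  rw [twist, gp, liftH_mkH, freeG, FreeAlgebra.lift_ι_apply]
  rfl

end

/-! ### Blocks of indices and shuffles -/

section

variable {k : ℕ} {n : Fin k → ℕ} {N : ℕ} (hN : ∑ i, n i = N)

/-- The embedding of the `i`-th block of indices. -/
def block (i : Fin k) : Fin (n i) ↪ Fin N := shift _ (offset_add_le hN i)

theorem block_val (i : Fin k) (j : Fin (n i)) :
    (block hN i j : ℕ) = ∑ j ∈ Finset.Iio i, n j + j := rfl

theorem block_strictMono (i : Fin k) : StrictMono (block hN i) := fun j j' h => by
  rw [Fin.lt_def, block_val, block_val]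
  have : (j : ℕ) < j' := h
  omega

/-- The decomposition of the set of indices into consecutive blocks. -/
def blockEquiv : (Σ i, Fin (n i)) ≃ Fin N :=
  Equiv.ofBijective (fun p => block hN p.1 p.2) (by
    rw [Fintype.bijective_iff_injective_and_card]
    have hlt : ∀ p p' : Σ i, Fin (n i), p.1 < p'.1 →
        (block hN p.1 p.2 : ℕ) < block hN p'.1 p'.2 := by
      intro p p' hp
      have h1 : ∑ j ∈ Finset.Iio p.1, n j + n p.1 ≤ ∑ j ∈ Finset.Iio p'.1, n j := by
        rw [add_comm, ← Finset.sum_insert (by simp)]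
        refine Finset.sum_le_sum_of_subset fun x hx => ?_
        rw [Finset.mem_insert, Finset.mem_Iio] at hx
        rw [Finset.mem_Iio]
        rcases hx with rfl | hx
        · exact hp
        · exact hx.trans hp
      have h2 := p.2.2
      rw [block_val, block_val]
      omega
    refine ⟨fun p p' h => ?_, by simp [hN]⟩
    obtain ⟨i, j⟩ := p
    obtain ⟨i', j'⟩ := p'
    have h' := congrArg Fin.val h
    rcases lt_trichotomy i i' with hi | rfl | hi
    · exact absurd h' (hlt ⟨i, j⟩ ⟨i', j'⟩ hi).ne
    · exact congrArg _ ((block hN i).injective h)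
    · exact absurd h' (hlt ⟨i', j'⟩ ⟨i, j⟩ hi).ne')

theorem exists_block (x : Fin N) : ∃ i j, block hN i j = x :=
  ⟨_, _, (blockEquiv hN).apply_symm_apply x⟩

theorem block_inj {i i' : Fin k} {j : Fin (n i)} {j' : Fin (n i')}
    (h : block hN i j = block hN i' j') : (⟨i, j⟩ : Σ i, Fin (n i)) = ⟨i', j'⟩ :=
  (blockEquiv hN).injective h

/-- The permutations that are increasing on each block: the minimal representatives of the left
cosets of the Young subgroup. -/
def IsShuffle (w : Equiv.Perm (Fin N)) : Prop := ∀ i, StrictMono fun j => w (block hN i j)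

/-- Multiplying a shuffle by an adjacent transposition gives a shuffle, or amounts to a transposition
of adjacent elements of one block. -/
theorem IsShuffle.swap_mul {w : Equiv.Perm (Fin N)} (hw : IsShuffle hN w) {a a' : Fin N}
    (ha : (a' : ℕ) = a + 1) : IsShuffle hN (Equiv.swap a a' * w) ∨
      ∃ (i : Fin k) (j j' : Fin (n i)), (j' : ℕ) = j + 1 ∧
        Equiv.swap a a' * w = w * Equiv.swap (block hN i j) (block hN i j') := by
  -- If a and a + 1 come from one block, their preimages are consecutive in it, because w is
  -- increasing there. Otherwise no order inside a block is affected by the exchange.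
  by_cases h : ∃ (i : Fin k) (j j' : Fin (n i)), w (block hN i j) = a ∧ w (block hN i j') = a'
  · right
    obtain ⟨i, j, j', rfl, rfl⟩ := h
    refine ⟨i, j, j', ?_, Equiv.swap_mul_eq_mul_swap _ _ _ |>.trans ?_⟩
    · have h1 : j < j' := by
        rw [← (hw i).lt_iff_lt, Fin.lt_def]
        omega
      by_contra h2
      have h1 : (j : ℕ) < j' := h1
      have h3 := hw i (show j < ⟨j + 1, by omega⟩ from Nat.lt_succ_self _)
      have h4 := hw i (show (⟨j + 1, by omega⟩ : Fin (n i)) < j' from by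
        rw [Fin.lt_def]
        change (j : ℕ) + 1 < j'
        omega)
      rw [Fin.lt_def] at h3 h4
      simp only at h3 h4
      omega
    · simp
  · left
    intro i j j' hj
    have h1 := hw i hj
    have h2 : ¬ (w (block hN i j) = a ∧ w (block hN i j') = a') := fun e => h ⟨i, j, j', e⟩
    simp only [Equiv.Perm.mul_apply] at h1 ⊢
    generalize w (block hN i j) = x at h1 h2
    generalize w (block hN i j') = y at h1 h2
    rw [Equiv.swap_apply_def, Equiv.swap_apply_def]
    simp only [Fin.lt_def, Fin.ext_iff] at *
    split_ifs <;> omega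

end

/-! ### Spanning sets and universal property of induced modules -/

section

variable {ℓ : ℕ} [NeZero ℓ] {k : ℕ} {n : Fin k → ℕ} {N : ℕ} (hN : ∑ i, n i = N)
  {W : Fin k → Type} [∀ i, AddCommGroup (W i)] [∀ i, Module ℂ (W i)]
  (A : ∀ i, H ℓ (n i) →ₐ[ℂ] Module.End ℂ (W i))

/-- The map `x ↦ 1 ⊗ x` to the induced module. -/
def indUnit : PiTensorProduct ℂ W →ₗ[ℂ] Ind hN A :=
  ((indRel hN A).mkQ.restrictScalars ℂ) ∘ₗ TensorProduct.mk ℂ (H ℓ N) (PiTensorProduct ℂ W) 1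

theorem indUnit_apply (x : PiTensorProduct ℂ W) :
    indUnit hN A x = Submodule.Quotient.mk (TensorProduct.tmul ℂ 1 x) := rfl

theorem smul_indUnit (h : H ℓ N) (x : PiTensorProduct ℂ W) :
    h • indUnit hN A x = Submodule.Quotient.mk (TensorProduct.tmul ℂ h x) := by
  rw [indUnit_apply, ← Submodule.Quotient.mk_smul, TensorProduct.smul_tmul', smul_eq_mul, mul_one]

theorem blockHom_smul_indUnit (i : Fin k) (h : H ℓ (n i)) (x : PiTensorProduct ℂ W) :
    blockHom ℓ _ (offset_add_le hN i) h • indUnit hN A x =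
      indUnit hN A (PiTensorProduct.map (Function.update (fun _ => LinearMap.id) i (A i h)) x) := by
  rw [smul_indUnit, indUnit_apply, Submodule.Quotient.eq]
  exact Submodule.subset_span ⟨i, h, x, rfl⟩

/-- The span of the vectors `w ⊗ x` with `w` in a set of permutations. -/
def permSpan (C : Set (Equiv.Perm (Fin N))) : Submodule ℂ (Ind hN A) :=
  Submodule.span ℂ {t | ∃ w ∈ C, ∃ x, t = (gp (SemidirectProduct.inr w) : H ℓ N) • indUnit hN A x}

variable {hN A} {C : Set (Equiv.Perm (Fin N))}

theorem mem_permSpan {w : Equiv.Perm (Fin N)} (hw : w ∈ C) (x : PiTensorProduct ℂ W) :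
    (gp (SemidirectProduct.inr w) : H ℓ N) • indUnit hN A x ∈ permSpan hN A C :=
  Submodule.subset_span ⟨w, hw, x, rfl⟩

theorem smul_permSpan {h : H ℓ N} (H : ∀ w ∈ C, ∀ x,
    h • (gp (SemidirectProduct.inr w) : SkewHecke.H ℓ N) • indUnit hN A x ∈ permSpan hN A C)
    {y : Ind hN A} (hy : y ∈ permSpan hN A C) : h • y ∈ permSpan hN A C := by
  induction hy using Submodule.span_induction with
  | mem y hy =>
    obtain ⟨w, hw, x, rfl⟩ := hy
    exact H w hw x
  | zero => rw [smul_zero]; exact zero_mem _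
  | add y y' _ _ hy hy' => rw [smul_add]; exact add_mem hy hy'
  | smul c y _ hy => rw [smul_comm]; exact Submodule.smul_mem _ _ hy

theorem zetaPow_smul_permSpan (i : Fin N) (c : ZMod ℓ) {y : Ind hN A}
    (hy : y ∈ permSpan hN A C) : (gp (zetaPow i c) : H ℓ N) • y ∈ permSpan hN A C := by
  refine smul_permSpan (fun w hw x => ?_) hy
  obtain ⟨a, j, hj⟩ := exists_block hN (w⁻¹ i)
  have e : (zetaPow i c * SemidirectProduct.inr w : G ℓ N) =
      SemidirectProduct.inr w * gMap ℓ (block hN a) (zetaPow j c) := by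
    rw [gMap_zetaPow, hj]
    refine SemidirectProduct.ext (funext fun x => ?_) ?_
    · change (Pi.mulSingle i (Multiplicative.ofAdd c) : Fin N → Multiplicative (ZMod ℓ)) x * 1 =
        1 * (Pi.mulSingle (w⁻¹ i) (Multiplicative.ofAdd c) : Fin N → Multiplicative (ZMod ℓ))
          (w⁻¹ x)
      simp [Pi.mulSingle_apply]
    · simp [zetaPow]
  rw [← mul_smul, ← gp_mul, e, gp_mul, mul_smul, block, ← blockHom_gp, blockHom_smul_indUnit]
  exact mem_permSpan hw _

/-- If the transposition leads out of C, it can be moved to the right of w, where it lies in the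
Young subgroup and is absorbed by a tensor factor. -/
theorem s_smul_permSpan {i i' : Fin N}
    (hC : ∀ w ∈ C, Equiv.swap i i' * w ∈ C ∨ ∃ (a : Fin k) (j j' : Fin (n a)),
      Equiv.swap i i' * w = w * Equiv.swap (block hN a j) (block hN a j'))
    {y : Ind hN A} (hy : y ∈ permSpan hN A C) : (gp (s i i') : H ℓ N) • y ∈ permSpan hN A C := by
  refine smul_permSpan (fun w hw x => ?_) hy
  rw [← mul_smul, ← gp_mul, s, ← map_mul]
  obtain h | ⟨a, j, j', e⟩ := hC w hw
  · exact mem_permSpan h x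
  · have := gMap_s (ℓ := ℓ) (block hN a) j j'
    rw [s] at this
    rw [e, map_mul, gp_mul, mul_smul]
    rw [s] at this
    rw [← this, block, ← blockHom_gp, blockHom_smul_indUnit]
    exact mem_permSpan hw _

theorem s_smul_permSpan_univ (i i' : Fin N) {y : Ind hN A}
    (hy : y ∈ permSpan hN A Set.univ) : (gp (s i i') : H ℓ N) • y ∈ permSpan hN A Set.univ :=
  s_smul_permSpan (fun _ _ => Or.inl (Set.mem_univ _)) hy

/-- Each relation moves u_i past the outermost letter of w at the cost of terms from the group,
which stay in the span. Once no letters are left, u_i acts through a tensor factor. -/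
theorem u_smul_permSpan_univ (i : Fin N) {y : Ind hN A}
    (hy : y ∈ permSpan hN A Set.univ) : u ℓ i • y ∈ permSpan hN A Set.univ := by
  refine smul_permSpan (fun w _ x => ?_) hy
  induction w using perm_induction generalizing i with
  | h1 =>
    rw [map_one, gp_one, one_smul]
    obtain ⟨a, j, rfl⟩ := exists_block hN i
    rw [block, ← blockHom_u, blockHom_smul_indUnit]
    simpa [gp_one] using mem_permSpan (A := A) (Set.mem_univ 1) _
  | hs a w ha ih =>
    obtain ⟨b, b', rfl, hb⟩ : ∃ b b' : Fin N, (b : ℕ) = a ∧ (b' : ℕ) = b + 1 :=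
      ⟨⟨a, by omega⟩, ⟨a + 1, ha⟩, rfl, rfl⟩
    have hv : (gp (SemidirectProduct.inr w) : H ℓ N) • indUnit hN A x ∈
        permSpan hN A Set.univ := mem_permSpan (Set.mem_univ _) _
    have hsum : ∀ {v : Ind hN A}, v ∈ permSpan hN A Set.univ →
        (∑ c : ZMod ℓ, (gp (zetaPow b c * zetaPow b' (-c)) : H ℓ N)) • v ∈
          permSpan hN A Set.univ := by
      intro v hv
      rw [Finset.sum_smul]
      refine Submodule.sum_mem _ fun c _ => ?_
      rw [gp_mul, mul_smul]
      exact zetaPow_smul_permSpan _ _ (zetaPow_smul_permSpan _ _ hv)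
    have hrel := s_u (ℓ := ℓ) b b' hb
    rw [adj_eq_swap b b' hb, map_mul, gp_mul, mul_smul]
    change u ℓ i • (gp (s b b') : H ℓ N) • _ ∈ _
    generalize hv' : (gp (SemidirectProduct.inr w) : H ℓ N) • indUnit hN A x = v at hv ih
    by_cases h1 : i = b
    · subst h1
      have e := congrArg (· • (gp (s i b') : H ℓ N) • v) hrel
      simp only [sub_smul, mul_smul, s_smul_s] at e
      rw [← s_smul_s (ℓ := ℓ) i b' (u ℓ i • _), e]
      exact s_smul_permSpan_univ _ _ (sub_mem (ih b' trivial) (hsum (s_smul_permSpan_univ _ _ hv)))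
    · by_cases h2 : i = b'
      · subst h2
        rw [eq_sub_iff_add_eq] at hrel
        rw [← mul_smul, ← hrel, add_smul, mul_smul]
        exact add_mem (s_smul_permSpan_univ _ _ (ih b trivial)) (hsum hv)
      · rw [← mul_smul, ← s_u_far b b' i hb h1 h2, mul_smul]
        exact s_smul_permSpan_univ _ _ (ih i trivial)

variable (hN A)

theorem permSpan_univ : permSpan hN A Set.univ = ⊤ := by
  rw [eq_top_iff]
  intro y _
  obtain ⟨t, rfl⟩ := Submodule.Quotient.mk_surjective _ y
  induction t using TensorProduct.induction_on with
  | zero => exact zero_mem _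
  | add t t' h h' => exact add_mem (h trivial) (h' trivial)
  | tmul h x =>
    rw [← smul_indUnit]
    refine submodule_stable _ (fun i y hy => u_smul_permSpan_univ i hy)
      (fun i i' _ y hy => s_smul_permSpan_univ i i' hy)
      (fun i c y hy => zetaPow_smul_permSpan i c hy) h ?_
    simpa [gp_one] using mem_permSpan (A := A) (Set.mem_univ 1) x

theorem permSpan_shuffle : permSpan hN A {w | IsShuffle hN w} = ⊤ := by
  rw [eq_top_iff, ← permSpan_univ hN A, permSpan, Submodule.span_le]
  rintro _ ⟨w, -, x, rfl⟩
  induction w using perm_induction with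
  | h1 => exact mem_permSpan (C := {w | IsShuffle hN w}) (w := 1) (fun i => block_strictMono hN i) x
  | hs a w ha ih =>
    obtain ⟨b, b', rfl, hb⟩ : ∃ b b' : Fin N, (b : ℕ) = a ∧ (b' : ℕ) = b + 1 :=
      ⟨⟨a, by omega⟩, ⟨a + 1, ha⟩, rfl, rfl⟩
    rw [adj_eq_swap b b' hb, map_mul, gp_mul, mul_smul]
    refine s_smul_permSpan (fun w hw => ?_) ih
    obtain h | ⟨i, j, j', -, h⟩ := IsShuffle.swap_mul hN hw hb
    · exact Or.inl h
    · exact Or.inr ⟨i, j, j', h⟩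

/-- The induced module is spanned by the `w ⊗ b`, for `w` a shuffle and `b` in a basis. -/
theorem span_shuffle {κ : Type*} (b : Module.Basis κ ℂ (PiTensorProduct ℂ W)) :
    Submodule.span ℂ (Set.range fun p : {w // IsShuffle hN w} × κ =>
      (gp (SemidirectProduct.inr p.1.1) : H ℓ N) • indUnit hN A (b p.2)) = ⊤ := by
  rw [eq_top_iff, ← permSpan_shuffle hN A, permSpan, Submodule.span_le]
  rintro _ ⟨w, hw, x, rfl⟩
  have hx : x ∈ Submodule.span ℂ (Set.range b) := b.mem_span x
  induction hx using Submodule.span_induction with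
  | mem y hy =>
    obtain ⟨t, rfl⟩ := hy
    exact Submodule.subset_span ⟨⟨⟨w, hw⟩, t⟩, rfl⟩
  | zero => rw [map_zero, smul_zero]; exact zero_mem _
  | add y y' _ _ hy hy' => rw [map_add, smul_add]; exact add_mem hy hy'
  | smul c y _ hy => rw [map_smul, smul_comm]; exact Submodule.smul_mem _ _ hy

/-- The universal property of the induced module. -/
theorem exists_indLift {Y : Type*} [AddCommGroup Y] [Module ℂ Y] [Module (H ℓ N) Y]
    [IsScalarTower ℂ (H ℓ N) Y] (φ : PiTensorProduct ℂ W →ₗ[ℂ] Y)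
    (hφ : ∀ i h x, φ (PiTensorProduct.map (Function.update (fun _ => LinearMap.id) i (A i h)) x) =
      blockHom ℓ _ (offset_add_le hN i) h • φ x) :
    ∃ Φ : Ind hN A →ₗ[H ℓ N] Y, ∀ x, Φ (indUnit hN A x) = φ x := by
  refine ⟨(indRel hN A).liftQ (TensorProduct.AlgebraTensorModule.lift
    (LinearMap.toSpanSingleton (H ℓ N) (PiTensorProduct ℂ W →ₗ[ℂ] Y) φ)) ?_, fun x => ?_⟩
  · rw [indRel, Submodule.span_le]
    rintro _ ⟨i, h, x, rfl⟩
    rw [SetLike.mem_coe, LinearMap.mem_ker, map_sub, TensorProduct.AlgebraTensorModule.lift_tmul,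
      TensorProduct.AlgebraTensorModule.lift_tmul, LinearMap.toSpanSingleton_apply,
      LinearMap.toSpanSingleton_apply, one_smul, hφ, LinearMap.smul_apply, sub_self]
  · change TensorProduct.AlgebraTensorModule.lift
      (LinearMap.toSpanSingleton (H ℓ N) (PiTensorProduct ℂ W →ₗ[ℂ] Y) φ)
      (TensorProduct.tmul ℂ (1 : H ℓ N) x) = φ x
    rw [TensorProduct.AlgebraTensorModule.lift_tmul, LinearMap.toSpanSingleton_apply, one_smul]

/-- It suffices to check on generators that a map is compatible with the actions. -/
theorem intertwine_of_generators {Y : Type*} [AddCommGroup Y] [Module ℂ Y] [Module (H ℓ N) Y]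
    [IsScalarTower ℂ (H ℓ N) Y] (φ : PiTensorProduct ℂ W →ₗ[ℂ] Y) (i : Fin k)
    (hu : ∀ j x, φ (PiTensorProduct.map
      (Function.update (fun _ => LinearMap.id) i (A i (u ℓ j))) x) = u ℓ (block hN i j) • φ x)
    (hs : ∀ j j' : Fin (n i), (j' : ℕ) = j + 1 → ∀ x, φ (PiTensorProduct.map
      (Function.update (fun _ => LinearMap.id) i (A i (gp (s j j')))) x) =
        (gp (s (block hN i j) (block hN i j')) : H ℓ N) • φ x)
    (hz : ∀ j c x, φ (PiTensorProduct.map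
      (Function.update (fun _ => LinearMap.id) i (A i (gp (zetaPow j c)))) x) =
        (gp (zetaPow (block hN i j) c) : H ℓ N) • φ x) (h : H ℓ (n i)) (x : PiTensorProduct ℂ W) :
    φ (PiTensorProduct.map (Function.update (fun _ => LinearMap.id) i (A i h)) x) =
      blockHom ℓ _ (offset_add_le hN i) h • φ x := by
  let S : Subalgebra ℂ (H ℓ (n i)) :=
    { carrier := {h | ∀ x,
        φ (PiTensorProduct.map (Function.update (fun _ => LinearMap.id) i (A i h)) x) =
          blockHom ℓ _ (offset_add_le hN i) h • φ x}
      mul_mem' {a b} ha hb x := by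
        have e : Function.update (fun j => (LinearMap.id : W j →ₗ[ℂ] W j)) i (A i (a * b)) =
            fun j => Function.update (fun j => (LinearMap.id : W j →ₗ[ℂ] W j)) i (A i a) j ∘ₗ
              Function.update (fun j => (LinearMap.id : W j →ₗ[ℂ] W j)) i (A i b) j := by
          funext j
          by_cases hj : j = i
          · subst hj
            rw [Function.update_self, Function.update_self, Function.update_self, map_mul]
            rfl
          · rw [Function.update_of_ne hj, Function.update_of_ne hj, Function.update_of_ne hj]
            rfl
        rw [e, PiTensorProduct.map_comp, LinearMap.comp_apply, ha, hb, map_mul, mul_smul]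
      add_mem' {a b} ha hb x := by
        rw [map_add, PiTensorProduct.map_update_add, LinearMap.add_apply, map_add, ha, hb, map_add,
          add_smul]
      algebraMap_mem' c x := by
        have e : Function.update (fun j => (LinearMap.id : W j →ₗ[ℂ] W j)) i 1 =
            fun j => LinearMap.id := Function.update_eq_self_iff.mpr rfl
        rw [AlgHom.commutes, AlgHom.commutes, Algebra.algebraMap_eq_smul_one,
          PiTensorProduct.map_update_smul, e, PiTensorProduct.map_id, algebraMap_smul,
          LinearMap.smul_apply, map_smul]
        rfl }
  have hS : S = ⊤ := by
    refine subalgebra_eq_top S (fun j x => ?_) (fun j j' hj x => ?_) fun j c x => ?_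
    · rw [blockHom_u]
      exact hu j x
    · rw [blockHom_gp, gMap_s]
      exact hs j j' hj x
    · rw [blockHom_gp, gMap_zetaPow]
      exact hz j c x
  exact (hS ▸ Algebra.mem_top : h ∈ S) x

end


/-! ### Concatenation of tableaux on the components -/

instance {ℓ n : ℕ} (S : Set (Box ℓ)) : Finite (SYT S n) :=
  inferInstanceAs (Finite {T : S ≃ Fin n // ∀ b c : S, b.1.le c.1 → T b ≤ T c})

theorem finite_skewBoxes {ℓ : ℕ} [NeZero ℓ] (lam mu : MultiPartition ℓ) :
    (skewBoxes lam mu).Finite :=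
  (boxes_finite lam).subset Set.sdiff_subset

theorem eLab_add {ℓ : ℕ} (a b : ℂ × ZMod ℓ) (c : ℂ) :
    eLab (a.1 + c, a.2) (b.1 + c, b.2) = eLab a b := by
  rw [eLab, eLab, add_sub_add_right_eq_sub]

theorem xLab_add {ℓ : ℕ} (a b : ℂ × ZMod ℓ) (c : ℂ) :
    xLab (a.1 + c, a.2) (b.1 + c, b.2) = xLab a b := by
  rw [xLab, xLab, eLab_add]

section

variable {ℓ : ℕ} [NeZero ℓ] {D : SkewShape ℓ} {N : ℕ} (P : Decomposition D N)
  (E : ∀ i, skewBoxes (P.lam i) (P.mu i) ≃ Fin (P.n i))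

/-- The filling of `D` obtained by filling each component with a consecutive block of numbers. -/
def concat : D.boxes ≃ Fin N :=
  P.e.trans ((Equiv.sigmaCongrRight E).trans (blockEquiv P.sum_n))

theorem concat_symm_block (i : Fin P.k) (j : Fin (P.n i)) :
    (concat P E).symm (block P.sum_n i j) = P.e.symm ⟨i, (E i).symm j⟩ := by
  rw [Equiv.symm_apply_eq, concat, Equiv.trans_apply, Equiv.apply_symm_apply, Equiv.trans_apply]
  change _ = block P.sum_n i (E i ((E i).symm j))
  rw [Equiv.apply_symm_apply]

theorem concat_symm (i : Fin P.k) (b : skewBoxes (P.lam i) (P.mu i)) :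
    concat P E (P.e.symm ⟨i, b⟩) = block P.sum_n i (E i b) := by
  rw [concat, Equiv.trans_apply, Equiv.apply_symm_apply]
  rfl

theorem flab_concat (i : Fin P.k) (j : Fin (P.n i)) :
    flab (concat P E) (block P.sum_n i j) =
      ((flab (E i) j).1 + P.α i, (flab (E i) j).2) := by
  rw [flab, flab, concat_symm_block, P.translate, Equiv.apply_symm_apply]
  simp only [Box.lab, Box.ct]
  congr 1
  ring

theorem le_of_component_le (i : Fin P.k) {b c : skewBoxes (P.lam i) (P.mu i)} :
    (P.e.symm ⟨i, b⟩).1.le (P.e.symm ⟨i, c⟩).1 ↔ b.1.le c.1 := by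
  rw [P.translate, P.translate (P.e.symm ⟨i, c⟩), Equiv.apply_symm_apply, Equiv.apply_symm_apply]
  constructor
  · rintro ⟨h, k, l, h1, h2⟩
    exact ⟨h, k, l, by linear_combination h1, by linear_combination h2⟩
  · rintro ⟨h, k, l, h1, h2⟩
    exact ⟨h, k, l, by linear_combination h1, by linear_combination h2⟩

/-- Comparable boxes lie in one component, and there a shuffle preserves the order of the entries.
-/
theorem isStd_concat_trans {w : Equiv.Perm (Fin N)} (hw : IsShuffle P.sum_n w)
    (hE : ∀ i, IsStd (E i)) : IsStd ((concat P E).trans w) := by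
  intro b c hbc
  obtain ⟨⟨i, b⟩, rfl⟩ := P.e.symm.surjective b
  obtain ⟨⟨i', c⟩, rfl⟩ := P.e.symm.surjective c
  obtain rfl : i = i' := by
    simpa using (P.component _ _).mpr (D.conn_of_le hbc)
  rw [Equiv.trans_apply, Equiv.trans_apply, concat_symm, concat_symm]
  exact (hw i).monotone (hE i b c ((le_of_component_le P i).mp hbc))

theorem isStd_concat_iff : IsStd (concat P E) ↔ ∀ i, IsStd (E i) := by
  refine ⟨fun h i b c hbc => ?_, fun h => ?_⟩
  · have := h _ _ ((le_of_component_le P i).mpr hbc)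
    rw [concat_symm, concat_symm] at this
    exact (block_strictMono P.sum_n i).le_iff_le.mp this
  · exact isStd_concat_trans P E (w := 1) (fun i => block_strictMono P.sum_n i) h

theorem concat_update (i : Fin P.k) (j j' : Fin (P.n i)) :
    concat P (Function.update E i ((E i).trans (Equiv.swap j j'))) =
      (concat P E).trans (Equiv.swap (block P.sum_n i j) (block P.sum_n i j')) := by
  ext b
  obtain ⟨⟨a, b⟩, rfl⟩ := P.e.symm.surjective b
  rw [Equiv.trans_apply, concat_symm, concat_symm]
  by_cases ha : a = i
  · subst ha
    rw [Function.update_self, Equiv.trans_apply, (block P.sum_n a).injective.swap_apply]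
  · rw [Function.update_of_ne ha, Equiv.swap_apply_of_ne_of_ne]
    · exact fun h => ha (congrArg Sigma.fst (block_inj P.sum_n h))
    · exact fun h => ha (congrArg Sigma.fst (block_inj P.sum_n h))

/-- A shuffle and the tableaux on the components are determined by the resulting tableau on `D`. -/
theorem concat_trans_injective {E E' : ∀ i, skewBoxes (P.lam i) (P.mu i) ≃ Fin (P.n i)}
    {w w' : Equiv.Perm (Fin N)} (hw : IsShuffle P.sum_n w) (hw' : IsShuffle P.sum_n w')
    (h : (concat P E).trans w = (concat P E').trans w') : w = w' ∧ E = E' := by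
  have hb : ∀ i b, w (block P.sum_n i (E i b)) = w' (block P.sum_n i (E' i b)) := by
    intro i b
    have := congrArg (fun F : D.boxes ≃ Fin N => F (P.e.symm ⟨i, b⟩)) h
    simpa only [Equiv.trans_apply, concat_symm] using this
  have hww : w = w' := by
    refine Equiv.ext fun x => ?_
    obtain ⟨i, j, rfl⟩ := exists_block P.sum_n x
    have hr : Set.range (fun j => w (block P.sum_n i j)) =
        Set.range fun j => w' (block P.sum_n i j) := by
      refine Set.Subset.antisymm ?_ ?_
      · rintro _ ⟨j, rfl⟩
        obtain ⟨b, rfl⟩ := (E i).surjective j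
        exact ⟨_, (hb i b).symm⟩
      · rintro _ ⟨j, rfl⟩
        obtain ⟨b, rfl⟩ := (E' i).surjective j
        exact ⟨_, hb i b⟩
    exact congrFun (((hw i).range_inj (hw' i)).mp hr) j
  refine ⟨hww, funext fun i => Equiv.ext fun b => ?_⟩
  subst hww
  exact (block P.sum_n i).injective (w.injective (hb i b))

theorem Decomposition.ncard_boxes_eq (P : Decomposition D N) : D.boxes.ncard = N := by
  have := fun i => (finite_skewBoxes (P.lam i) (P.mu i)).to_subtype
  rw [← P.sum_n, ← Nat.card_coe_set_eq, Nat.card_congr P.e, Nat.card_sigma]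
  refine Finset.sum_congr rfl fun i _ => ?_
  rw [Nat.card_coe_set_eq, ncard_skewBoxes (P.mu_le i), P.size_lam, P.size_mu,
    Nat.add_sub_cancel_left]

theorem Decomposition.nonempty_SYT (P : Decomposition D N) : Nonempty (SYT D.boxes N) :=
  exists_SYT _ D.finite P.ncard_boxes_eq

end

/-! ### The modules S^D in seminormal form -/

section

variable {ℓ : ℕ} [NeZero ℓ] {ζ : ℂ} (hζ : IsPrimitiveRoot ζ ℓ) {D : SkewShape ℓ} {N : ℕ}
  (P : Decomposition D N)

/-- The tensor product of the modules `S^{λ_i∖μ_i}`. -/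
abbrev SkewTensor (ζ : ℂ) (P : Decomposition D N) : Type :=
  PiTensorProduct ℂ fun i => SkewHom ζ (P.lam i) (P.mu i) (P.m i) (P.n i)

variable {P} (Θ : ∀ i, YoungSpace (skewBoxes (P.lam i) (P.mu i)) (P.n i) ≃ₗ[ℂ]
  SkewHom ζ (P.lam i) (P.mu i) (P.m i) (P.n i))

/-- The basis of the tensor product indexed by the families of tableaux on the components. -/
def tensorBasis : Module.Basis (∀ i, SYT (skewBoxes (P.lam i) (P.mu i)) (P.n i)) ℂ
    (SkewTensor ζ P) :=
  Basis.piTensorProduct fun i => (youngBasis _ _).map (Θ i)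

theorem tensorBasis_apply (T : ∀ i, SYT (skewBoxes (P.lam i) (P.mu i)) (P.n i)) :
    tensorBasis Θ T = PiTensorProduct.tprod ℂ fun i => Θ i (youngVec (T i).fill) := by
  rw [tensorBasis, Basis.piTensorProduct_apply]
  simp only [Module.Basis.map_apply, youngVec_std]

/-- The map `⊗ v_{T_i} ↦ v_T`, with `T` the concatenation of the `T_i`. -/
def concatMap : SkewTensor ζ P →ₗ[ℂ] YoungModule hζ D N :=
  (tensorBasis Θ).constr ℂ fun T => yVec hζ D (concat P fun i => (T i).fill)

/-- If some filling is not standard, both sides are zero. Having the formula for all fillings lets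
the exchanges be computed without case distinctions. -/
theorem concatMap_tprod (E : ∀ i, skewBoxes (P.lam i) (P.mu i) ≃ Fin (P.n i)) :
    concatMap hζ Θ (PiTensorProduct.tprod ℂ fun i => Θ i (youngVec (E i))) =
      yVec hζ D (concat P E) := by
  by_cases h : ∀ i, IsStd (E i)
  · choose T hT using fun i => (h i).exists_fill
    obtain rfl : (fun i => (T i).fill) = E := funext hT
    rw [← tensorBasis_apply, concatMap, Module.Basis.constr_basis]
  · have h' : yVec hζ D (concat P E) = 0 :=
      youngVec_eq_zero (mt (isStd_concat_iff P E).mp h)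
    push Not at h
    obtain ⟨i, hi⟩ := h
    rw [h', MultilinearMap.map_coord_zero _ i (by rw [youngVec_eq_zero hi, map_zero]), map_zero]

theorem tensor_ext {V : Type*} [AddCommGroup V] [Module ℂ V] {f g : SkewTensor ζ P →ₗ[ℂ] V}
    (h : ∀ E : ∀ i, skewBoxes (P.lam i) (P.mu i) ≃ Fin (P.n i),
      f (PiTensorProduct.tprod ℂ fun i => Θ i (youngVec (E i))) =
        g (PiTensorProduct.tprod ℂ fun i => Θ i (youngVec (E i)))) : f = g :=
  (tensorBasis Θ).ext fun T => by rw [tensorBasis_apply, h]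

theorem map_update_tprod (i : Fin P.k)
    (a : Module.End ℂ (SkewHom ζ (P.lam i) (P.mu i) (P.m i) (P.n i)))
    (x : ∀ i, SkewHom ζ (P.lam i) (P.mu i) (P.m i) (P.n i)) :
    PiTensorProduct.map (Function.update (fun _ => LinearMap.id) i a)
      (PiTensorProduct.tprod ℂ x) = PiTensorProduct.tprod ℂ (Function.update x i (a (x i))) := by
  rw [PiTensorProduct.map_tprod]
  congr 1
  funext j
  by_cases hj : j = i
  · subst hj
    rw [Function.update_self, Function.update_self]
  · rw [Function.update_of_ne hj, Function.update_of_ne hj]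
    rfl

theorem update_tensor (E : ∀ i, skewBoxes (P.lam i) (P.mu i) ≃ Fin (P.n i)) (i : Fin P.k)
    (F : skewBoxes (P.lam i) (P.mu i) ≃ Fin (P.n i)) :
    Function.update (fun i => Θ i (youngVec (E i))) i (Θ i (youngVec F)) =
      fun j => Θ j (youngVec (Function.update E i F j)) := by
  funext j
  by_cases hj : j = i
  · subst hj
    rw [Function.update_self, Function.update_self]
  · rw [Function.update_of_ne hj, Function.update_of_ne hj]

variable (hΘ : ∀ i a v, skewAct ζ (P.lam i) (P.mu i) (P.m i) (P.n i) a (Θ i v) =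
  Θ i (skewYoungAct hζ (P.lam i) (P.mu i) (P.n i) a v))

/-- The action on the `i`-th tensor factor. -/
abbrev twistAct (ζ : ℂ) (P : Decomposition D N) (i : Fin P.k) :
    H ℓ (P.n i) →ₐ[ℂ] Module.End ℂ (SkewHom ζ (P.lam i) (P.mu i) (P.m i) (P.n i)) :=
  (skewAct ζ (P.lam i) (P.mu i) (P.m i) (P.n i)).comp (twist ℓ (P.n i) (ℓ * P.α i))

include hΘ

theorem concatMap_u (i : Fin P.k) (j : Fin (P.n i)) (x : SkewTensor ζ P) :
    concatMap hζ Θ (PiTensorProduct.map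
      (Function.update (fun _ => LinearMap.id) i (twistAct ζ P i (u ℓ j))) x) =
        u ℓ (block P.sum_n i j) • concatMap hζ Θ x := by
  suffices h : concatMap hζ Θ ∘ₗ PiTensorProduct.map
      (Function.update (fun _ => LinearMap.id) i (twistAct ζ P i (u ℓ j))) =
      DistribSMul.toLinearMap ℂ _ (u ℓ (block P.sum_n i j)) ∘ₗ concatMap hζ Θ from
    LinearMap.congr_fun h x
  refine tensor_ext Θ fun E => ?_
  rw [LinearMap.comp_apply, LinearMap.comp_apply, map_update_tprod, concatMap_tprod,
    DistribSMul.toLinearMap_apply, u_smul_yVec, flab_concat, AlgHom.comp_apply, twist_u, map_add,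
    AlgHom.commutes, LinearMap.add_apply, hΘ, skewYoungAct_u, youngU, diagOp_apply, map_smul,
    Module.algebraMap_end_apply, ← add_smul, MultilinearMap.map_update_smul,
    Function.update_eq_self, map_smul, concatMap_tprod, mul_add]

theorem concatMap_zetaPow (i : Fin P.k) (j : Fin (P.n i)) (c : ZMod ℓ) (x : SkewTensor ζ P) :
    concatMap hζ Θ (PiTensorProduct.map
      (Function.update (fun _ => LinearMap.id) i (twistAct ζ P i (gp (zetaPow j c)))) x) =
        (gp (zetaPow (block P.sum_n i j) c) : H ℓ N) • concatMap hζ Θ x := by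
  suffices h : concatMap hζ Θ ∘ₗ PiTensorProduct.map
      (Function.update (fun _ => LinearMap.id) i (twistAct ζ P i (gp (zetaPow j c)))) =
      DistribSMul.toLinearMap ℂ _ (gp (zetaPow (block P.sum_n i j) c) : H ℓ N) ∘ₗ
      concatMap hζ Θ from
    LinearMap.congr_fun h x
  refine tensor_ext Θ fun E => ?_
  rw [LinearMap.comp_apply, LinearMap.comp_apply, map_update_tprod, concatMap_tprod,
    DistribSMul.toLinearMap_apply, zetaPow_smul_yVec, flab_concat, AlgHom.comp_apply, twist_gp,
    hΘ, skewYoungAct_zetaPow, diagOp_apply, map_smul, MultilinearMap.map_update_smul,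
    Function.update_eq_self, map_smul, concatMap_tprod]

theorem concatMap_s (i : Fin P.k) {j j' : Fin (P.n i)} (hj : (j' : ℕ) = j + 1)
    (x : SkewTensor ζ P) :
    concatMap hζ Θ (PiTensorProduct.map
      (Function.update (fun _ => LinearMap.id) i (twistAct ζ P i (gp (s j j')))) x) =
        (gp (s (block P.sum_n i j) (block P.sum_n i j')) : H ℓ N) • concatMap hζ Θ x := by
  have hj' : (block P.sum_n i j' : ℕ) = block P.sum_n i j + 1 := by
    rw [block_val, block_val, hj, add_assoc]
  suffices h : concatMap hζ Θ ∘ₗ PiTensorProduct.map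
      (Function.update (fun _ => LinearMap.id) i (twistAct ζ P i (gp (s j j')))) =
      DistribSMul.toLinearMap ℂ _
      (gp (s (block P.sum_n i j) (block P.sum_n i j')) : H ℓ N) ∘ₗ
      concatMap hζ Θ from
    LinearMap.congr_fun h x
  refine tensor_ext Θ fun E => ?_
  rw [LinearMap.comp_apply, LinearMap.comp_apply, map_update_tprod, concatMap_tprod,
    DistribSMul.toLinearMap_apply, s_smul_yVec hζ D hj', flab_concat, flab_concat, eLab_add,
    xLab_add, ← concat_update, AlgHom.comp_apply, twist_gp, hΘ, skewYoungAct_s hζ hj,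
    skewYoungS_apply _ _ hj, map_add, map_smul, map_smul, MultilinearMap.map_update_add,
    MultilinearMap.map_update_smul, MultilinearMap.map_update_smul, Function.update_eq_self,
    update_tensor, map_add, map_smul, map_smul, concatMap_tprod, concatMap_tprod]

omit hΘ

/-- The module `S^D` has a basis of eigenvectors on which `H_{ℓ,n}` acts by the formulas of Young's
seminormal form; in particular it does not depend on the choices. -/
theorem nonempty_SD_equiv (P : Decomposition D N) :
    Nonempty (SD ζ P ≃ₗ[H ℓ N] YoungModule hζ D N) := by
  choose Θ hΘ using fun i => exists_skewHom_equiv (n := P.n i) hζ (P.mu_le i) (P.size_mu i)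
  obtain ⟨Φ, hΦ⟩ := exists_indLift P.sum_n (twistAct ζ P) (concatMap hζ Θ) fun i =>
    intertwine_of_generators P.sum_n (twistAct ζ P) _ i (concatMap_u hζ Θ hΘ i)
      (fun j j' hj => concatMap_s hζ Θ hΘ i hj) (concatMap_zetaPow hζ Θ hΘ i)
  have hΦ' : ∀ E, Φ (indUnit P.sum_n (twistAct ζ P)
      (PiTensorProduct.tprod ℂ fun i => Θ i (youngVec (E i)))) = yVec hζ D (concat P E) :=
    fun E => (hΦ _).trans (concatMap_tprod hζ Θ E)
  have hT : ∀ i, Nonempty (SYT (skewBoxes (P.lam i) (P.mu i)) (P.n i)) := fun i =>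
    exists_SYT _ (finite_skewBoxes _ _) (by
      rw [ncard_skewBoxes (P.mu_le i), P.size_lam, P.size_mu, Nat.add_sub_cancel_left])
  have hne := P.nonempty_SYT
  have hsimple := youngModule_isSimple (D := D) (n := N) hζ
  -- The target is simple and Φ is nonzero, as it hits the vector of a concatenated standard
  -- tableau.
  have hsurj : Function.Surjective Φ := by
    refine LinearMap.surjective_of_ne_zero fun h0 => ?_
    have h := hΦ' fun i => (hT i).some.fill
    obtain ⟨S, hS⟩ := ((isStd_concat_iff P _).mpr fun i => (hT i).some.isStd_fill).exists_fill
    rw [h0, LinearMap.zero_apply, ← hS, ← yBasis_apply] at h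
    exact (yBasis hζ D N).ne_zero S h.symm
  have hspan := span_shuffle P.sum_n (twistAct ζ P) (tensorBasis Θ)
  have hfin : Module.Finite ℂ (SD ζ P) := ⟨by
    rw [← hspan]
    exact Submodule.fg_span (Set.finite_range _)⟩
  have hfin' : Module.Finite ℂ (YoungModule hζ D N) := Module.Finite.of_basis (yBasis hζ D N)
  -- Pairs of a shuffle and a family of tableaux on the components give distinct standard tableaux
  -- on D, so the spanning set of the induced module is no larger than the basis of the target. No
  -- basis of H_{ℓ,n} is needed.
  have hle : Module.finrank ℂ (SD ζ P) ≤ Module.finrank ℂ (YoungModule hζ D N) := by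
    have := Fintype.ofFinite ({w // IsShuffle P.sum_n w} ×
      ∀ i, SYT (skewBoxes (P.lam i) (P.mu i)) (P.n i))
    rw [Module.finrank_eq_nat_card_basis (yBasis hζ D N), ← finrank_top, ← hspan]
    refine (finrank_range_le_card _).trans ?_
    rw [← Nat.card_eq_fintype_card]
    choose g hg using fun p : {w // IsShuffle P.sum_n w} ×
      (∀ i, SYT (skewBoxes (P.lam i) (P.mu i)) (P.n i)) =>
        (isStd_concat_trans P _ p.1.2 fun i => (p.2 i).isStd_fill).exists_fill
    refine Nat.card_le_card_of_injective g fun p p' h => ?_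
    have e := concat_trans_injective P p.1.2 p'.1.2
      ((hg p).symm.trans ((congrArg SYT.fill h).trans (hg p')))
    exact Prod.ext (Subtype.ext e.1) (funext fun i => Subtype.ext (congrFun e.2 i))
  have hinj : Function.Injective (Φ.restrictScalars ℂ) :=
    (LinearMap.injective_iff_surjective_of_finrank_eq_finrank (le_antisymm hle
      (LinearMap.finrank_le_finrank_of_surjective (f := Φ.restrictScalars ℂ) hsurj))).mpr hsurj
  exact ⟨LinearEquiv.ofBijective Φ ⟨hinj, hsurj⟩⟩

end


/-! ### Comparison of weights and classification -/

section

variable {ℓ n : ℕ} [NeZero ℓ] {ζ : ℂ} (hζ : IsPrimitiveRoot ζ ℓ)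

theorem isWt_of_exponents (hζ : IsPrimitiveRoot ζ ℓ) {M : Type*} [AddCommGroup M] [Module ℂ M]
    [Module (H ℓ n) M] (m : M) (a : Fin n → ℂ) (b : Fin n → ℤ) (ha : ∀ i, u ℓ i • m = a i • m)
    (hb : ∀ i, z ℓ i • m = ζ ^ b i • m) :
    IsWt ζ (fun i => (a i / ℓ, (b i : ZMod ℓ))) m := by
  intro i
  refine ⟨?_, ?_⟩
  · rw [ha, mul_div_cancel₀ _ (NeZero.ne (ℓ : ℂ))]
  · have h0 : ζ ≠ 0 := hζ.ne_zero (NeZero.ne ℓ)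
    rw [hb, ← zpow_natCast, ZMod.val_intCast]
    congr 1
    conv_lhs => rw [← Int.emod_add_mul_ediv (b i) ℓ]
    rw [zpow_add₀ h0, zpow_mul, zpow_natCast, hζ.pow_eq_one, one_zpow, mul_one]

theorem wt_eq_iff {D : SkewShape ℓ} (T : SYT D.boxes n) (a : Fin n → ℂ) (b : Fin n → ℤ) :
    T.wt = (fun i => (a i / ℓ, (b i : ZMod ℓ))) ↔
      ∀ i, a i = ℓ * (T.box i).ct ∧ (b i : ZMod ℓ) = (T.box i).β := by
  rw [funext_iff]
  refine forall_congr' fun i => Prod.ext_iff.trans (and_congr ?_ eq_comm)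
  rw [eq_div_iff (NeZero.ne (ℓ : ℂ)), eq_comm, mul_comm]
  rfl

include hζ

theorem isSimple_SD {D : SkewShape ℓ} (P : Decomposition D n) :
    IsSimpleModule (H ℓ n) (SD ζ P) := by
  have := P.nonempty_SYT
  have := youngModule_isSimple (D := D) (n := n) hζ
  exact IsSimpleModule.congr (nonempty_SD_equiv hζ P).some

theorem isUDiagonalizable_SD {D : SkewShape ℓ} (P : Decomposition D n) :
    IsUDiagonalizable ℓ n (SD ζ P) := by
  obtain ⟨Ψ⟩ := nonempty_SD_equiv hζ P
  obtain ⟨ι, v, hv⟩ := youngModule_isUDiagonalizable (D := D) (n := n) hζ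
  refine ⟨ι, v.map (Ψ.symm.restrictScalars ℂ), fun i h hh => ?_⟩
  obtain ⟨c, hc⟩ := hv i h hh
  refine ⟨c, ?_⟩
  rw [Module.Basis.map_apply]
  exact (map_smul Ψ.symm h (v i)).symm.trans
    ((congrArg Ψ.symm hc).trans ((Ψ.symm.restrictScalars ℂ).map_smul c (v i)))

theorem exists_isWt_SD {D : SkewShape ℓ} (P : Decomposition D n) (T : SYT D.boxes n) :
    ∃ x : SD ζ P, x ≠ 0 ∧ IsWt ζ T.wt x := by
  obtain ⟨Ψ⟩ := nonempty_SD_equiv hζ P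
  exact ⟨Ψ.symm (yBasis hζ D n T),
    (Ψ.symm.map_ne_zero_iff).mpr ((yBasis hζ D n).ne_zero T),
    (isWt_yBasis hζ T).map Ψ.symm.toLinearMap⟩

/-- An isomorphism carries the weight of a tableau on D to one of a tableau on D', and equal labels
mean a slide. Conversely a slide carries tableaux along with their labels, and simple modules with a
common weight are isomorphic. -/
theorem nonempty_SD_equiv_SD_iff {D D' : SkewShape ℓ} (P : Decomposition D n)
    (P' : Decomposition D' n) :
    Nonempty (SD ζ P ≃ₗ[H ℓ n] SD ζ P') ↔ ∃ e : D.boxes ≃ D'.boxes, IsSlide D D' e := by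
  obtain ⟨T⟩ := P.nonempty_SYT
  obtain ⟨x, hx0, hx⟩ := exists_isWt_SD hζ P T
  constructor
  · rintro ⟨Ψ⟩
    obtain ⟨Ψ'⟩ := nonempty_SD_equiv hζ P'
    obtain ⟨T', hT'⟩ := exists_wt_eq_of_isWt hζ (hx.map (Ψ.trans Ψ').toLinearMap)
      ((Ψ.trans Ψ').map_ne_zero_iff.mpr hx0)
    exact ⟨_, SYT.isSlide_of_wt_eq T T' hT'⟩
  · rintro ⟨e, he⟩
    obtain ⟨T', hT'⟩ := he.exists_SYT T
    obtain ⟨x', hx0', hx'⟩ := exists_isWt_SD hζ P' T'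
    have := isSimple_SD hζ P
    have := isSimple_SD hζ P'
    exact nonempty_equiv_of_common_weight hζ (isUDiagonalizable_SD hζ P).uSemi
      (isUDiagonalizable_SD hζ P').uSemi hx (hT' ▸ hx') hx0 hx0'

end

end SkewHecke

theorem theorem1p1 (ℓ n : ℕ) [NeZero ℓ] (ζ : ℂ) (hζ : IsPrimitiveRoot ζ ℓ) :
    -- the weight of a weight vector determines a tableau, and `M ≅ S^D`
    (∀ (M : Type*) [AddCommGroup M] [Module ℂ M] [Module (SkewHecke.H ℓ n) M] [IsScalarTower ℂ (SkewHecke.H ℓ n) M],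
      IsSimpleModule (SkewHecke.H ℓ n) M → SkewHecke.IsUDiagonalizable ℓ n M →
      ∀ (m : M) (a : Fin n → ℂ) (b : Fin n → ℤ), m ≠ 0 →
        (∀ i, SkewHecke.u ℓ i • m = a i • m) → (∀ i, SkewHecke.z ℓ i • m = ζ ^ b i • m) →
        ∃ (D : SkewHecke.SkewShape ℓ) (T : SkewHecke.SYT D.boxes n),
          (∀ i, a i = ℓ * (T.box i).ct ∧ (b i : ZMod ℓ) = (T.box i).β) ∧
          (Nonempty (SkewHecke.Decomposition D n) ∧
            ∀ P : SkewHecke.Decomposition D n, Nonempty (M ≃ₗ[SkewHecke.H ℓ n] SkewHecke.SD ζ P)) ∧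
          ∀ (D' : SkewHecke.SkewShape ℓ) (T' : SkewHecke.SYT D'.boxes n),
            (∀ i, a i = ℓ * (T'.box i).ct ∧ (b i : ZMod ℓ) = (T'.box i).β) →
            ∃ e : D.boxes ≃ D'.boxes, SkewHecke.IsSlide D D' e ∧ ∀ x, T'.1 (e x) = T.1 x) ∧
    -- every `S^D` occurs
    (∀ D : SkewHecke.SkewShape ℓ, D.boxes.ncard = n → Nonempty (SkewHecke.Decomposition D n) ∧
      ∀ P : SkewHecke.Decomposition D n, IsSimpleModule (SkewHecke.H ℓ n) (SkewHecke.SD ζ P) ∧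
        SkewHecke.IsUDiagonalizable ℓ n (SkewHecke.SD ζ P)) ∧
    -- isomorphism classes of modules correspond to shapes up to slides
    (∀ (D D' : SkewHecke.SkewShape ℓ) (P : SkewHecke.Decomposition D n) (P' : SkewHecke.Decomposition D' n),
      Nonempty (SkewHecke.SD ζ P ≃ₗ[SkewHecke.H ℓ n] SkewHecke.SD ζ P') ↔ ∃ e : D.boxes ≃ D'.boxes, SkewHecke.IsSlide D D' e) := by
  refine ⟨fun M _ _ _ _ hM hdiag m a b hm ha hb => ?_, fun D hD => ?_, fun D D' P P' =>
    SkewHecke.nonempty_SD_equiv_SD_iff hζ P P'⟩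
  · have hwt := SkewHecke.isWt_of_exponents hζ m a b ha hb
    obtain ⟨D, T, hT⟩ := hwt.exists_SYT hζ hdiag.uSemi hm
    refine ⟨D, T, (SkewHecke.wt_eq_iff T a b).mp hT, ⟨?_, fun P => ?_⟩, fun D' T' hT' => ?_⟩
    · refine D.nonempty_decomposition ?_
      rw [← Nat.card_coe_set_eq, Nat.card_congr T.fill, Nat.card_fin]
    -- The tableau T gives S^D a weight vector with the weight of m, whatever the decomposition.
    · obtain ⟨x, hx0, hx⟩ := SkewHecke.exists_isWt_SD hζ P T
      have := SkewHecke.isSimple_SD hζ P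
      exact SkewHecke.nonempty_equiv_of_common_weight hζ hdiag.uSemi
        (SkewHecke.isUDiagonalizable_SD hζ P).uSemi hwt (hT ▸ hx) hm hx0
    · refine ⟨_, T.isSlide_of_wt_eq T' (((SkewHecke.wt_eq_iff T' a b).mpr hT').trans hT.symm),
        fun x => ?_⟩
      exact T'.fill.apply_symm_apply _
  · exact ⟨D.nonempty_decomposition hD, fun P =>
      ⟨SkewHecke.isSimple_SD hζ P, SkewHecke.isUDiagonalizable_SD hζ P⟩⟩
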